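/- Let $g=\begin{pmatrix} a&b\\ c&d\end{pmatrix}\in SL_2(\mathbb Z)$ with $a+d>2$ and $c\ge a+d+2$, let $\theta\in\mathbb R$ be a fixed point of $g$ (i.e. $a\theta+b=\theta(c\theta+d)$), and let $\tau\in\mathbb C$ with $\operatorname{Im}\tau<0$. *The ring.* For $h=\begin{pmatrix} a_h&b_h\\ c_h&d_h\end{pmatrix}\in SL_2(\mathbb Z)$ with $c_h>0$ and $j(h,\theta):=c_h\theta+d_h>0$ let $\mathcal H_h(\theta)$ be the space of $f\in\mathcal S(\mathbb R\times\mathbb Z/c_h\mathbb Z)$ with $\bar\nabla_0 f=0$, where $\bar\nabla_0 f=\frac{\partial f}{\partial x}+2\pi i\,\frac{c_h\tau}{c_h\theta+d_h}\,x f$; it has the basis $\varphi_\alpha(x,\beta)=\exp\bigl(-\pi i\frac{c_h\tau}{c_h\theta+d_h}x^2\bigr)\delta_\alpha^\beta$, $\alpha\in\mathbb Z/c_h\mathbb Z$. The tensor product of basic modules over the noncommutative torus is given by the pairing $$t_{g_1,g_2}(f_1\otimes f_2)(x,\gamma)=\sum_{k\in\mathbb Z} f_1\Bigl(\tfrac{x}{j(g_2,\theta)}+j(g_1,g_2\theta)\bigl(\tfrac{k}{c_1}-\tfrac{\gamma}{c_{12}}\bigr),\,k\Bigr)\,f_2\Bigl(x-\tfrac{c_1}{c_2}\bigl(\tfrac{k}{c_1}-\tfrac{\gamma}{c_{12}}\bigr),\,\gamma-a_2k\Bigr),$$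 where $a_2$ is the upper left entry of $g_2$ and $c_1,c_2,c_{12}$ are the lower left entries of $g_1,g_2,g_1g_2$. The homogeneous coordinate ring of the noncommutative torus $\mathbb T_{\theta,\tau}$ is the graded $\mathbb C$-algebra $B_g(\theta,\tau)=\bigoplus_{n\ge0}\mathcal H_{g^n}(\theta)$ with $\mathcal H_{g^0}=\mathbb C$ and product $t_{g^m,g^n}$ in positive degrees. *The coefficients.* Put $\vartheta_r(\tau)=\sum_{n\in\mathbb Z}\exp(\pi i(n+r)^2\tau)$, $\tau'=-c(a+d)\tau$, $q(\mu)=\frac{d\mu}{c}-\frac{\mu}{c(a+d)}+\frac1{a+d}$, $\Lambda_{i,j}=-\frac{dj}{c}-\frac{i}{a+d}$. For $\mu\in\{1,\dots,c\}$ let $M(\mu)$ be the $(a+d)\times c$ matrix with entries $M(\mu)_{i,j}=\vartheta_{q(\mu)+\Lambda_{i,j}}(\tau')$, and for $i_1,\dots,i_{a+d}\in\{1,\dots,c\}$ let $F^{g,\mu}_{i_1,\dots,i_{a+d}}$ be the determinant of the matrix formed by the columns $i_1,\dots,i_{a+d}$ of $M(\mu)$, in this order. For $\mu,j\in\{1,\dots,c\}$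 let $\alpha(\mu,j)\in\{1,\dots,c\}$ be congruent to $d(\mu-j)$ modulo $c$. **Theorem.** (1) For every $\mu$ there is an ordering (permutation) $\sigma_\mu$ of the columns $\{1,\dots,c\}$ with $F^{g,\mu}_{\sigma_\mu(1),\dots,\sigma_\mu(a+d)}\ne0$. If $a+d$ is odd, $\sigma_\mu=\mathrm{id}$ has this property for every $\mu$. (2) Choose any such orderings $\sigma_\mu$. For $\mu\in\{1,\dots,c\}$ and $k\in\{1,\dots,c-a-d\}$ define $v^{\mu,k}\in\mathbb C^c$ by $$v^{\mu,k}_{\sigma_\mu(j)}=\begin{cases}F^{g,\mu}_{\sigma_\mu(1),\dots,\sigma_\mu(j-1),\,\sigma_\mu(a+d+k),\,\sigma_\mu(j+1),\dots,\sigma_\mu(a+d)}&1\le j\le a+d,\\ -F^{g,\mu}_{\sigma_\mu(1),\dots,\sigma_\mu(a+d)}&j=a+d+k,\\ 0&\text{otherwise.}\end{cases}$$ Then $B_g(\theta,\tau)$ is the $\mathbb C$-algebra generated by elements $x_1,\dots,x_c$ of degree one subject to the $c(c-a-d)$ quadratic relations $$f^\mu_k=\sum_{j=1}^c v^{\mu,k}_j\,x_{\alpha(\mu,j)}\,x_j=0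 .$$ More precisely, there is an isomorphism of $\mathbb C$-algebras $\mathbb C\langle x_1,\dots,x_c\rangle/(f^\mu_k)\to B_g(\theta,\tau)$ which sends $x_i$ to the basis element $\varphi_i\in\mathcal H_g(\theta)$. -/

import Mathlib

open scoped BigOperators ContDiff SchwartzMap

noncomputable section

namespace NCTorus

/-! ### Basic modules, holomorphic sections and the pairing of basic modules -/

/-- The group `SL₂(ℤ)`. -/
abbrev SL2Z := Matrix.SpecialLinearGroup (Fin 2) ℤ

/-- `cθ + d` for `g = (a b; c d)`. -/
def autFactor (g : SL2Z) (θ : ℝ) : ℝ := g 1 0 * θ + g 1 1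

/-- The fractional linear action `gθ = (aθ + b)/(cθ + d)`. -/
def moebius (g : SL2Z) (θ : ℝ) : ℝ := (g 0 0 * θ + g 0 1) / autFactor g θ

/-- The space `𝓢(ℝ × ℤ/cℤ)` underlying the basic module `E_g(θ)`, where `c = deg g`: a function
on `ℝ × ℤ/cℤ` is written as a `c`-periodic sequence of functions on `ℝ`
(`f α x` stands for `f(x, α)`). -/
def basicModule (g : SL2Z) : Submodule ℂ (ℤ → ℝ → ℂ) where
  carrier := {f | (∀ α, f (α + g 1 0) = f α) ∧ ∀ α, ∃ s : 𝓢(ℝ, ℂ), ⇑s = f α}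
  zero_mem' := ⟨fun _ => rfl, fun _ => ⟨0, rfl⟩⟩
  add_mem' := by
    rintro f h ⟨hf, hf'⟩ ⟨hh, hh'⟩
    refine ⟨fun α => by simp [hf α, hh α], fun α => ?_⟩
    obtain ⟨s, hs⟩ := hf' α
    obtain ⟨t, ht⟩ := hh' α
    exact ⟨s + t, by rw [Pi.add_apply, ← hs, ← ht]; rfl⟩
  smul_mem' := by
    rintro z f ⟨hf, hf'⟩
    refine ⟨fun α => by simp [hf α], fun α => ?_⟩
    obtain ⟨s, hs⟩ := hf' α
    exact ⟨z • s, by rw [Pi.smul_apply, ← hs]; rfl⟩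

/-- The standard holomorphic structure `∇̄₀ f = ∂f/∂x + 2πi (cτ/(cθ+d)) x f` on `E_g(θ)`. -/
def nablaBar (g : SL2Z) (θ : ℝ) (τ : ℂ) (f : ℤ → ℝ → ℂ) : ℤ → ℝ → ℂ := fun α x =>
  deriv (f α) x + 2 * Real.pi * Complex.I * (g 1 0 * τ / autFactor g θ * x) * f α x

/-- `𝓗_g(θ) = ker ∇̄₀`, the space of holomorphic sections of `E_g(θ)`. -/
def holSections (g : SL2Z) (θ : ℝ) (τ : ℂ) : Submodule ℂ (ℤ → ℝ → ℂ) where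
  carrier := {f | f ∈ basicModule g ∧ nablaBar g θ τ f = 0}
  zero_mem' := ⟨zero_mem _, by funext α x; simp [nablaBar]⟩
  add_mem' := by
    rintro f h ⟨hf, hf'⟩ ⟨hh, hh'⟩
    refine ⟨add_mem hf hh, ?_⟩
    funext α x
    obtain ⟨s, hs⟩ := hf.2 α
    obtain ⟨t, ht⟩ := hh.2 α
    have h1 := congrFun (congrFun hf' α) x
    have h2 := congrFun (congrFun hh' α) x
    simp only [nablaBar, Pi.zero_apply, Pi.add_apply] at h1 h2 ⊢
    have h3 : deriv (f α + h α) x = deriv (f α) x + deriv (h α) x :=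
      deriv_add (hs ▸ s.differentiableAt) (ht ▸ t.differentiableAt)
    rw [h3]
    linear_combination h1 + h2
  smul_mem' := by
    rintro z f ⟨hf, hf'⟩
    refine ⟨Submodule.smul_mem _ _ hf, ?_⟩
    funext α x
    obtain ⟨s, hs⟩ := hf.2 α
    have h1 := congrFun (congrFun hf' α) x
    simp only [nablaBar, Pi.zero_apply, Pi.smul_apply] at h1 ⊢
    have h3 : deriv (z • f α) x = z • deriv (f α) x :=
      deriv_const_smul z (hs ▸ s.differentiableAt)
    rw [h3, smul_eq_mul, smul_eq_mul]
    linear_combination z * h1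

/-- The pairing `t_{g₁,g₂} : E_{g₁}(g₂θ) ⊗ E_{g₂}(θ) → E_{g₁g₂}(θ)` of basic modules, which
identifies `E_{g₁g₂}(θ)` with the tensor product of `E_{g₁}(g₂θ)` and `E_{g₂}(θ)` over the algebra
of the noncommutative torus with parameter `g₂θ`. -/
def pairing (g₁ g₂ : SL2Z) (θ : ℝ) (f₁ f₂ : ℤ → ℝ → ℂ) : ℤ → ℝ → ℂ := fun γ x =>
  ∑' k : ℤ,
    f₁ k (x / autFactor g₂ θ + autFactor g₁ (moebius g₂ θ) *
      ((k : ℝ) / g₁ 1 0 - (γ : ℝ) / (g₁ * g₂) 1 0)) *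
    f₂ (γ - g₂ 0 0 * k) (x - (g₁ 1 0 : ℝ) / g₂ 1 0 *
      ((k : ℝ) / g₁ 1 0 - (γ : ℝ) / (g₁ * g₂) 1 0))

/-- The section `φ_α(x, β) = exp(-πi (cτ/(cθ+d)) x²) δ_α^β` of `E_g(θ)`, where the Kronecker
symbol is that of `ℤ/cℤ`. -/
def basisSection (g : SL2Z) (θ : ℝ) (τ : ℂ) (α : ℤ) : ℤ → ℝ → ℂ := fun β x =>
  if β ≡ α [ZMOD g 1 0] then
    Complex.exp (-(Real.pi * Complex.I * (g 1 0 * τ / autFactor g θ)) * (x : ℂ) ^ 2) else 0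

/-! ### Gaussians -/

lemma iteratedDeriv_gauss (A : ℂ) (n : ℕ) : ∃ P : Polynomial ℂ,
    iteratedDeriv n (fun x : ℝ => Complex.exp (-A * (x : ℂ) ^ 2)) =
      fun x : ℝ => P.eval (x : ℂ) * Complex.exp (-A * (x : ℂ) ^ 2) := by
  induction n with
  | zero => exact ⟨1, by simp⟩
  | succ n ih =>
    obtain ⟨P, hP⟩ := ih
    refine ⟨P.derivative + P * (Polynomial.C (-A * 2) * Polynomial.X), ?_⟩
    rw [iteratedDeriv_succ, hP]
    funext x
    have h1 : HasDerivAt (fun z : ℂ => P.eval z * Complex.exp (-A * z ^ 2))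
        (P.derivative.eval (x : ℂ) * Complex.exp (-A * (x : ℂ) ^ 2) +
          P.eval (x : ℂ) * (Complex.exp (-A * (x : ℂ) ^ 2) * (-A * (2 * (x : ℂ))))) (x : ℂ) := by
      refine (P.hasDerivAt _).mul (HasDerivAt.cexp ?_)
      simpa using (hasDerivAt_pow 2 (x : ℂ)).const_mul (-A)
    rw [h1.comp_ofReal.deriv]
    simp only [Polynomial.eval_add, Polynomial.eval_mul, Polynomial.eval_C, Polynomial.eval_X]
    ring

lemma norm_gauss (A : ℂ) (x : ℝ) :
    ‖Complex.exp (-A * (x : ℂ) ^ 2)‖ = Real.exp (-A.re * x ^ 2) := by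
  rw [Complex.norm_exp, ← Complex.ofReal_pow, Complex.re_mul_ofReal, Complex.neg_re]

lemma pow_mul_exp_bound {a : ℝ} (ha : 0 < a) (k : ℕ) :
    ∃ C : ℝ, ∀ x : ℝ, |x| ^ k * Real.exp (-a * x ^ 2) ≤ C := by
  refine ⟨1 + k.factorial / a ^ k, fun x => ?_⟩
  have h1 : |x| ^ k ≤ 1 + (x ^ 2) ^ k := by
    rcases le_total |x| 1 with h | h
    · have := pow_le_one₀ (n := k) (abs_nonneg x) h
      have : 0 ≤ (x ^ 2) ^ k := by positivity
      linarith
    · have : |x| ^ k ≤ (|x| ^ 2) ^ k := by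
        apply pow_le_pow_left₀ (abs_nonneg x)
        nlinarith
      rw [sq_abs] at this
      linarith
  have h2 : (a * x ^ 2) ^ k / k.factorial ≤ Real.exp (a * x ^ 2) :=
    Real.pow_div_factorial_le_exp _ (by positivity) k
  have h3 : (x ^ 2) ^ k ≤ k.factorial / a ^ k * Real.exp (a * x ^ 2) := by
    rw [mul_pow, div_le_iff₀ (by positivity)] at h2
    rw [div_mul_eq_mul_div, le_div_iff₀ (by positivity)]
    linarith
  have h4 : Real.exp (a * x ^ 2) * Real.exp (-a * x ^ 2) = 1 := by
    rw [← Real.exp_add]; simp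
  have h5 : Real.exp (-a * x ^ 2) ≤ 1 := by
    rw [Real.exp_le_one_iff]; nlinarith [sq_nonneg x]
  have h6 := Real.exp_pos (-a * x ^ 2)
  calc |x| ^ k * Real.exp (-a * x ^ 2)
      ≤ (1 + k.factorial / a ^ k * Real.exp (a * x ^ 2)) * Real.exp (-a * x ^ 2) := by
        gcongr; linarith
    _ = Real.exp (-a * x ^ 2) +
        k.factorial / a ^ k * (Real.exp (a * x ^ 2) * Real.exp (-a * x ^ 2)) := by ring
    _ ≤ _ := by rw [h4]; linarith

lemma pow_mul_poly_bound {A : ℂ} (hA : 0 < A.re) (P : Polynomial ℂ) (k : ℕ) :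
    ∃ C : ℝ, ∀ x : ℝ, |x| ^ k * ‖P.eval (x : ℂ) * Complex.exp (-A * (x : ℂ) ^ 2)‖ ≤ C := by
  induction P using Polynomial.induction_on' with
  | add P Q hP hQ =>
    obtain ⟨C, hC⟩ := hP
    obtain ⟨D, hD⟩ := hQ
    refine ⟨C + D, fun x => ?_⟩
    calc _ ≤ |x| ^ k * (‖P.eval (x : ℂ) * Complex.exp (-A * (x : ℂ) ^ 2)‖ +
            ‖Q.eval (x : ℂ) * Complex.exp (-A * (x : ℂ) ^ 2)‖) := by
          gcongr
          rw [Polynomial.eval_add, add_mul]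
          exact norm_add_le _ _
      _ ≤ _ := by rw [mul_add]; exact add_le_add (hC x) (hD x)
  | monomial n z =>
    obtain ⟨C, hC⟩ := pow_mul_exp_bound hA (k + n)
    refine ⟨‖z‖ * C, fun x => ?_⟩
    rw [Polynomial.eval_monomial, norm_mul, norm_mul, norm_pow, norm_gauss, Complex.norm_real,
      Real.norm_eq_abs]
    calc _ = ‖z‖ * (|x| ^ (k + n) * Real.exp (-A.re * x ^ 2)) := by ring
      _ ≤ _ := by gcongr; exact hC x

/-- Gaussians are Schwartz functions. -/
lemma exists_schwartz_gauss {A : ℂ} (hA : 0 < A.re) (z : ℂ) :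
    ∃ s : 𝓢(ℝ, ℂ), ⇑s = fun x : ℝ => z * Complex.exp (-A * (x : ℂ) ^ 2) := by
  have hs : ContDiff ℝ ∞ (fun x : ℝ => Complex.exp (-A * (x : ℂ) ^ 2)) := by
    have h1 : ContDiff ℝ ∞ (fun x : ℝ => (x : ℂ)) := Complex.ofRealCLM.contDiff
    exact (contDiff_const.mul (h1.pow 2)).cexp
  let s : 𝓢(ℝ, ℂ) :=
    { toFun := fun x : ℝ => Complex.exp (-A * (x : ℂ) ^ 2)
      smooth' := hs
      decay' := fun k n => by
        obtain ⟨P, hP⟩ := iteratedDeriv_gauss A n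
        obtain ⟨C, hC⟩ := pow_mul_poly_bound hA P k
        refine ⟨C, fun x => ?_⟩
        rw [norm_iteratedFDeriv_eq_norm_iteratedDeriv, hP, Real.norm_eq_abs]
        exact hC x }
  exact ⟨z • s, rfl⟩

/-- The exponent of the Gaussians in `𝓗_g(θ)`. -/
def gaussExp (g : SL2Z) (θ : ℝ) (τ : ℂ) : ℂ :=
  Real.pi * Complex.I * (g 1 0 * τ / autFactor g θ)

lemma gaussExp_re {g : SL2Z} {θ : ℝ} {τ : ℂ} (hc : 0 < g 1 0) (hj : 0 < autFactor g θ)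
    (hτ : τ.im < 0) : 0 < (gaussExp g θ τ).re := by
  have h : gaussExp g θ τ = ((Real.pi * (g 1 0 : ℝ) / autFactor g θ : ℝ) : ℂ) *
      (Complex.I * τ) := by
    rw [gaussExp]; push_cast; ring
  rw [h, Complex.re_ofReal_mul, Complex.I_mul_re]
  have : (0 : ℝ) < g 1 0 := by exact_mod_cast hc
  have h2 : 0 < Real.pi * (g 1 0 : ℝ) / autFactor g θ := by positivity
  exact mul_pos h2 (by linarith)

/-- Explicit description of `𝓗_g(θ)`. -/
lemma mem_holSections_iff {g : SL2Z} {θ : ℝ} {τ : ℂ} (hc : 0 < g 1 0) (hj : 0 < autFactor g θ)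
    (hτ : τ.im < 0) (f : ℤ → ℝ → ℂ) :
    f ∈ holSections g θ τ ↔ ∃ u : ℤ → ℂ, (∀ α, u (α + g 1 0) = u α) ∧
      f = fun α (x : ℝ) => u α * Complex.exp (-gaussExp g θ τ * (x : ℂ) ^ 2) := by
  have key : ∀ (A z : ℂ) (x : ℝ), HasDerivAt (fun y : ℝ => z * Complex.exp (-A * (y : ℂ) ^ 2))
      (z * (Complex.exp (-A * (x : ℂ) ^ 2) * (-A * (2 * (x : ℂ))))) x := by
    intro A z x
    have h1 : HasDerivAt (fun y : ℂ => z * Complex.exp (-A * y ^ 2))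
        (z * (Complex.exp (-A * (x : ℂ) ^ 2) * (-A * (2 * (x : ℂ))))) (x : ℂ) := by
      refine HasDerivAt.const_mul z (HasDerivAt.cexp ?_)
      simpa using (hasDerivAt_pow 2 (x : ℂ)).const_mul (-A)
    exact h1.comp_ofReal
  constructor
  · rintro ⟨⟨hper, hsch⟩, hnab⟩
    refine ⟨fun α => f α 0, fun α => congrFun (hper α) 0, ?_⟩
    funext α x
    obtain ⟨s, hs⟩ := hsch α
    have hd : ∀ y, HasDerivAt (f α) (deriv (f α) y) y := fun y =>
      (hs ▸ s.differentiableAt : DifferentiableAt ℝ (f α) y).hasDerivAt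
    have hconst : ∀ y, HasDerivAt
        (fun y : ℝ => f α y * (1 * Complex.exp (-(-gaussExp g θ τ) * (y : ℂ) ^ 2))) 0 y := by
      intro y
      have h1 := (hd y).mul (key (-gaussExp g θ τ) 1 y)
      have h2 := congrFun (congrFun hnab α) y
      simp only [nablaBar, Pi.zero_apply] at h2
      refine h1.congr_deriv ?_
      have h3 : deriv (f α) y = -(2 * gaussExp g θ τ * y * f α y) := by
        rw [gaussExp]; linear_combination h2
      rw [h3]; ring
    have h4 := is_const_of_deriv_eq_zero (fun y => (hconst y).differentiableAt)
      (fun y => (hconst y).deriv) x 0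
    simp only [neg_neg, one_mul, Complex.ofReal_zero, ne_eq, OfNat.ofNat_ne_zero,
      not_false_eq_true, zero_pow, mul_zero, Complex.exp_zero, mul_one] at h4
    change f α x = f α 0 * _
    rw [← h4, mul_assoc, ← Complex.exp_add]
    simp
  · rintro ⟨u, hu, rfl⟩
    refine ⟨⟨fun α => by simp only [hu], fun α =>
      exists_schwartz_gauss (gaussExp_re hc hj hτ) (u α)⟩, ?_⟩
    funext α x
    simp only [nablaBar, Pi.zero_apply, (key _ _ x).deriv, gaussExp]
    ring

lemma basisSection_mem {g : SL2Z} {θ : ℝ} {τ : ℂ} (hc : 0 < g 1 0) (hj : 0 < autFactor g θ)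
    (hτ : τ.im < 0) (α : ℤ) : basisSection g θ τ α ∈ holSections g θ τ := by
  refine (mem_holSections_iff hc hj hτ _).2
    ⟨fun β => if β ≡ α [ZMOD g 1 0] then 1 else 0, fun β => ?_, ?_⟩
  · have : β + g 1 0 ≡ α [ZMOD g 1 0] ↔ β ≡ α [ZMOD g 1 0] := by
      simp [Int.ModEq]
    simp only [this]
  · funext β x
    simp only [basisSection, gaussExp]
    split_ifs <;> simp

/-! ### Gaussian sums -/

lemma summable_gauss {b p : ℝ} (hb : 0 < b) (hp : p ≠ 0) (q : ℝ) :
    Summable fun k : ℤ => Real.exp (-b * (p * k + q) ^ 2) := by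
  have ht : 0 < b * p ^ 2 / Real.pi := by positivity
  have h := HurwitzKernelBounds.summable_f_int 0 (q / p) ht
  refine h.congr fun k => ?_
  simp only [HurwitzKernelBounds.f_int, pow_zero, one_mul]
  congr 1
  field_simp

lemma periodic_int {α : Type*} {u : ℤ → α} {c : ℤ} (hu : ∀ k, u (k + c) = u k) (m k : ℤ) :
    u (k + c * m) = u k := by
  have h : Function.Periodic u c := hu
  simpa [mul_comm] using h.int_mul m k

lemma periodic_bounded {u : ℤ → ℂ} {c : ℤ} (hc : 0 < c) (hu : ∀ k, u (k + c) = u k) :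
    ∃ C : ℝ, 0 ≤ C ∧ ∀ k, ‖u k‖ ≤ C := by
  refine ⟨∑ i ∈ Finset.Ico 0 c, ‖u i‖, Finset.sum_nonneg fun _ _ => norm_nonneg _, fun k => ?_⟩
  have h1 : u k = u (k % c) := by
    have := periodic_int hu (k / c) (k % c)
    rw [Int.emod_add_mul_ediv] at this
    exact this
  rw [h1]
  exact Finset.single_le_sum (f := fun i => ‖u i‖) (fun _ _ => norm_nonneg _)
    (Finset.mem_Ico.2 ⟨Int.emod_nonneg _ hc.ne', Int.emod_lt_of_pos _ hc⟩)

lemma summable_gauss_shift {b : ℝ} (hb : 0 < b) {p : ℤ} (hp : 0 < p) (c l : ℤ) :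
    Summable fun k : ℤ => Real.exp (-b * ((p : ℝ) * k - c * l) ^ 2) := by
  have hp' : (p : ℝ) ≠ 0 := by exact_mod_cast hp.ne'
  refine (summable_gauss hb hp' (-(c * l : ℝ))).congr fun k => ?_
  rw [sub_eq_add_neg]

/-- Shifted Gaussian sums are bounded. -/
lemma tsum_gauss_bounded (b : ℝ) {p : ℤ} (hp : 0 < p) (c : ℤ) :
    ∃ C : ℝ, ∀ l : ℤ, ∑' k : ℤ, Real.exp (-b * ((p : ℝ) * k - c * l) ^ 2) ≤ C := by
  have hS : ∀ l : ℤ, ((∑' k : ℤ, Real.exp (-b * ((p : ℝ) * k - c * (l + p : ℤ)) ^ 2) : ℝ) : ℂ) =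
      ((∑' k : ℤ, Real.exp (-b * ((p : ℝ) * k - c * l) ^ 2) : ℝ) : ℂ) := by
    intro l
    congr 1
    rw [← (Equiv.addRight c).tsum_eq]
    refine tsum_congr fun k => ?_
    congr 1
    simp only [Equiv.coe_addRight]
    push_cast
    ring
  obtain ⟨C, -, hC⟩ := periodic_bounded (u := fun l : ℤ =>
    ((∑' k : ℤ, Real.exp (-b * ((p : ℝ) * k - c * l) ^ 2) : ℝ) : ℂ)) hp hS
  refine ⟨C, fun l => ?_⟩
  have := hC l
  rw [Complex.norm_real, Real.norm_eq_abs] at this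
  exact (le_abs_self _).trans this

/-- Two-dimensional Gaussian sums converge. -/
lemma summable_gauss₂ {b₁ b₂ : ℝ} (hb₁ : 0 < b₁) (hb₂ : 0 < b₂) {p c r : ℤ} (hp : 0 < p)
    (hr : 0 < r) (q : ℝ) :
    Summable fun x : ℤ × ℤ => Real.exp (-b₁ * ((p : ℝ) * x.2 - c * x.1) ^ 2) *
      Real.exp (-b₂ * ((r : ℝ) * x.1 + q) ^ 2) := by
  have hr' : (r : ℝ) ≠ 0 := by exact_mod_cast hr.ne'
  obtain ⟨C, hC⟩ := tsum_gauss_bounded b₁ hp c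
  let f : ℤ × ℤ → ℝ := fun x => Real.exp (-b₁ * ((p : ℝ) * x.2 - c * x.1) ^ 2) *
    Real.exp (-b₂ * ((r : ℝ) * x.1 + q) ^ 2)
  have hf : 0 ≤ f := fun x => mul_nonneg (Real.exp_pos _).le (Real.exp_pos _).le
  have hf1 : ∀ l : ℤ, Summable fun k : ℤ => f (l, k) := fun l =>
    (summable_gauss_shift hb₁ hp c l).mul_right (Real.exp (-b₂ * ((r : ℝ) * l + q) ^ 2))
  have hf2 : ∀ l : ℤ, ∑' k : ℤ, f (l, k) ≤ C * Real.exp (-b₂ * ((r : ℝ) * l + q) ^ 2) := by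
    intro l
    have h2 : ∑' k : ℤ, f (l, k) = (∑' k : ℤ, Real.exp (-b₁ * ((p : ℝ) * k - c * l) ^ 2)) *
        Real.exp (-b₂ * ((r : ℝ) * l + q) ^ 2) := by
      simp only [f]
      exact tsum_mul_right
    rw [h2]
    exact mul_le_mul_of_nonneg_right (hC l) (Real.exp_pos _).le
  have hf3 : Summable fun l : ℤ => C * Real.exp (-b₂ * ((r : ℝ) * l + q) ^ 2) :=
    (summable_gauss hb₂ hr' q).mul_left C
  have hf4 : Summable fun l : ℤ => ∑' k : ℤ, f (l, k) :=
    Summable.of_nonneg_of_le (fun l => tsum_nonneg fun k => hf (l, k)) hf2 hf3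
  exact (summable_prod_of_nonneg hf).2 ⟨hf1, hf4⟩

/-! ### Arithmetic of `SL₂(ℤ)` -/

lemma sl_det (g : SL2Z) : g 0 0 * g 1 1 - g 0 1 * g 1 0 = 1 := by
  have := g.det_coe
  rwa [Matrix.det_fin_two] at this

lemma sl_mul00 (g h : SL2Z) : (g * h) 0 0 = g 0 0 * h 0 0 + g 0 1 * h 1 0 := by
  simp [Matrix.mul_apply, Fin.sum_univ_two]

lemma sl_mul10 (g h : SL2Z) : (g * h) 1 0 = g 1 0 * h 0 0 + g 1 1 * h 1 0 := by
  simp [Matrix.mul_apply, Fin.sum_univ_two]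

lemma sl_mul11 (g h : SL2Z) : (g * h) 1 1 = g 1 0 * h 0 1 + g 1 1 * h 1 1 := by
  simp [Matrix.mul_apply, Fin.sum_univ_two]

lemma autFactor_mul (g h : SL2Z) {θ : ℝ} (hj : autFactor h θ ≠ 0) :
    autFactor (g * h) θ = autFactor g (moebius h θ) * autFactor h θ := by
  have h1 : autFactor g (moebius h θ) * autFactor h θ =
      g 1 0 * (h 0 0 * θ + h 0 1) + g 1 1 * autFactor h θ := by
    rw [autFactor, moebius]; field_simp
  rw [h1, autFactor, autFactor, sl_mul10, sl_mul11]
  push_cast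
  ring

/-- `c₁ + c₂ j(g₁g₂, θ) = c₁₂ j(g₂, θ)`. -/
lemma cocycle_rel (g h : SL2Z) (θ : ℝ) :
    (g 1 0 : ℝ) + h 1 0 * autFactor (g * h) θ = (g * h) 1 0 * autFactor h θ := by
  have hd : (h 0 0 : ℝ) * h 1 1 - h 0 1 * h 1 0 = 1 := by exact_mod_cast sl_det h
  simp only [autFactor, sl_mul10, sl_mul11]
  push_cast
  linear_combination -(g 1 0 : ℝ) * hd

lemma mul_deg_pos {g h : SL2Z} {θ : ℝ} (hg : 0 < g 1 0) (hh : 0 < h 1 0)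
    (hj : 0 < autFactor h θ) (hj' : 0 < autFactor g (moebius h θ)) : 0 < (g * h) 1 0 := by
  have h1 := cocycle_rel g h θ
  have h2 : 0 < autFactor (g * h) θ := by
    rw [autFactor_mul _ _ hj.ne']; positivity
  have hg' : (0 : ℝ) < g 1 0 := by exact_mod_cast hg
  have hh' : (0 : ℝ) < h 1 0 := by exact_mod_cast hh
  have h3 : 0 < ((g * h) 1 0 : ℝ) * autFactor h θ := by rw [← h1]; positivity
  exact_mod_cast pos_of_mul_pos_left h3 hj.le

/-! ### The pairing on holomorphic sections -/

/-- The Gaussian factor of the product of two holomorphic sections. -/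
def mulTerm (g₁ g₂ : SL2Z) (τ : ℂ) (γ k : ℤ) : ℂ :=
  Complex.exp (-(Real.pi * Complex.I * τ / (g₁ 1 0 * g₂ 1 0 * (g₁ * g₂) 1 0)) *
    (((g₁ * g₂) 1 0 : ℂ) * k - g₁ 1 0 * γ) ^ 2)

/-- The product of holomorphic sections in terms of their coefficients. -/
def coeffMul (g₁ g₂ : SL2Z) (τ : ℂ) (u v : ℤ → ℂ) : ℤ → ℂ := fun γ =>
  ∑' k : ℤ, u k * v (γ - g₂ 0 0 * k) * mulTerm g₁ g₂ τ γ k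

/-- The rate of decay of `mulTerm`. -/
def mulRate (g₁ g₂ : SL2Z) (τ : ℂ) : ℝ :=
  -(Real.pi * τ.im / (g₁ 1 0 * g₂ 1 0 * (g₁ * g₂) 1 0))

lemma mulRate_pos {g₁ g₂ : SL2Z} {τ : ℂ} (h₁ : 0 < g₁ 1 0) (h₂ : 0 < g₂ 1 0)
    (h₁₂ : 0 < (g₁ * g₂) 1 0) (hτ : τ.im < 0) : 0 < mulRate g₁ g₂ τ := by
  have h1 : (0 : ℝ) < g₁ 1 0 := by exact_mod_cast h₁
  have h2 : (0 : ℝ) < g₂ 1 0 := by exact_mod_cast h₂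
  have h3 : (0 : ℝ) < (g₁ * g₂) 1 0 := by exact_mod_cast h₁₂
  rw [mulRate, neg_pos]
  exact div_neg_of_neg_of_pos (mul_neg_of_pos_of_neg Real.pi_pos hτ) (by positivity)

lemma norm_mulTerm (g₁ g₂ : SL2Z) (τ : ℂ) (γ k : ℤ) :
    ‖mulTerm g₁ g₂ τ γ k‖ =
      Real.exp (-mulRate g₁ g₂ τ * (((g₁ * g₂) 1 0 : ℝ) * k - g₁ 1 0 * γ) ^ 2) := by
  rw [mulTerm, Complex.norm_exp]
  congr 1
  have h : -(Real.pi * Complex.I * τ / (g₁ 1 0 * g₂ 1 0 * (g₁ * g₂) 1 0)) *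
      (((g₁ * g₂) 1 0 : ℂ) * k - g₁ 1 0 * γ) ^ 2 =
      ((-Real.pi / (g₁ 1 0 * g₂ 1 0 * (g₁ * g₂) 1 0) *
        (((g₁ * g₂) 1 0 : ℝ) * k - g₁ 1 0 * γ) ^ 2 : ℝ) : ℂ) * (Complex.I * τ) := by
    push_cast; ring
  rw [h, Complex.re_ofReal_mul, Complex.I_mul_re, mulRate]
  ring

lemma summable_coeffMul {g₁ g₂ : SL2Z} {τ : ℂ} (h₁ : 0 < g₁ 1 0) (h₂ : 0 < g₂ 1 0)
    (h₁₂ : 0 < (g₁ * g₂) 1 0) (hτ : τ.im < 0) {u v : ℤ → ℂ}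
    (hu : ∀ k, u (k + g₁ 1 0) = u k) (hv : ∀ k, v (k + g₂ 1 0) = v k) (γ : ℤ) :
    Summable fun k : ℤ => u k * v (γ - g₂ 0 0 * k) * mulTerm g₁ g₂ τ γ k := by
  obtain ⟨C, hC0, hC⟩ := periodic_bounded h₁ hu
  obtain ⟨D, hD0, hD⟩ := periodic_bounded h₂ hv
  have h3 : ((g₁ * g₂) 1 0 : ℝ) ≠ 0 := by exact_mod_cast h₁₂.ne'
  refine Summable.of_norm_bounded (g := fun k : ℤ => C * D *
    Real.exp (-mulRate g₁ g₂ τ * (((g₁ * g₂) 1 0 : ℝ) * k + -(g₁ 1 0 * γ : ℝ)) ^ 2))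
    ((summable_gauss (mulRate_pos h₁ h₂ h₁₂ hτ) h3 _).mul_left _) fun k => ?_
  rw [norm_mul, norm_mul, norm_mulTerm, ← sub_eq_add_neg]
  gcongr
  · exact hC k
  · exact hD _

lemma coeffMul_periodic (g₁ g₂ : SL2Z) (τ : ℂ) {u v : ℤ → ℂ}
    (hu : ∀ k, u (k + g₁ 1 0) = u k) (hv : ∀ k, v (k + g₂ 1 0) = v k) (γ : ℤ) :
    coeffMul g₁ g₂ τ u v (γ + (g₁ * g₂) 1 0) = coeffMul g₁ g₂ τ u v γ := by
  rw [coeffMul, coeffMul, ← (Equiv.addRight (g₁ 1 0)).tsum_eq]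
  refine tsum_congr fun k => ?_
  simp only [Equiv.coe_addRight, hu]
  have h1 : γ + (g₁ * g₂) 1 0 - g₂ 0 0 * (k + g₁ 1 0) = γ - g₂ 0 0 * k + g₂ 1 0 * g₁ 1 1 := by
    rw [sl_mul10]; ring
  rw [h1, periodic_int hv]
  congr 1
  rw [mulTerm, mulTerm]
  congr 2
  push_cast
  ring

lemma pairing_gauss {g₁ g₂ : SL2Z} {θ : ℝ} {τ : ℂ} (h₁ : 0 < g₁ 1 0) (h₂ : 0 < g₂ 1 0)
    (hj : 0 < autFactor g₂ θ) (hj' : 0 < autFactor g₁ (moebius g₂ θ)) (u v : ℤ → ℂ) :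
    pairing g₁ g₂ θ
      (fun α (x : ℝ) => u α * Complex.exp (-gaussExp g₁ (moebius g₂ θ) τ * (x : ℂ) ^ 2))
      (fun α (x : ℝ) => v α * Complex.exp (-gaussExp g₂ θ τ * (x : ℂ) ^ 2)) =
    fun γ (x : ℝ) => coeffMul g₁ g₂ τ u v γ * Complex.exp (-gaussExp (g₁ * g₂) θ τ * (x : ℂ) ^ 2) := by
  funext γ x
  rw [pairing, coeffMul, ← tsum_mul_right]
  refine tsum_congr fun k => ?_
  have h12 := mul_deg_pos h₁ h₂ hj hj'
  have e1 := autFactor_mul g₁ g₂ hj.ne'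
  have e2 := cocycle_rel g₁ g₂ θ
  have n1 : (g₁ 1 0 : ℂ) ≠ 0 := by exact_mod_cast h₁.ne'
  have n2 : (g₂ 1 0 : ℂ) ≠ 0 := by exact_mod_cast h₂.ne'
  have n3 : ((g₁ * g₂) 1 0 : ℂ) ≠ 0 := by exact_mod_cast h12.ne'
  have n4 : (autFactor g₂ θ : ℂ) ≠ 0 := by exact_mod_cast hj.ne'
  have n5 : (autFactor g₁ (moebius g₂ θ) : ℂ) ≠ 0 := by exact_mod_cast hj'.ne'
  have e2' : (g₁ 1 0 : ℂ) + g₂ 1 0 * (autFactor g₁ (moebius g₂ θ) * autFactor g₂ θ) =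
      (g₁ * g₂) 1 0 * autFactor g₂ θ := by
    rw [e1] at e2; exact_mod_cast e2
  have key : -gaussExp g₁ (moebius g₂ θ) τ * (((x / autFactor g₂ θ + autFactor g₁ (moebius g₂ θ) *
      ((k : ℝ) / g₁ 1 0 - (γ : ℝ) / (g₁ * g₂) 1 0) : ℝ)) : ℂ) ^ 2 +
      -gaussExp g₂ θ τ * ((x - (g₁ 1 0 : ℝ) / g₂ 1 0 *
      ((k : ℝ) / g₁ 1 0 - (γ : ℝ) / (g₁ * g₂) 1 0) : ℝ) : ℂ) ^ 2 =
      -(Real.pi * Complex.I * τ / (g₁ 1 0 * g₂ 1 0 * (g₁ * g₂) 1 0)) *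
      (((g₁ * g₂) 1 0 : ℂ) * k - g₁ 1 0 * γ) ^ 2 + -gaussExp (g₁ * g₂) θ τ * (x : ℂ) ^ 2 := by
    simp only [gaussExp, e1]
    push_cast
    generalize (autFactor g₁ (moebius g₂ θ) : ℂ) = j₁ at *
    generalize (autFactor g₂ θ : ℂ) = j₂ at *
    generalize ((g₁ * g₂) 1 0 : ℂ) = c₁₂ at *
    generalize (g₁ 1 0 : ℂ) = c₁ at *
    generalize (g₂ 1 0 : ℂ) = c₂ at *
    rw [← sub_eq_zero]
    have e3 : c₁ + c₂ * (j₁ * j₂) - c₁₂ * j₂ = 0 := sub_eq_zero.2 e2'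
    rw [← mul_zero (-(Real.pi * Complex.I * τ) * ((x : ℂ) ^ 2 / (j₁ * j₂ ^ 2) +
      (k / c₁ - γ / c₁₂) ^ 2 * c₁ / (c₂ * j₂))), ← e3]
    field_simp
    ring
  rw [mulTerm, mul_mul_mul_comm, ← Complex.exp_add, key, Complex.exp_add]
  ring

lemma coeffMul_assoc {g₁ g₂ g₃ : SL2Z} {τ : ℂ} (h₁ : 0 < g₁ 1 0) (h₂ : 0 < g₂ 1 0)
    (h₃ : 0 < g₃ 1 0) (h₁₂ : 0 < (g₁ * g₂) 1 0) (h₂₃ : 0 < (g₂ * g₃) 1 0)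
    (h₁₂₃ : 0 < (g₁ * g₂ * g₃) 1 0) (hτ : τ.im < 0) {u v w : ℤ → ℂ}
    (hu : ∀ k, u (k + g₁ 1 0) = u k) (hv : ∀ k, v (k + g₂ 1 0) = v k)
    (hw : ∀ k, w (k + g₃ 1 0) = w k) :
    coeffMul (g₁ * g₂) g₃ τ (coeffMul g₁ g₂ τ u v) w = coeffMul g₁ (g₂ * g₃) τ u (coeffMul g₂ g₃ τ v w) := by
  funext ε
  let F : ℤ → ℤ → ℂ := fun l k => u k * v (l - g₂ 0 0 * k) * mulTerm g₁ g₂ τ l k *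
    w (ε - g₃ 0 0 * l) * mulTerm (g₁ * g₂) g₃ τ ε l
  have hsum : Summable (Function.uncurry F) := by
    obtain ⟨C, hC0, hC⟩ := periodic_bounded h₁ hu
    obtain ⟨D, hD0, hD⟩ := periodic_bounded h₂ hv
    obtain ⟨E, hE0, hE⟩ := periodic_bounded h₃ hw
    refine Summable.of_norm_bounded
      ((summable_gauss₂ (mulRate_pos h₁ h₂ h₁₂ hτ) (mulRate_pos h₁₂ h₃ h₁₂₃ hτ) h₁₂ h₁₂₃
        (c := g₁ 1 0) (-((g₁ * g₂) 1 0 * ε : ℝ))).mul_left (C * D * E)) ?_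
    rintro ⟨l, k⟩
    simp only [Function.uncurry, F]
    rw [norm_mul, norm_mul, norm_mul, norm_mul, norm_mulTerm, norm_mulTerm, ← sub_eq_add_neg]
    calc _ ≤ C * D * Real.exp (-mulRate g₁ g₂ τ *
          (((g₁ * g₂) 1 0 : ℝ) * k - g₁ 1 0 * l) ^ 2) * E *
          Real.exp (-mulRate (g₁ * g₂) g₃ τ *
            (((g₁ * g₂ * g₃) 1 0 : ℝ) * l - (g₁ * g₂) 1 0 * ε) ^ 2) := by
          gcongr
          · exact hC k
          · exact hD _
          · exact hE _
      _ = _ := by ring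
  have hL : coeffMul (g₁ * g₂) g₃ τ (coeffMul g₁ g₂ τ u v) w ε = ∑' l : ℤ, ∑' k : ℤ, F l k := by
    rw [coeffMul]
    refine tsum_congr fun l => ?_
    rw [coeffMul, ← tsum_mul_right, ← tsum_mul_right]
  have hR : coeffMul g₁ (g₂ * g₃) τ u (coeffMul g₂ g₃ τ v w) ε = ∑' k : ℤ, ∑' l : ℤ, F l k := by
    rw [coeffMul]
    refine tsum_congr fun k => ?_
    rw [coeffMul, ← tsum_mul_left, ← tsum_mul_right, ← (Equiv.subRight (g₂ 0 0 * k)).tsum_eq]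
    refine tsum_congr fun l => ?_
    simp only [Equiv.subRight_apply, F]
    have hwarg : ε - (g₂ * g₃) 0 0 * k - g₃ 0 0 * (l - g₂ 0 0 * k) =
        ε - g₃ 0 0 * l + g₃ 1 0 * (-(g₂ 0 1 * k)) := by
      rw [sl_mul00]; ring
    rw [hwarg, periodic_int hw]
    have n1 : (g₁ 1 0 : ℂ) ≠ 0 := by exact_mod_cast h₁.ne'
    have n2 : (g₂ 1 0 : ℂ) ≠ 0 := by exact_mod_cast h₂.ne'
    have n3 : (g₃ 1 0 : ℂ) ≠ 0 := by exact_mod_cast h₃.ne'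
    have n12 : ((g₁ * g₂) 1 0 : ℂ) ≠ 0 := by exact_mod_cast h₁₂.ne'
    have n23 : ((g₂ * g₃) 1 0 : ℂ) ≠ 0 := by exact_mod_cast h₂₃.ne'
    have n123 : ((g₁ * g₂ * g₃) 1 0 : ℂ) ≠ 0 := by exact_mod_cast h₁₂₃.ne'
    have d2 := sl_det g₂
    have r1 : (g₂ * g₃) 1 0 * g₂ 0 0 - g₂ 1 0 * (g₂ * g₃) 0 0 = g₃ 1 0 := by
      rw [sl_mul10, sl_mul00]; linear_combination g₃ 1 0 * d2
    have r2 : (g₁ * g₂) 1 0 * (g₂ * g₃) 1 0 - g₂ 1 0 * (g₁ * g₂ * g₃) 1 0 = g₁ 1 0 * g₃ 1 0 := by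
      rw [mul_assoc g₁ g₂ g₃, sl_mul10 g₁ (g₂ * g₃), sl_mul10 g₁ g₂]
      linear_combination g₁ 1 0 * r1
    have r1' : ((g₂ * g₃) 1 0 : ℂ) * g₂ 0 0 - g₂ 1 0 * (g₂ * g₃) 0 0 = g₃ 1 0 := by
      exact_mod_cast r1
    have r2' : ((g₁ * g₂) 1 0 : ℂ) * (g₂ * g₃) 1 0 - g₂ 1 0 * (g₁ * g₂ * g₃) 1 0 =
        g₁ 1 0 * g₃ 1 0 := by
      exact_mod_cast r2
    have hexp : mulTerm g₁ (g₂ * g₃) τ ε k *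
        mulTerm g₂ g₃ τ (ε - (g₂ * g₃) 0 0 * k) (l - g₂ 0 0 * k) =
        mulTerm g₁ g₂ τ l k * mulTerm (g₁ * g₂) g₃ τ ε l := by
      simp only [mulTerm]
      rw [← Complex.exp_add, ← Complex.exp_add, ← mul_assoc g₁ g₂ g₃]
      congr 1
      push_cast
      have r3 : ((g₂ * g₃) 1 0 : ℂ) * (l - g₂ 0 0 * k) - g₂ 1 0 * (ε - (g₂ * g₃) 0 0 * k) =
          (g₂ * g₃) 1 0 * l - g₂ 1 0 * ε - g₃ 1 0 * k := by
        linear_combination -(k : ℂ) * r1'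
      rw [r3]
      generalize ((g₁ * g₂ * g₃) 1 0 : ℂ) = c₁₂₃ at *
      generalize ((g₁ * g₂) 1 0 : ℂ) = c₁₂ at *
      generalize ((g₂ * g₃) 1 0 : ℂ) = c₂₃ at *
      generalize (g₁ 1 0 : ℂ) = c₁ at *
      generalize (g₂ 1 0 : ℂ) = c₂ at *
      generalize (g₃ 1 0 : ℂ) = c₃ at *
      rw [← sub_eq_zero]
      have e3 : c₁₂ * c₂₃ - c₂ * c₁₂₃ - c₁ * c₃ = 0 := sub_eq_zero.2 r2'
      rw [← mul_zero (-(Real.pi * Complex.I * τ) * (-(k : ℂ) ^ 2 / (c₁ * c₂ * c₂₃) +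
        (l : ℂ) ^ 2 / (c₂ * c₃ * c₁₂) - (ε : ℂ) ^ 2 / (c₃ * c₂₃ * c₁₂₃))), ← e3]
      field_simp
      ring
    calc _ = u k * v (l - g₂ 0 0 * k) * w (ε - g₃ 0 0 * l) * (mulTerm g₁ (g₂ * g₃) τ ε k *
        mulTerm g₂ g₃ τ (ε - (g₂ * g₃) 0 0 * k) (l - g₂ 0 0 * k)) := by ring
      _ = _ := by rw [hexp]; ring
  rw [hL, hR]
  exact hsum.tsum_comm.symm

lemma pairing_mem {g₁ g₂ : SL2Z} {θ : ℝ} {τ : ℂ} (h₁ : 0 < g₁ 1 0) (h₂ : 0 < g₂ 1 0)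
    (hj : 0 < autFactor g₂ θ) (hj' : 0 < autFactor g₁ (moebius g₂ θ)) (hτ : τ.im < 0)
    {f₁ f₂ : ℤ → ℝ → ℂ} (hf₁ : f₁ ∈ holSections g₁ (moebius g₂ θ) τ)
    (hf₂ : f₂ ∈ holSections g₂ θ τ) :
    pairing g₁ g₂ θ f₁ f₂ ∈ holSections (g₁ * g₂) θ τ := by
  obtain ⟨u, hu, rfl⟩ := (mem_holSections_iff h₁ hj' hτ _).1 hf₁
  obtain ⟨v, hv, rfl⟩ := (mem_holSections_iff h₂ hj hτ _).1 hf₂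
  have h12 := mul_deg_pos h₁ h₂ hj hj'
  have hj12 : 0 < autFactor (g₁ * g₂) θ := by rw [autFactor_mul _ _ hj.ne']; positivity
  rw [pairing_gauss h₁ h₂ hj hj']
  exact (mem_holSections_iff h12 hj12 hτ _).2 ⟨_, coeffMul_periodic g₁ g₂ τ hu hv, rfl⟩

lemma coeffMul_add_left {g₁ g₂ : SL2Z} {τ : ℂ} (h₁ : 0 < g₁ 1 0) (h₂ : 0 < g₂ 1 0)
    (h₁₂ : 0 < (g₁ * g₂) 1 0) (hτ : τ.im < 0) {u u' v : ℤ → ℂ}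
    (hu : ∀ k, u (k + g₁ 1 0) = u k) (hu' : ∀ k, u' (k + g₁ 1 0) = u' k)
    (hv : ∀ k, v (k + g₂ 1 0) = v k) :
    coeffMul g₁ g₂ τ (fun k => u k + u' k) v = fun γ => coeffMul g₁ g₂ τ u v γ + coeffMul g₁ g₂ τ u' v γ := by
  funext γ
  rw [coeffMul, coeffMul, coeffMul, ← (summable_coeffMul h₁ h₂ h₁₂ hτ hu hv γ).tsum_add
    (summable_coeffMul h₁ h₂ h₁₂ hτ hu' hv γ)]
  exact tsum_congr fun k => by ring

lemma coeffMul_add_right {g₁ g₂ : SL2Z} {τ : ℂ} (h₁ : 0 < g₁ 1 0) (h₂ : 0 < g₂ 1 0)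
    (h₁₂ : 0 < (g₁ * g₂) 1 0) (hτ : τ.im < 0) {u v v' : ℤ → ℂ}
    (hu : ∀ k, u (k + g₁ 1 0) = u k) (hv : ∀ k, v (k + g₂ 1 0) = v k)
    (hv' : ∀ k, v' (k + g₂ 1 0) = v' k) :
    coeffMul g₁ g₂ τ u (fun k => v k + v' k) = fun γ => coeffMul g₁ g₂ τ u v γ + coeffMul g₁ g₂ τ u v' γ := by
  funext γ
  rw [coeffMul, coeffMul, coeffMul, ← (summable_coeffMul h₁ h₂ h₁₂ hτ hu hv γ).tsum_add
    (summable_coeffMul h₁ h₂ h₁₂ hτ hu hv' γ)]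
  exact tsum_congr fun k => by ring

lemma pairing_add_left {g₁ g₂ : SL2Z} {θ : ℝ} {τ : ℂ} (h₁ : 0 < g₁ 1 0) (h₂ : 0 < g₂ 1 0)
    (hj : 0 < autFactor g₂ θ) (hj' : 0 < autFactor g₁ (moebius g₂ θ)) (hτ : τ.im < 0)
    {f f' h : ℤ → ℝ → ℂ} (hf : f ∈ holSections g₁ (moebius g₂ θ) τ)
    (hf' : f' ∈ holSections g₁ (moebius g₂ θ) τ) (hh : h ∈ holSections g₂ θ τ) :
    pairing g₁ g₂ θ (f + f') h = pairing g₁ g₂ θ f h + pairing g₁ g₂ θ f' h := by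
  obtain ⟨u, hu, rfl⟩ := (mem_holSections_iff h₁ hj' hτ _).1 hf
  obtain ⟨u', hu', rfl⟩ := (mem_holSections_iff h₁ hj' hτ _).1 hf'
  obtain ⟨v, hv, rfl⟩ := (mem_holSections_iff h₂ hj hτ _).1 hh
  have e : ((fun α (x : ℝ) => u α * Complex.exp (-gaussExp g₁ (moebius g₂ θ) τ * (x : ℂ) ^ 2)) +
      fun α (x : ℝ) => u' α * Complex.exp (-gaussExp g₁ (moebius g₂ θ) τ * (x : ℂ) ^ 2)) =
      fun α (x : ℝ) => (fun k => u k + u' k) α *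
        Complex.exp (-gaussExp g₁ (moebius g₂ θ) τ * (x : ℂ) ^ 2) := by
    funext α x
    simp only [Pi.add_apply]
    ring
  rw [e, pairing_gauss h₁ h₂ hj hj', pairing_gauss h₁ h₂ hj hj', pairing_gauss h₁ h₂ hj hj',
    coeffMul_add_left h₁ h₂ (mul_deg_pos h₁ h₂ hj hj') hτ hu hu' hv]
  funext α x
  simp only [Pi.add_apply]
  ring

lemma pairing_add_right {g₁ g₂ : SL2Z} {θ : ℝ} {τ : ℂ} (h₁ : 0 < g₁ 1 0) (h₂ : 0 < g₂ 1 0)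
    (hj : 0 < autFactor g₂ θ) (hj' : 0 < autFactor g₁ (moebius g₂ θ)) (hτ : τ.im < 0)
    {f h h' : ℤ → ℝ → ℂ} (hf : f ∈ holSections g₁ (moebius g₂ θ) τ)
    (hh : h ∈ holSections g₂ θ τ) (hh' : h' ∈ holSections g₂ θ τ) :
    pairing g₁ g₂ θ f (h + h') = pairing g₁ g₂ θ f h + pairing g₁ g₂ θ f h' := by
  obtain ⟨u, hu, rfl⟩ := (mem_holSections_iff h₁ hj' hτ _).1 hf
  obtain ⟨v, hv, rfl⟩ := (mem_holSections_iff h₂ hj hτ _).1 hh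
  obtain ⟨v', hv', rfl⟩ := (mem_holSections_iff h₂ hj hτ _).1 hh'
  have e : ((fun α (x : ℝ) => v α * Complex.exp (-gaussExp g₂ θ τ * (x : ℂ) ^ 2)) +
      fun α (x : ℝ) => v' α * Complex.exp (-gaussExp g₂ θ τ * (x : ℂ) ^ 2)) =
      fun α (x : ℝ) => (fun k => v k + v' k) α *
        Complex.exp (-gaussExp g₂ θ τ * (x : ℂ) ^ 2) := by
    funext α x
    simp only [Pi.add_apply]
    ring
  rw [e, pairing_gauss h₁ h₂ hj hj', pairing_gauss h₁ h₂ hj hj', pairing_gauss h₁ h₂ hj hj',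
    coeffMul_add_right h₁ h₂ (mul_deg_pos h₁ h₂ hj hj') hτ hu hv hv']
  funext α x
  simp only [Pi.add_apply]
  ring

lemma pairing_smul_left (g₁ g₂ : SL2Z) (θ : ℝ) (z : ℂ) (f h : ℤ → ℝ → ℂ) :
    pairing g₁ g₂ θ (z • f) h = z • pairing g₁ g₂ θ f h := by
  funext γ x
  simp only [pairing, Pi.smul_apply, smul_eq_mul, mul_assoc]
  exact tsum_mul_left

lemma pairing_smul_right (g₁ g₂ : SL2Z) (θ : ℝ) (z : ℂ) (f h : ℤ → ℝ → ℂ) :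
    pairing g₁ g₂ θ f (z • h) = z • pairing g₁ g₂ θ f h := by
  funext γ x
  simp only [pairing, Pi.smul_apply, smul_eq_mul, mul_left_comm _ z]
  exact tsum_mul_left

/-! ### The homogeneous coordinate ring -/

/-- A noncommutative torus `𝕋_θ` with real multiplication by `g = (a b; c d)`, with complex
structure `τ`, under the inequalities `a + d > 2` and `c ≥ a + d + 2`. -/
structure RMTorus where
  /-- The matrix `g = (a b; c d)`. -/
  g : SL2Z
  /-- The real parameter of the noncommutative torus. -/
  θ : ℝ
  /-- The parameter of the complex structure. -/
  τ : ℂ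
  hyperbolic : 2 < g 0 0 + g 1 1
  degree_ge : g 0 0 + g 1 1 + 2 ≤ g 1 0
  /-- `gθ = θ`, that is, `aθ + b = θ(cθ + d)`. -/
  fixed : (g 0 0 : ℝ) * θ + g 0 1 = θ * (g 1 0 * θ + g 1 1)
  im_neg : τ.im < 0

namespace RMTorus

variable (T : RMTorus)

lemma deg_pos : 0 < T.g 1 0 := by
  have := T.hyperbolic
  have := T.degree_ge
  omega

lemma aut_pos : 0 < autFactor T.g T.θ := by
  have h1 : autFactor T.g T.θ ^ 2 + 1 = ((T.g 0 0 : ℝ) + T.g 1 1) * autFactor T.g T.θ := by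
    have hd : (T.g 0 0 : ℝ) * T.g 1 1 - T.g 0 1 * T.g 1 0 = 1 := by exact_mod_cast sl_det T.g
    rw [autFactor]
    linear_combination -(T.g 1 0 : ℝ) * T.fixed - hd
  have h2 : (2 : ℝ) < (T.g 0 0 : ℝ) + T.g 1 1 := by exact_mod_cast T.hyperbolic
  by_contra h
  nlinarith [sq_nonneg (autFactor T.g T.θ)]

lemma moebius_g : moebius T.g T.θ = T.θ := by
  have h := T.aut_pos
  rw [moebius, div_eq_iff h.ne', T.fixed, autFactor]

lemma pow_pos (n : ℕ) : 0 < (T.g ^ (n + 1)) 1 0 ∧ 0 < autFactor (T.g ^ (n + 1)) T.θ := by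
  induction n with
  | zero => simpa using ⟨T.deg_pos, T.aut_pos⟩
  | succ n ih =>
    have h : 0 < autFactor (T.g ^ (n + 1)) (moebius T.g T.θ) := by rw [T.moebius_g]; exact ih.2
    rw [_root_.pow_succ _ (n + 1)]
    refine ⟨mul_deg_pos ih.1 T.deg_pos T.aut_pos h, ?_⟩
    rw [autFactor_mul _ _ T.aut_pos.ne']
    exact mul_pos h T.aut_pos

lemma moebius_pow (n : ℕ) : moebius (T.g ^ (n + 1)) T.θ = T.θ := by
  have key : ∀ n : ℕ, ((T.g ^ n) 0 0 : ℝ) * T.θ + (T.g ^ n) 0 1 =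
      T.θ * autFactor (T.g ^ n) T.θ := by
    intro n
    induction n with
    | zero => simp [autFactor]
    | succ n ih =>
      have e01 : (T.g ^ n * T.g) 0 1 = (T.g ^ n) 0 0 * T.g 0 1 + (T.g ^ n) 0 1 * T.g 1 1 := by
        simp [Matrix.mul_apply, Fin.sum_univ_two]
      have hf := T.fixed
      rw [_root_.pow_succ, autFactor, sl_mul00, sl_mul10, sl_mul11, e01]
      rw [autFactor] at ih
      push_cast
      linear_combination ((T.g ^ n) 0 0 : ℝ) * hf + (T.g 1 0 * T.θ + T.g 1 1) * ih -
        T.θ * (T.g ^ n) 1 0 * hf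
  rw [moebius, div_eq_iff (T.pow_pos n).2.ne', key]

/-- The graded pieces `𝓗_{gⁿ}(θ)` of the homogeneous coordinate ring. In degree `0` the module is
the algebra of the noncommutative torus itself, whose holomorphic elements are the scalars; they
are realized here as constant functions. -/
def piece : ℕ → Submodule ℂ (ℤ → ℝ → ℂ)
  | 0 => Submodule.span ℂ {1}
  | n + 1 => holSections (T.g ^ (n + 1)) T.θ T.τ

/-- The product of sections: scalar multiplication if one of the degrees is `0`, and the pairing
`t_{g^m, g^n}` otherwise. -/
def mulFun : ℕ → ℕ → (ℤ → ℝ → ℂ) → (ℤ → ℝ → ℂ) → ℤ → ℝ → ℂ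
  | 0, _, f, h => f * h
  | _ + 1, 0, f, h => f * h
  | m + 1, n + 1, f, h => pairing (T.g ^ (m + 1)) (T.g ^ (n + 1)) T.θ f h

lemma mem_piece_zero {f : ℤ → ℝ → ℂ} (hf : f ∈ T.piece 0) : ∃ z : ℂ, f = z • 1 := by
  obtain ⟨z, hz⟩ := Submodule.mem_span_singleton.1 hf
  exact ⟨z, hz.symm⟩

lemma mulFun_zero_left (n : ℕ) (z : ℂ) (h : ℤ → ℝ → ℂ) : T.mulFun 0 n (z • 1) h = z • h := by
  simp [mulFun]

lemma mulFun_zero_right (n : ℕ) (z : ℂ) (h : ℤ → ℝ → ℂ) : T.mulFun n 0 h (z • 1) = z • h := by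
  cases n <;> simp [mulFun]

lemma mulFun_smul_left (m n : ℕ) (z : ℂ) (f h : ℤ → ℝ → ℂ) :
    T.mulFun m n (z • f) h = z • T.mulFun m n f h := by
  rcases m with _ | m
  · simp [mulFun]
  · rcases n with _ | n
    · simp [mulFun]
    · exact pairing_smul_left _ _ _ _ _ _

lemma mulFun_smul_right (m n : ℕ) (z : ℂ) (f h : ℤ → ℝ → ℂ) :
    T.mulFun m n f (z • h) = z • T.mulFun m n f h := by
  rcases m with _ | m
  · simp [mulFun]
  · rcases n with _ | n
    · simp [mulFun]
    · exact pairing_smul_right _ _ _ _ _ _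

lemma mem_piece_succ' {n : ℕ} (k : ℕ) {f : ℤ → ℝ → ℂ} (hf : f ∈ T.piece (n + 1)) :
    f ∈ holSections (T.g ^ (n + 1)) (moebius (T.g ^ (k + 1)) T.θ) T.τ := by
  rw [T.moebius_pow]; exact hf

lemma aut_pos' (n k : ℕ) : 0 < autFactor (T.g ^ (n + 1)) (moebius (T.g ^ (k + 1)) T.θ) := by
  rw [T.moebius_pow]; exact (T.pow_pos n).2

lemma mulFun_mem {m n : ℕ} {f h : ℤ → ℝ → ℂ} (hf : f ∈ T.piece m) (hh : h ∈ T.piece n) :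
    T.mulFun m n f h ∈ T.piece (m + n) := by
  rcases m with _ | m
  · obtain ⟨z, rfl⟩ := T.mem_piece_zero hf
    rw [T.mulFun_zero_left, zero_add]
    exact Submodule.smul_mem _ _ hh
  · rcases n with _ | n
    · obtain ⟨z, rfl⟩ := T.mem_piece_zero hh
      rw [T.mulFun_zero_right]
      exact Submodule.smul_mem _ _ hf
    · have := pairing_mem (T.pow_pos m).1 (T.pow_pos n).1 (T.pow_pos n).2 (T.aut_pos' m n)
        T.im_neg (T.mem_piece_succ' n hf) hh
      rw [← _root_.pow_add] at this
      exact this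

lemma mulFun_add_left {m n : ℕ} {f f' h : ℤ → ℝ → ℂ} (hf : f ∈ T.piece m) (hf' : f' ∈ T.piece m)
    (hh : h ∈ T.piece n) : T.mulFun m n (f + f') h = T.mulFun m n f h + T.mulFun m n f' h := by
  rcases m with _ | m
  · exact add_mul _ _ _
  · rcases n with _ | n
    · exact add_mul _ _ _
    · exact pairing_add_left (T.pow_pos m).1 (T.pow_pos n).1 (T.pow_pos n).2 (T.aut_pos' m n)
        T.im_neg (T.mem_piece_succ' n hf) (T.mem_piece_succ' n hf') hh

lemma mulFun_add_right {m n : ℕ} {f h h' : ℤ → ℝ → ℂ} (hf : f ∈ T.piece m) (hh : h ∈ T.piece n)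
    (hh' : h' ∈ T.piece n) : T.mulFun m n f (h + h') = T.mulFun m n f h + T.mulFun m n f h' := by
  rcases m with _ | m
  · exact mul_add _ _ _
  · rcases n with _ | n
    · exact mul_add _ _ _
    · exact pairing_add_right (T.pow_pos m).1 (T.pow_pos n).1 (T.pow_pos n).2 (T.aut_pos' m n)
        T.im_neg (T.mem_piece_succ' n hf) hh hh'

lemma mulFun_assoc {m n k : ℕ} {f h q : ℤ → ℝ → ℂ} (hf : f ∈ T.piece m) (hh : h ∈ T.piece n)
    (hq : q ∈ T.piece k) :
    T.mulFun (m + n) k (T.mulFun m n f h) q = T.mulFun m (n + k) f (T.mulFun n k h q) := by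
  rcases m with _ | m
  · obtain ⟨z, rfl⟩ := T.mem_piece_zero hf
    rw [T.mulFun_zero_left, T.mulFun_zero_left, T.mulFun_smul_left, zero_add]
  rcases n with _ | n
  · obtain ⟨z, rfl⟩ := T.mem_piece_zero hh
    rw [T.mulFun_zero_left, T.mulFun_zero_right, T.mulFun_smul_left, T.mulFun_smul_right,
      zero_add, add_zero]
  rcases k with _ | k
  · obtain ⟨z, rfl⟩ := T.mem_piece_zero hq
    rw [T.mulFun_zero_right, T.mulFun_zero_right, T.mulFun_smul_right, add_zero]
  have hτ := T.im_neg
  have e1 : T.g ^ (m + 1 + n + 1) = T.g ^ (m + 1) * T.g ^ (n + 1) := by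
    rw [← _root_.pow_add]; rfl
  have e2 : T.g ^ (n + 1 + k + 1) = T.g ^ (n + 1) * T.g ^ (k + 1) := by
    rw [← _root_.pow_add]; rfl
  obtain ⟨u, hu, rfl⟩ := (mem_holSections_iff (T.pow_pos m).1 (T.pow_pos m).2 hτ _).1 hf
  obtain ⟨v, hv, rfl⟩ := (mem_holSections_iff (T.pow_pos n).1 (T.pow_pos n).2 hτ _).1 hh
  obtain ⟨w, hw, rfl⟩ := (mem_holSections_iff (T.pow_pos k).1 (T.pow_pos k).2 hτ _).1 hq
  have p12 := (T.pow_pos (m + 1 + n)).1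
  have p23 := (T.pow_pos (n + 1 + k)).1
  have p123 := (T.pow_pos (m + 1 + n + 1 + k)).1
  have e3 : T.g ^ (m + 1 + n + 1 + k + 1) =
      T.g ^ (m + 1) * T.g ^ (n + 1) * T.g ^ (k + 1) := by
    rw [← _root_.pow_add, ← _root_.pow_add]; rfl
  have pg : ∀ (i j : ℕ) (u v : ℤ → ℂ), pairing (T.g ^ (i + 1)) (T.g ^ (j + 1)) T.θ
      (fun α (x : ℝ) => u α * Complex.exp (-gaussExp (T.g ^ (i + 1)) T.θ T.τ * (x : ℂ) ^ 2))
      (fun α (x : ℝ) => v α * Complex.exp (-gaussExp (T.g ^ (j + 1)) T.θ T.τ * (x : ℂ) ^ 2)) =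
      fun γ (x : ℝ) => coeffMul (T.g ^ (i + 1)) (T.g ^ (j + 1)) T.τ u v γ *
        Complex.exp (-gaussExp (T.g ^ (i + 1 + j + 1)) T.θ T.τ * (x : ℂ) ^ 2) := by
    intro i j u v
    have := pairing_gauss (τ := T.τ) (T.pow_pos i).1 (T.pow_pos j).1 (T.pow_pos j).2
      (T.aut_pos' i j) u v
    rw [T.moebius_pow, ← _root_.pow_add] at this
    exact this
  have e5 : ∀ (i j : ℕ) (f h : ℤ → ℝ → ℂ), T.mulFun (i + 1) (j + 1) f h =
      pairing (T.g ^ (i + 1)) (T.g ^ (j + 1)) T.θ f h := fun _ _ _ _ => rfl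
  rw [← Nat.add_assoc (m + 1) n 1, ← Nat.add_assoc (n + 1) k 1, e5, e5, e5, e5]
  rw [pg m n, pg n k, pg (m + 1 + n) k, pg m (n + 1 + k)]
  have hs := coeffMul_assoc (g₁ := T.g ^ (m + 1)) (g₂ := T.g ^ (n + 1)) (g₃ := T.g ^ (k + 1))
    (T.pow_pos m).1 (T.pow_pos n).1 (T.pow_pos k).1 (e1 ▸ p12) (e2 ▸ p23) (e3 ▸ p123) hτ hu hv hw
  rw [← e1, ← e2] at hs
  rw [hs]
  have e4 : m + 1 + n + 1 + k + 1 = m + 1 + (n + 1 + k) + 1 := by omega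
  rw [e4]

lemma gradedMonoid_ext {m n : ℕ} (h : m = n) {f : T.piece m} {k : T.piece n}
    (hfk : (f : ℤ → ℝ → ℂ) = k) :
    (GradedMonoid.mk m f : GradedMonoid fun n => T.piece n) = GradedMonoid.mk n k := by
  subst h
  exact congrArg _ (Subtype.ext hfk)

instance gOne : GradedMonoid.GOne fun n => T.piece n where
  one := ⟨1, Submodule.mem_span_singleton_self _⟩

instance gMul : GradedMonoid.GMul fun n => T.piece n where
  mul {m n} f h := ⟨T.mulFun m n f h, T.mulFun_mem f.2 h.2⟩

instance gRing : DirectSum.GRing fun n => T.piece n where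
  mul_zero {m n} f := Subtype.ext (by
    have := T.mulFun_smul_right m n 0 f 0
    simp only [zero_smul] at this
    exact this)
  zero_mul {m n} f := Subtype.ext (by
    have := T.mulFun_smul_left m n 0 0 f
    simp only [zero_smul] at this
    exact this)
  mul_add f h k := Subtype.ext (T.mulFun_add_right f.2 h.2 k.2)
  add_mul f h k := Subtype.ext (T.mulFun_add_left f.2 h.2 k.2)
  one_mul f := T.gradedMonoid_ext (zero_add _) (by
    have := T.mulFun_zero_left f.1 1 f.2
    simp only [one_smul] at this
    exact this)
  mul_one f := T.gradedMonoid_ext (add_zero _) (by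
    have := T.mulFun_zero_right f.1 1 f.2
    simp only [one_smul] at this
    exact this)
  mul_assoc f h k := T.gradedMonoid_ext (add_assoc _ _ _)
    (T.mulFun_assoc f.2.2 h.2.2 k.2.2)
  natCast n := ⟨(n : ℂ) • 1, Submodule.smul_mem _ _ (Submodule.mem_span_singleton_self _)⟩
  natCast_zero := Subtype.ext (by simp)
  natCast_succ n := Subtype.ext (by
    change ((n + 1 : ℕ) : ℂ) • (1 : ℤ → ℝ → ℂ) = (n : ℂ) • 1 + 1
    rw [Nat.cast_succ, add_smul, one_smul])
  intCast n := ⟨(n : ℂ) • 1, Submodule.smul_mem _ _ (Submodule.mem_span_singleton_self _)⟩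
  intCast_ofNat n := Subtype.ext (by simp)
  intCast_negSucc_ofNat n := Subtype.ext (by
    change ((Int.negSucc n : ℤ) : ℂ) • (1 : ℤ → ℝ → ℂ) = -(((n + 1 : ℕ) : ℂ) • 1)
    rw [Int.cast_negSucc, neg_smul])

instance gAlgebra : DirectSum.GAlgebra ℂ fun n => T.piece n where
  toFun :=
    { toFun := fun z => ⟨z • 1, Submodule.smul_mem _ _ (Submodule.mem_span_singleton_self _)⟩
      map_zero' := Subtype.ext (zero_smul _ _)
      map_add' := fun z w => Subtype.ext (add_smul _ _ _) }
  map_one := Subtype.ext (one_smul _ _)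
  map_mul z w := T.gradedMonoid_ext (zero_add 0).symm (by
    change (z * w) • (1 : ℤ → ℝ → ℂ) = T.mulFun 0 0 (z • 1) (w • 1)
    rw [T.mulFun_zero_left, mul_smul])
  commutes z f := T.gradedMonoid_ext ((zero_add _).trans (add_zero _).symm) (by
    change T.mulFun 0 f.1 (z • 1) f.2 = T.mulFun f.1 0 f.2 (z • 1)
    rw [T.mulFun_zero_left, T.mulFun_zero_right])
  smul_def z f := T.gradedMonoid_ext (zero_add _).symm (by
    change z • (f.2 : ℤ → ℝ → ℂ) = T.mulFun 0 f.1 (z • 1) f.2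
    rw [T.mulFun_zero_left])

/-- The homogeneous coordinate ring `B_g(θ, τ) = ⨁_{n ≥ 0} 𝓗_{gⁿ}(θ)`. -/
abbrev CoordRing : Type := DirectSum ℕ fun n => T.piece n

/-! ### Theta constants and the relations -/

/-- The number `a + d`. -/
def tr : ℕ := (T.g 0 0 + T.g 1 1).toNat

/-- The number `c`. -/
def deg : ℕ := (T.g 1 0).toNat

lemma tr_cast : (T.tr : ℤ) = T.g 0 0 + T.g 1 1 := by
  have := T.hyperbolic
  rw [tr, Int.toNat_of_nonneg (by omega)]

lemma deg_cast : (T.deg : ℤ) = T.g 1 0 := by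
  have := T.deg_pos
  rw [deg, Int.toNat_of_nonneg (by omega)]

lemma tr_add_two_le_deg : T.tr + 2 ≤ T.deg := by
  have := T.degree_ge
  have := T.tr_cast
  have := T.deg_cast
  omega

end RMTorus

/-- The theta function with characteristics `(r, s)`. -/
def thetaChar (r s : ℚ) (z τ : ℂ) : ℂ :=
  ∑' n : ℤ, Complex.exp (Real.pi * Complex.I * ((n : ℂ) + r) ^ 2 * τ +
    2 * Real.pi * Complex.I * ((n : ℂ) + r) * (z + s))

/-- The theta constant `ϑ_r(τ) = ϑ_{r,0}(0, τ)`. -/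
def thetaConst (r : ℚ) (τ : ℂ) : ℂ := thetaChar r 0 0 τ

/-- The elements `i` of `Fin n` stand for the indices `1, …, n`; this is the index `i + 1`. -/
def idx {n : ℕ} (i : Fin n) : ℤ := (i : ℤ) + 1

namespace RMTorus

variable (T : RMTorus)

/-- `τ' = -c(a+d)τ`. -/
def tauPrime : ℂ := -((T.deg : ℂ) * T.tr) * T.τ

/-- `q(μ) = dμ/c - μ/(c(a+d)) + 1/(a+d)`. -/
def q (μ : ℤ) : ℚ := (T.g 1 1 : ℚ) * μ / T.deg - μ / (T.deg * T.tr) + 1 / T.tr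

/-- `Λ_{i,j} = -dj/c - i/(a+d)`. -/
def Λ (i j : ℤ) : ℚ := -((T.g 1 1 : ℚ) * j / T.deg) - i / T.tr

/-- The `(a+d) × c` matrix `M(μ)` of theta constants. -/
def M (μ : Fin T.deg) : Matrix (Fin T.tr) (Fin T.deg) ℂ :=
  Matrix.of fun i j => thetaConst (T.q (idx μ) + T.Λ (idx i) (idx j)) T.tauPrime

/-- `F^{g,μ}_{i₁,…,i_{a+d}}`: the determinant of the matrix formed by the columns
`i₁, …, i_{a+d}` of `M(μ)`, in this order. -/
def F (μ : Fin T.deg) (s : Fin T.tr → Fin T.deg) : ℂ := ((T.M μ).submatrix id s).det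

/-- `α(μ, j)`: the index in `{1, …, c}` congruent to `d(μ - j)` modulo `c`. -/
def α (μ j : Fin T.deg) : Fin T.deg :=
  ⟨((T.g 1 1 * (idx μ - idx j) - 1) % T.deg).toNat, by
    have h : (0 : ℤ) < T.deg := by rw [T.deg_cast]; exact T.deg_pos
    have h1 := Int.emod_nonneg (T.g 1 1 * (idx μ - idx j) - 1) h.ne'
    have h2 := Int.emod_lt_of_pos (T.g 1 1 * (idx μ - idx j) - 1) h
    omega⟩

/-- The `j`-th of the first `a + d` columns. -/
def firstCol (j : Fin T.tr) : Fin T.deg := Fin.castLE ((Nat.le_add_right _ 2).trans T.tr_add_two_le_deg) j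

/-- The column `a + d + k`. -/
def laterCol (k : Fin (T.deg - T.tr)) : Fin T.deg := ⟨T.tr + k, by have := k.2; omega⟩

/-- The vector `v^{μ,k}` formed from the columns of `M(μ)` arranged in the order
`σ(1), …, σ(c)`. -/
def v (μ : Fin T.deg) (σ : Equiv.Perm (Fin T.deg)) (k : Fin (T.deg - T.tr)) (j : Fin T.deg) : ℂ :=
  if h : (σ.symm j : ℕ) < T.tr then
    T.F μ (Function.update (fun i => σ (T.firstCol i)) ⟨σ.symm j, h⟩ (σ (T.laterCol k)))
  else if j = σ (T.laterCol k) then -T.F μ fun i => σ (T.firstCol i)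
  else 0

/-- The quadratic relation `f^μ_k = ∑_j v^{μ,k}_j x_{α(μ,j)} x_j` in the free algebra. -/
def rel (μ : Fin T.deg) (σ : Equiv.Perm (Fin T.deg)) (k : Fin (T.deg - T.tr)) :
    FreeAlgebra ℂ (Fin T.deg) :=
  ∑ j, T.v μ σ k j • (FreeAlgebra.ι ℂ (T.α μ j) * FreeAlgebra.ι ℂ j)

/-- The free algebra on `x₁, …, x_c` modulo the relations `f^μ_k = 0`, where `σ μ` is the order in
which the columns of `M(μ)` are arranged. -/
abbrev Presented (σ : Fin T.deg → Equiv.Perm (Fin T.deg)) : Type :=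
  RingQuot fun p r : FreeAlgebra ℂ (Fin T.deg) => (∃ μ k, p = T.rel μ (σ μ) k) ∧ r = 0

/-- The class of the generator `x_i`. -/
def gen (σ : Fin T.deg → Equiv.Perm (Fin T.deg)) (i : Fin T.deg) : T.Presented σ :=
  RingQuot.mkAlgHom ℂ _ (FreeAlgebra.ι ℂ i)

/-- The basis `φ₁, …, φ_c` of `𝓗_g(θ)`, as elements of degree one of `B_g(θ, τ)`. -/
def φ (i : Fin T.deg) : T.CoordRing :=
  DirectSum.of (fun n => T.piece n) 1 ⟨basisSection T.g T.θ T.τ (idx i), by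
    have h := basisSection_mem T.deg_pos T.aut_pos T.im_neg (idx i)
    have e : T.g ^ (0 + 1) = T.g := by simp
    change _ ∈ holSections (T.g ^ (0 + 1)) T.θ T.τ
    rw [e]
    exact h⟩

end RMTorus

end NCTorus

end

/-!
Sections of degree `n + 1` of the homogeneous coordinate ring are Gaussians with coefficients in the
`c_{n+1}`-periodic sequences, where `c_n` is the lower left entry of `gⁿ`, and their product is a
sum over `ℤ` of coefficients against a Gaussian (`twMul`). The proof shows that the ring is
generated in degree one and that its syzygies are generated in degree two, and then identifies the
quadratic relations.

*Analysis.* A function on `ℂˣ` with `f(Tw) = A w^{-N} f(w)` that has more than `N` zeros modulo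
`T^ℤ` vanishes, and for exactly `N` zeros their product is prescribed (`eq_zero_or_of_zeros`); the
zeros are divided out one at a time by a theta product. Gaussian sums with quasi-periodic
coefficients are such functions (`eq_zero_of_gaussSum_zeros`). Two consequences drive everything
else: products of sections of the modules of `g₁` and `g₂` span the sections for `g₁g₂` if
`c₁₂ < c₁c₂` (`mem_span_twMul`), and multiplication by all sections for `g₁` is injective if
`c₂ < c₁c₁₂` (`eq_zero_of_twMul_eq_zero`).

*Syzygies.* By the first consequence the multiplication `𝓗_g ⊗ 𝓗_{g^{m+1}} → 𝓗_{g^{m+2}}` is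
onto (`mulHom_surjective`), so its kernel has dimension `c c_{m+1} - c_{m+2}`. This is the degree of
`s⁻¹g^{m+1}` for a matrix `s ∈ SL₂(ℤ)` (`mutation`), and the kernel is in fact the image of the
sections of a module for `s⁻¹g^{m+1}`, twisted by signs and translated by a half-period. Indeed
there is a canonical tensor `∑ φ_i ⊗ s_i`, with sections `s_i` for `s`, whose product is a sum of
Gaussians at half-integers with alternating signs and therefore vanishes
(`sum_twMul_delta_signDelta`); multiplying by sections for `s⁻¹g^{m+1}` gives syzygies by
associativity (`twMul_assoc`), the resulting map is injective by the second consequence, and the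
dimensions agree (`range_syzHom`). Finally the sections for `s⁻¹g^{m+2}` are spanned by products of
those for `s⁻¹g` with those for `g^{m+1}`; this uses `c ≥ a + d + 2`. Hence every syzygy is a
combination of quadratic relations multiplied from the right (`mem_span_of_mulHom_eq_zero`), which
is the criterion for a quadratic presentation (`exists_linearMap_of_quadratic`).

*Quadratic relations.* The products `φ_{α(μ,j)} φ_j` have the columns of `M(μ)` as coefficients, so
the relations of degree two form the direct sum over `μ` of the kernels of the matrices `M(μ)`. A
combination of the rows of `M(μ)` is a Gaussian sum with `(a+d)`-periodic coefficients evaluated at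
`c` points; the bound on the number of zeros shows that `M(μ)` has rank `a + d`, and, if `a + d` is
odd, that any `a + d` columns are independent (`exists_perm_F_ne_zero`, `F_firstCol_ne_zero`). By
Cramer's rule the kernel has the basis `v^{μ,k}` (`exists_eq_sum_smul_v`).
-/

noncomputable section

namespace NCTorus

open Filter Topology

/-! ### Zeros of theta functions -/

/-- The `q`-Pochhammer symbol `(w; T)_∞ = ∏_{n ≥ 0} (1 - Tⁿ w)`. -/
def qPoch (T w : ℂ) : ℂ := ∏' n : ℕ, (1 - T ^ n * w)

section

variable {T : ℂ}

lemma summable_qPoch (hT : ‖T‖ < 1) (w : ℂ) : Summable fun n : ℕ => ‖-(T ^ n * w)‖ := by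
  simp only [norm_neg, norm_mul, norm_pow]
  exact (summable_geometric_of_lt_one (norm_nonneg _) hT).mul_right _

lemma multipliable_qPoch (hT : ‖T‖ < 1) (w : ℂ) : Multipliable fun n : ℕ => (1 - T ^ n * w) := by
  simpa [sub_eq_add_neg] using multipliable_one_add_of_summable (summable_qPoch hT w)

lemma differentiable_qPoch (hT : ‖T‖ < 1) : Differentiable ℂ (qPoch T) := by
  intro w
  have h : HasProdLocallyUniformlyOn (fun (n : ℕ) (w : ℂ) => 1 + -(T ^ n * w))
      (fun w => ∏' n : ℕ, (1 + -(T ^ n * w))) (Metric.ball 0 (‖w‖ + 1)) := by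
    refine Summable.hasProdLocallyUniformlyOn_nat_one_add (u := fun n => ‖T‖ ^ n * (‖w‖ + 1))
      Metric.isOpen_ball ?_ ?_ ?_
    · exact (summable_geometric_of_lt_one (norm_nonneg _) hT).mul_right _
    · refine .of_forall fun n x hx => ?_
      rw [norm_neg, norm_mul, norm_pow]
      gcongr
      simpa using (Metric.mem_ball.1 hx).le
    · intro n
      fun_prop
  have hd := h.differentiableOn (.of_forall fun _ => by
    simpa [Finset.prod_fn] using DifferentiableOn.finsetProd (fun _ _ => by fun_prop))
    Metric.isOpen_ball
  have := hd.differentiableAt (Metric.isOpen_ball.mem_nhds (by simp : w ∈ Metric.ball 0 (‖w‖ + 1)))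
  simp only [← sub_eq_add_neg] at this
  exact this

lemma qPoch_eq (hT : ‖T‖ < 1) (w : ℂ) : qPoch T w = (1 - w) * qPoch T (T * w) := by
  have e : (fun n : ℕ => 1 - T ^ (n + 1) * w) = fun n : ℕ => 1 - T ^ n * (T * w) := by
    funext n; ring
  have h : Multipliable fun n : ℕ => 1 - T ^ (n + 1) * w := by
    rw [e]; exact multipliable_qPoch hT (T * w)
  have h2 := tprod_eq_zero_mul' (f := fun n : ℕ => 1 - T ^ n * w) h
  rw [e, pow_zero, one_mul] at h2
  exact h2

lemma qPoch_zero (T : ℂ) : qPoch T 0 = 1 := by simp [qPoch]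

lemma qPoch_ne_zero (hT : ‖T‖ < 1) {w : ℂ} (hw : ∀ n : ℕ, T ^ n * w ≠ 1) : qPoch T w ≠ 0 := by
  have := tprod_one_add_ne_zero_of_summable (f := fun n : ℕ => -(T ^ n * w))
    (fun n => by rw [← sub_eq_add_neg]; exact sub_ne_zero.2 (hw n).symm) (summable_qPoch hT w)
  simpa only [qPoch, sub_eq_add_neg] using this

/-- A theta function with simple zeros at the powers of `T`. -/
def thetaProd (T w : ℂ) : ℂ := qPoch T w * qPoch T (T / w)

lemma differentiableAt_thetaProd (hT : ‖T‖ < 1) {w : ℂ} (hw : w ≠ 0) :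
    DifferentiableAt ℂ (thetaProd T) w := by
  have h := differentiable_qPoch hT
  exact (h w).mul ((h (T / w)).comp w (by fun_prop (disch := exact hw)))

lemma thetaProd_one (hT : ‖T‖ < 1) : thetaProd T 1 = 0 := by
  rw [thetaProd, qPoch_eq hT]; simp

lemma thetaProd_mul (hT : ‖T‖ < 1) (hT0 : T ≠ 0) {w : ℂ} (hw : w ≠ 0) :
    w * thetaProd T (T * w) = -thetaProd T w := by
  have h1 := qPoch_eq hT w
  have h2 := qPoch_eq hT (w⁻¹)
  have e1 : T / (T * w) = w⁻¹ := by field_simp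
  have e2 : T * w⁻¹ = T / w := rfl
  rw [thetaProd, thetaProd, e1, h2, h1, e2]
  field_simp
  ring

lemma thetaProd_ne_zero (hT : ‖T‖ < 1) {w : ℂ} (hw : w ≠ 0) (h : ∀ k : ℤ, w ≠ T ^ k) :
    thetaProd T w ≠ 0 := by
  refine mul_ne_zero (qPoch_ne_zero hT fun n hn => h (-n) ?_)
    (qPoch_ne_zero hT fun n hn => h (n + 1) ?_)
  · rw [zpow_neg, zpow_natCast]
    exact eq_inv_of_mul_eq_one_right hn
  · rw [← mul_div_assoc, div_eq_one_iff_eq hw, ← pow_succ] at hn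
    exact_mod_cast hn.symm

lemma deriv_thetaProd_one (hT : ‖T‖ < 1) : deriv (thetaProd T) 1 ≠ 0 := by
  by_cases hT0 : T = 0
  · subst hT0
    have : thetaProd 0 = fun w => qPoch 0 w := by
      funext w; simp [thetaProd, qPoch_zero]
    have e : (fun w => qPoch 0 w) = fun w => (1 - w) := by
      funext w; rw [qPoch_eq (by simp)]; simp [qPoch_zero]
    rw [this, e]
    simp
  have hd := differentiable_qPoch hT
  have h1 : thetaProd T = fun w => (1 - w) * (qPoch T (T * w) * qPoch T (T / w)) := by
    funext w
    rw [thetaProd, qPoch_eq hT, mul_assoc]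
  have h2 : DifferentiableAt ℂ (fun w => qPoch T (T * w) * qPoch T (T / w)) 1 :=
    ((hd (T * 1)).comp 1 (by fun_prop)).mul ((hd (T / 1)).comp 1 (by fun_prop (disch := simp)))
  have h3 : HasDerivAt (fun w : ℂ => 1 - w) (-1) 1 := by
    simpa using (hasDerivAt_id (1 : ℂ)).const_sub 1
  rw [h1, show deriv (fun w => (1 - w) * (qPoch T (T * w) * qPoch T (T / w))) 1 = _ from
    (h3.mul h2.hasDerivAt).deriv]
  have h4 : qPoch T T ≠ 0 := by
    refine qPoch_ne_zero hT fun n hn => ?_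
    have : ‖T ^ n * T‖ = 1 := by rw [hn, norm_one]
    rw [← pow_succ, norm_pow] at this
    exact (pow_lt_one₀ (norm_nonneg _) hT (by omega)).ne this
  simpa using h4

/-- A zero at `w = 1` of a function on `ℂˣ` can be divided out together with its translates under
`T^ℤ`. -/
lemma exists_eq_thetaProd_mul (hT : ‖T‖ < 1) (hT0 : T ≠ 0) {f : ℂ → ℂ}
    (hf : ∀ w ≠ 0, DifferentiableAt ℂ f w) (hf0 : ∀ k : ℤ, f (T ^ k) = 0) :
    ∃ h : ℂ → ℂ, (∀ w ≠ 0, DifferentiableAt ℂ h w) ∧ ∀ w ≠ 0, f w = thetaProd T w * h w := by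
  have hz : ∀ k : ℤ, thetaProd T (T ^ k) = 0 ∧ deriv (thetaProd T) (T ^ k) ≠ 0 := by
    have step : ∀ w ≠ 0, (thetaProd T w = 0 ∧ deriv (thetaProd T) w ≠ 0) ↔
        (thetaProd T (T * w) = 0 ∧ deriv (thetaProd T) (T * w) ≠ 0) := by
      intro w hw
      have h0 := thetaProd_mul hT hT0 hw
      have e : thetaProd T w = 0 ↔ thetaProd T (T * w) = 0 := by
        rw [← neg_eq_zero, ← h0]; simp [hw]
      rw [e]
      refine and_congr_right fun hz => not_congr ?_
      have hd : HasDerivAt (fun w => w * thetaProd T (T * w))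
          (1 * thetaProd T (T * w) + w * (deriv (thetaProd T) (T * w) * (T * 1))) w := by
        refine (hasDerivAt_id w).mul ?_
        exact (differentiableAt_thetaProd hT (mul_ne_zero hT0 hw)).hasDerivAt.comp w
          ((hasDerivAt_id w).const_mul T)
      have hd' : HasDerivAt (fun w => w * thetaProd T (T * w)) (-deriv (thetaProd T) w) w := by
        refine (differentiableAt_thetaProd hT hw).hasDerivAt.neg.congr_of_eventuallyEq ?_
        filter_upwards [isOpen_ne.mem_nhds hw] with x hx using thetaProd_mul hT hT0 hx
      have := hd.unique hd'
      rw [← neg_eq_zero, ← this, hz]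
      simp [hw, hT0]
    intro k
    induction k using Int.induction_on with
    | zero => simpa using ⟨thetaProd_one hT, deriv_thetaProd_one hT⟩
    | succ n ih =>
      have := (step _ (zpow_ne_zero n hT0)).1 ih
      rwa [mul_comm, ← zpow_add_one₀ hT0] at this
    | pred n ih =>
      refine (step _ (zpow_ne_zero _ hT0)).2 ?_
      rw [mul_comm, ← zpow_add_one₀ hT0]
      simpa using ih
  let P := thetaProd T
  let h : ℂ → ℂ := fun w => if P w = 0 then deriv f w / deriv P w else f w / P w
  have hPz : ∀ w ≠ 0, P w = 0 → ∃ k : ℤ, w = T ^ k := fun w hw h0 => by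
    by_contra! hk
    exact thetaProd_ne_zero hT hw hk h0
  refine ⟨h, fun w hw => ?_, fun w hw => ?_⟩
  · by_cases h0 : P w = 0
    · obtain ⟨k, rfl⟩ := hPz w hw h0
      -- near a common zero the quotient is that of the divided differences
      have hopen : ({0}ᶜ : Set ℂ) ∈ 𝓝 (T ^ k) := isOpen_ne.mem_nhds hw
      have hdf : DifferentiableAt ℂ (dslope f (T ^ k)) (T ^ k) :=
        ((Complex.differentiableOn_dslope hopen).2
          fun x hx => (hf x hx).differentiableWithinAt).differentiableAt hopen
      have hdP : DifferentiableAt ℂ (dslope P (T ^ k)) (T ^ k) :=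
        ((Complex.differentiableOn_dslope hopen).2
          fun x hx => (differentiableAt_thetaProd hT hx).differentiableWithinAt).differentiableAt
            hopen
      have hne : dslope P (T ^ k) (T ^ k) ≠ 0 := by rw [dslope_same]; exact (hz k).2
      refine (hdf.div hdP hne).congr_of_eventuallyEq ?_
      filter_upwards [hdP.continuousAt.eventually_ne hne] with x hx
      by_cases hxk : x = T ^ k
      · subst hxk
        simp only [h, if_pos h0, Pi.div_apply, dslope_same]
      · have e1 := sub_smul_dslope f (T ^ k) x
        have e2 := sub_smul_dslope P (T ^ k) x
        rw [hf0, sub_zero, smul_eq_mul] at e1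
        rw [h0, sub_zero, smul_eq_mul] at e2
        have hs : x - T ^ k ≠ 0 := sub_ne_zero.2 hxk
        have hPx : P x ≠ 0 := by rw [← e2]; exact mul_ne_zero hs hx
        simp only [h, if_neg hPx, Pi.div_apply]
        rw [← e1, ← e2, mul_div_mul_left _ _ hs]
    · have hP := differentiableAt_thetaProd hT hw
      refine ((hf w hw).div hP h0).congr_of_eventuallyEq ?_
      filter_upwards [hP.continuousAt.eventually_ne h0] with x hx
      simp only [h, if_neg (show P x ≠ 0 from hx), Pi.div_apply]
      rfl
  · by_cases h0 : P w = 0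
    · obtain ⟨k, rfl⟩ := hPz w hw h0
      rw [hf0]; change 0 = P _ * _; rw [h0, zero_mul]
    · simp only [h, if_neg h0]
      exact (mul_div_cancel₀ _ h0).symm

end

section

variable {T : ℂ}

lemma exists_zpow_smul_mem_annulus (hT : ‖T‖ < 1) (hT0 : T ≠ 0) {w : ℂ} (hw : w ≠ 0)
    (hw1 : ‖w‖ ≤ 1) : ∃ (n : ℕ) (x : ℂ), w = T ^ n * x ∧ ‖T‖ < ‖x‖ ∧ ‖x‖ ≤ 1 := by
  obtain ⟨n, hn1, hn2⟩ := exists_nat_pow_near_of_lt_one (norm_pos_iff.2 hw) hw1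
    (norm_pos_iff.2 hT0) hT
  have hp : 0 < ‖T‖ ^ n := pow_pos (norm_pos_iff.2 hT0) n
  refine ⟨n, w / T ^ n, (mul_div_cancel₀ _ (pow_ne_zero n hT0)).symm, ?_, ?_⟩
  · rw [norm_div, norm_pow, lt_div_iff₀ hp, mul_comm, ← pow_succ]; exact hn1
  · rw [norm_div, norm_pow, div_le_one hp]; exact hn2

/-- A nonzero function on `ℂˣ` with `h(Tw) = B w^m h(w)`, `m ≥ 0`, exists only if `m = 0` and `B`
is a power of `T`: after multiplication by a power of `w` it extends holomorphically to `0`, and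
its order of vanishing there would contradict the functional equation. -/
lemma eq_zero_or_of_quasiperiodic (hT : ‖T‖ < 1) (hT0 : T ≠ 0) {h : ℂ → ℂ} {B : ℂ} {m : ℕ}
    (hd : ∀ w ≠ 0, DifferentiableAt ℂ h w) (hq : ∀ w ≠ 0, h (T * w) = B * w ^ m * h w) :
    (∀ w ≠ 0, h w = 0) ∨ m = 0 ∧ ∃ k : ℤ, B = T ^ k := by
  obtain ⟨K, hK⟩ : ∃ K : ℕ, ‖T‖ ^ K * ‖B‖ ≤ 1 := by
    have := ((tendsto_pow_atTop_nhds_zero_of_lt_one (norm_nonneg T) hT).mul_const ‖B‖)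
    rw [zero_mul] at this
    obtain ⟨K, hK⟩ := (this.eventually (gt_mem_nhds one_pos)).exists
    exact ⟨K, hK.le⟩
  -- `R` is bounded on the punctured unit disc, since `‖R‖` does not increase from an annulus to
  -- its translates under multiplication by `T`
  let R : ℂ → ℂ := fun w => w ^ K * h w
  have hRd : ∀ w ≠ 0, DifferentiableAt ℂ R w := fun w hw => by
    exact (differentiableAt_id.pow K).mul (hd w hw)
  have hRq : ∀ w ≠ 0, R (T * w) = T ^ K * B * w ^ m * R w := fun w hw => by
    simp only [R]; rw [hq w hw]; ring
  have hR1 : ∀ w ≠ 0, ‖w‖ ≤ 1 → ‖R (T * w)‖ ≤ ‖R w‖ := by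
    intro w hw hw1
    rw [hRq w hw, norm_mul, norm_mul, norm_mul, norm_pow, norm_pow]
    have h1 : ‖w‖ ^ m ≤ 1 := pow_le_one₀ (norm_nonneg _) hw1
    have h2 : ‖T‖ ^ K * ‖B‖ * ‖w‖ ^ m ≤ 1 :=
      mul_le_one₀ hK (by positivity) h1
    exact mul_le_of_le_one_left (norm_nonneg _) h2
  have hRn : ∀ (n : ℕ), ∀ w ≠ 0, ‖w‖ ≤ 1 → ‖R (T ^ n * w)‖ ≤ ‖R w‖ := by
    intro n
    induction n with
    | zero => intro w _ _; simp
    | succ n ih =>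
      intro w hw hw1
      have e : T ^ (n + 1) * w = T ^ n * (T * w) := by ring
      rw [e]
      refine (ih (T * w) (mul_ne_zero hT0 hw) ?_).trans (hR1 w hw hw1)
      rw [norm_mul]
      exact mul_le_one₀ hT.le (norm_nonneg _) hw1
  have hcomp : IsCompact (Metric.closedBall (0 : ℂ) 1 \ Metric.ball 0 ‖T‖) :=
    (isCompact_closedBall _ _).diff Metric.isOpen_ball
  have hann : ∀ x ∈ Metric.closedBall (0 : ℂ) 1 \ Metric.ball 0 ‖T‖, x ≠ 0 := by
    rintro x ⟨-, hx⟩ rfl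
    exact hx (by simpa using hT0)
  obtain ⟨C, hC⟩ := hcomp.exists_bound_of_continuousOn (f := R)
    fun x hx => (hRd x (hann x hx)).continuousAt.continuousWithinAt
  have hbdd : ∀ w ≠ 0, ‖w‖ ≤ 1 → ‖R w‖ ≤ C := by
    intro w hw hw1
    obtain ⟨n, x, rfl, hx1, hx2⟩ := exists_zpow_smul_mem_annulus hT hT0 hw hw1
    have hx0 : x ≠ 0 := norm_pos_iff.1 ((norm_nonneg _).trans_lt hx1)
    refine (hRn n x hx0 hx2).trans (hC x ⟨by simpa using hx2, by simpa using hx1.le⟩)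
  let S : ℂ → ℂ := Function.update R 0 (limUnder (𝓝[≠] 0) R)
  have hS1 : DifferentiableOn ℂ S (Metric.ball 0 1) := by
    refine Complex.differentiableOn_update_limUnder_of_bddAbove
      (Metric.ball_mem_nhds _ one_pos) (fun x hx => (hRd x hx.2).differentiableWithinAt)
      ⟨C, ?_⟩
    rintro _ ⟨x, hx, rfl⟩
    exact hbdd x hx.2 (by simpa using (Metric.mem_ball.1 hx.1).le)
  have hSR : ∀ w ≠ 0, S w = R w := fun w hw => Function.update_of_ne hw _ _
  have hSd : Differentiable ℂ S := by
    intro w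
    by_cases hw : w = 0
    · subst hw
      exact hS1.differentiableAt (Metric.ball_mem_nhds _ one_pos)
    · refine (hRd w hw).congr_of_eventuallyEq ?_
      filter_upwards [isOpen_ne.mem_nhds hw] with x hx using hSR x hx
  have hSq : ∀ w ≠ 0, S (T * w) = T ^ K * B * w ^ m * S w := fun w hw => by
    rw [hSR _ hw, hSR _ (mul_ne_zero hT0 hw), hRq w hw]
  have hSa : AnalyticAt ℂ S 0 := hSd.analyticAt 0
  by_cases hzero : ∀ᶠ z in 𝓝 0, S z = 0
  · left
    have hS0 : S = 0 := AnalyticOnNhd.eq_of_eventuallyEq (fun z _ => hSd.analyticAt z)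
      (fun z _ => analyticAt_const) hzero
    intro w hw
    have := hSR w hw
    rw [hS0] at this
    simpa [R, hw] using this.symm
  · right
    -- compare the leading coefficients at `0` of the two sides of `hSq`
    obtain ⟨n, g, hg, hg0, hgS⟩ := hSa.exists_eventuallyEq_pow_smul_nonzero_iff.2 hzero
    have hTc : Tendsto (fun w : ℂ => T * w) (𝓝 0) (𝓝 0) := by
      have : Continuous fun w : ℂ => T * w := by fun_prop
      simpa using this.tendsto 0
    have key : ∀ᶠ w in 𝓝[≠] (0 : ℂ), T ^ n * g (T * w) = T ^ K * B * w ^ m * g w := by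
      have h1 := hTc.eventually hgS
      filter_upwards [h1.filter_mono nhdsWithin_le_nhds, hgS.filter_mono nhdsWithin_le_nhds,
        self_mem_nhdsWithin] with w hw1 hw2 hw0
      have h2 := hSq w hw0
      rw [hw1, hw2, sub_zero, sub_zero, smul_eq_mul, smul_eq_mul, mul_pow] at h2
      have h3 : w ^ n ≠ 0 := pow_ne_zero n hw0
      apply mul_left_cancel₀ h3
      linear_combination h2
    have l1 : Tendsto (fun w => T ^ n * g (T * w)) (𝓝[≠] 0) (𝓝 (T ^ n * g 0)) := by
      have := (hg.continuousAt.tendsto.comp hTc).const_mul (T ^ n)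
      exact this.mono_left nhdsWithin_le_nhds
    have l2 : Tendsto (fun w => T ^ K * B * w ^ m * g w) (𝓝[≠] 0)
        (𝓝 (T ^ K * B * 0 ^ m * g 0)) := by
      have h1 : Tendsto (fun w : ℂ => T ^ K * B * w ^ m) (𝓝 0) (𝓝 (T ^ K * B * 0 ^ m)) := by
        have : Continuous fun w : ℂ => T ^ K * B * w ^ m := by fun_prop
        exact this.tendsto 0
      exact (h1.mul hg.continuousAt.tendsto).mono_left nhdsWithin_le_nhds
    have h0 := tendsto_nhds_unique (l1.congr' key) l2
    have h1 : T ^ n = T ^ K * B * 0 ^ m := mul_right_cancel₀ hg0 h0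
    have hm : m = 0 := by
      by_contra hm
      rw [zero_pow hm, mul_zero] at h1
      exact pow_ne_zero n hT0 h1
    subst hm
    refine ⟨rfl, n - K, ?_⟩
    rw [pow_zero, mul_one] at h1
    rw [zpow_sub₀ hT0, zpow_natCast, zpow_natCast, h1, mul_div_cancel_left₀ _ (pow_ne_zero K hT0)]

/-- Zeros of theta functions: if `f(Tw) = A w^{-N} f(w)` has `P` zeros that are distinct modulo
`T^ℤ`, then `f = 0` if `P > N`; if `P = N` the product of the zeros is determined up to `T^ℤ`. -/
theorem eq_zero_or_of_zeros (hT : ‖T‖ < 1) (hT0 : T ≠ 0) (s : List ℂ) :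
    ∀ {f : ℂ → ℂ} {A : ℂ} {N : ℤ}, (∀ w ≠ 0, DifferentiableAt ℂ f w) →
    (∀ w ≠ 0, f (T * w) = A * w ^ (-N) * f w) → N ≤ s.length → (∀ x ∈ s, x ≠ 0 ∧ f x = 0) →
    s.Pairwise (fun x y => ∀ k : ℤ, y ≠ T ^ k * x) →
    (∀ w ≠ 0, f w = 0) ∨ N = s.length ∧ ∃ k : ℤ, A * (-1) ^ s.length = T ^ k * s.prod := by
  induction s with
  | nil =>
    intro f A N hd hq hN _ _
    obtain ⟨m, hm⟩ := Int.eq_ofNat_of_zero_le (show 0 ≤ -N by simpa using hN)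
    rw [hm] at hq
    rcases eq_zero_or_of_quasiperiodic hT hT0 hd hq with h | ⟨h1, h2⟩
    · exact Or.inl h
    · right
      refine ⟨by simp; omega, by simpa using h2⟩
  | cons x s ih =>
    intro f A N hd hq hN hz hp
    rw [List.pairwise_cons] at hp
    obtain ⟨hx0, hfx⟩ := hz x List.mem_cons_self
    have hzk : ∀ k : ℤ, f (T ^ k * x) = 0 := by
      have step : ∀ w ≠ 0, A ≠ 0 → (f w = 0 ↔ f (T * w) = 0) := by
        intro w hw hA
        rw [hq w hw]
        simp [hA, zpow_ne_zero _ hw]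
      by_cases hA : A = 0
      · intro k
        have : T ^ k * x = T * (T ^ (k - 1) * x) := by
          rw [← mul_assoc, mul_comm T, ← zpow_add_one₀ hT0, sub_add_cancel]
        rw [this, hq _ (mul_ne_zero (zpow_ne_zero _ hT0) hx0), hA]
        simp
      intro k
      induction k using Int.induction_on with
      | zero => simpa using hfx
      | succ n ih =>
        have := (step _ (mul_ne_zero (zpow_ne_zero n hT0) hx0) hA).1 ih
        rwa [← mul_assoc, mul_comm T, ← zpow_add_one₀ hT0] at this
      | pred n ih =>
        refine (step _ (mul_ne_zero (zpow_ne_zero _ hT0) hx0) hA).2 ?_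
        rw [← mul_assoc, mul_comm T, ← zpow_add_one₀ hT0]
        simpa using ih
    obtain ⟨h, hhd, hh⟩ := exists_eq_thetaProd_mul hT hT0 (f := fun w => f (w * x))
      (fun w hw => (hd _ (mul_ne_zero hw hx0)).comp w (by fun_prop)) hzk
    have hfh : ∀ w ≠ 0, f w = thetaProd T (w / x) * h (w / x) := by
      intro w hw
      have := hh (w / x) (div_ne_zero hw hx0)
      simpa [div_mul_cancel₀ _ hx0] using this
    -- the quotient satisfies a functional equation with `N - 1` in place of `N`
    let h' : ℂ → ℂ := fun w => h (w / x)
    have hd' : ∀ w ≠ 0, DifferentiableAt ℂ h' w := fun w hw =>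
      (hhd _ (div_ne_zero hw hx0)).comp w (by fun_prop)
    have hq' : ∀ w ≠ 0, h' (T * w) = (-A / x) * w ^ (-(N - 1)) * h' w := by
      have off : ∀ w ≠ 0, thetaProd T (w / x) ≠ 0 →
          h' (T * w) = (-A / x) * w ^ (-(N - 1)) * h' w := by
        intro w hw hne
        have h1 := hq w hw
        rw [hfh _ (mul_ne_zero hT0 hw), hfh w hw] at h1
        have h2 := thetaProd_mul hT hT0 (div_ne_zero hw hx0)
        rw [← mul_div_assoc] at h2
        have h3 : w ^ (-(N - 1)) = w ^ (-N) * w := by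
          rw [← zpow_add_one₀ hw]; congr 1; ring
        apply mul_left_cancel₀ hne
        rw [h3]
        have h4 : thetaProd T (w / x) * h' (T * w) =
            -(w / x) * (thetaProd T (T * w / x) * h (T * w / x)) := by
          simp only [h']
          linear_combination h (T * w / x) * h2
        rw [h4, h1]
        simp only [h']
        ring
      -- the zeros of the theta function are isolated
      intro w hw
      have hcl : ∀ᶠ z in 𝓝[≠] w, thetaProd T (z / x) ≠ 0 := by
        have hana : AnalyticOnNhd ℂ (fun z => thetaProd T (z / x)) {0}ᶜ := by
          refine DifferentiableOn.analyticOnNhd (fun y hy => ?_) isOpen_compl_singleton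
          exact (DifferentiableAt.comp y (g := thetaProd T) (f := fun z => z / x)
            (differentiableAt_thetaProd hT (div_ne_zero hy hx0))
            (by fun_prop)).differentiableWithinAt
        refine (hana w hw).eventually_eq_zero_or_eventually_ne_zero.resolve_left fun h0 => ?_
        have hU : IsPreconnected ({0}ᶜ : Set ℂ) :=
          (isConnected_compl_singleton_of_one_lt_rank (by simp) 0).isPreconnected
        have h1 := hana.eqOn_zero_of_preconnected_of_eventuallyEq_zero hU hw h0
        refine deriv_thetaProd_one hT ?_
        have : thetaProd T =ᶠ[𝓝 1] fun _ => 0 := by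
          filter_upwards [isOpen_ne.mem_nhds (one_ne_zero : (1 : ℂ) ≠ 0)] with z hz
          have := h1 (mul_ne_zero hz hx0 : z * x ∈ ({0}ᶜ : Set ℂ))
          simpa [mul_div_cancel_right₀ _ hx0] using this
        rw [this.deriv_eq]; simp
      have hne0 : ∀ᶠ z in 𝓝[≠] w, z ≠ 0 :=
        (isOpen_ne.mem_nhds hw : {z : ℂ | z ≠ 0} ∈ 𝓝 w) |> fun h => mem_nhdsWithin_of_mem_nhds h
      have l1 : ContinuousAt (fun z => h' (T * z)) w :=
        ((hd' _ (mul_ne_zero hT0 hw)).comp w (by fun_prop)).continuousAt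
      have l2 : ContinuousAt (fun z => (-A / x) * z ^ (-(N - 1)) * h' z) w :=
        (continuousAt_const.mul (continuousAt_zpow₀ _ _ (Or.inl hw))).mul (hd' w hw).continuousAt
      refine tendsto_nhds_unique (l1.tendsto.mono_left nhdsWithin_le_nhds)
        ((l2.tendsto.mono_left nhdsWithin_le_nhds).congr' ?_) (l := 𝓝[≠] w)
      filter_upwards [hcl, hne0] with z hz hz0 using (off z hz0 hz).symm
    have hz' : ∀ y ∈ s, y ≠ 0 ∧ h' y = 0 := by
      intro y hy
      obtain ⟨hy0, hfy⟩ := hz y (List.mem_cons_of_mem _ hy)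
      refine ⟨hy0, ?_⟩
      rw [hfh y hy0] at hfy
      refine (mul_eq_zero.1 hfy).resolve_left (thetaProd_ne_zero hT (div_ne_zero hy0 hx0) ?_)
      intro k hk
      exact hp.1 y hy k ((div_eq_iff hx0).1 hk)
    rcases ih hd' hq' (by simp at hN; omega) hz' hp.2 with h0 | ⟨h1, k, hk⟩
    · left
      intro w hw
      have := h0 w hw
      rw [hfh w hw]
      simp only [h'] at this
      rw [this, mul_zero]
    · right
      refine ⟨by simp; omega, k, ?_⟩
      rw [List.length_cons, pow_succ, List.prod_cons]
      have : -A / x * (-1) ^ s.length * x = T ^ k * s.prod * x := by rw [hk]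
      rw [mul_right_comm, div_mul_cancel₀ _ hx0] at this
      linear_combination this

end

/-! ### Gaussian sums with quasi-periodic coefficients -/

lemma bounded_of_quasiperiodic {D : ℤ → ℂ} {N : ℤ} (hN : 0 < N) {η : ℂ} (hη : ‖η‖ = 1)
    (hD : ∀ j, D (j + N) = η * D j) : ∃ C : ℝ, 0 ≤ C ∧ ∀ j, ‖D j‖ ≤ C := by
  obtain ⟨C, hC0, hC⟩ := periodic_bounded (u := fun j => (‖D j‖ : ℂ)) hN
    (fun j => by simp [hD, hη])
  exact ⟨C, hC0, fun j => by simpa using hC j⟩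

lemma summable_exp_quadratic {b : ℝ} (hb : 0 < b) (r : ℝ) :
    Summable fun j : ℤ => Real.exp (-b * j ^ 2 + r * j) := by
  refine ((summable_gauss hb one_ne_zero (-r / (2 * b))).mul_left
    (Real.exp (r ^ 2 / (4 * b)))).congr fun j => ?_
  rw [← Real.exp_add]
  congr 1
  field_simp
  ring

/-- The Laurent series `∑ D_j exp(-B j²) w^j`. -/
def gaussLaurent (B : ℂ) (D : ℤ → ℂ) (w : ℂ) : ℂ :=
  ∑' j : ℤ, D j * Complex.exp (-B * (j : ℂ) ^ 2) * w ^ j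

section

variable {B : ℂ} {D : ℤ → ℂ} {C : ℝ}

lemma norm_gaussLaurent_term_le (hC : ∀ j, ‖D j‖ ≤ C) {r : ℝ} {w : ℂ} (hw : w ≠ 0)
    (h1 : Real.log ‖w‖ ≤ r) (h2 : -r ≤ Real.log ‖w‖) (j : ℤ) :
    ‖D j * Complex.exp (-B * (j : ℂ) ^ 2) * w ^ j‖ ≤
      C * (Real.exp (-B.re * j ^ 2 + r * j) + Real.exp (-B.re * j ^ 2 + (-r) * j)) := by
  have hw' : 0 < ‖w‖ := norm_pos_iff.2 hw
  have e1 : ‖w ^ j‖ = Real.exp (Real.log ‖w‖ * j) := by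
    rw [norm_zpow, ← Real.rpow_intCast, Real.rpow_def_of_pos hw']
  have e2 : ‖Complex.exp (-B * (j : ℂ) ^ 2)‖ = Real.exp (-B.re * j ^ 2) := by
    have := norm_gauss B (j : ℝ)
    simpa using this
  rw [norm_mul, norm_mul, e1, e2, mul_assoc, ← Real.exp_add]
  refine mul_le_mul (hC j) ?_ (Real.exp_pos _).le ((norm_nonneg _).trans (hC j))
  rcases le_total 0 (j : ℝ) with hj | hj
  · have : Real.exp (-B.re * j ^ 2 + Real.log ‖w‖ * j) ≤ Real.exp (-B.re * j ^ 2 + r * j) := by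
      gcongr
    linarith [Real.exp_pos (-B.re * j ^ 2 + (-r) * j)]
  · have : Real.exp (-B.re * j ^ 2 + Real.log ‖w‖ * j) ≤ Real.exp (-B.re * j ^ 2 + (-r) * j) := by
      refine Real.exp_le_exp.2 (add_le_add le_rfl (mul_le_mul_of_nonpos_right h2 hj))
    linarith [Real.exp_pos (-B.re * j ^ 2 + r * j)]

lemma summable_gaussLaurent_bound (hB : 0 < B.re) (C r : ℝ) : Summable fun j : ℤ =>
    C * (Real.exp (-B.re * j ^ 2 + r * j) + Real.exp (-B.re * j ^ 2 + (-r) * j)) :=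
  ((summable_exp_quadratic hB r).add (summable_exp_quadratic hB (-r))).mul_left C

lemma differentiableAt_gaussLaurent (hB : 0 < B.re) (hC : ∀ j, ‖D j‖ ≤ C) {w : ℂ} (hw : w ≠ 0) :
    DifferentiableAt ℂ (gaussLaurent B D) w := by
  have hw' : 0 < ‖w‖ := norm_pos_iff.2 hw
  let r := |Real.log ‖w‖| + 1
  let U : Set ℂ := {z | Real.exp (-r) < ‖z‖ ∧ ‖z‖ < Real.exp r}
  have hU : IsOpen U := (isOpen_lt continuous_const continuous_norm).inter
    (isOpen_lt continuous_norm continuous_const)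
  have hwU : w ∈ U := by
    constructor
    · rw [← Real.lt_log_iff_exp_lt hw']
      have := neg_abs_le (Real.log ‖w‖)
      simp only [r]; linarith
    · rw [← Real.log_lt_iff_lt_exp hw']
      have := le_abs_self (Real.log ‖w‖)
      simp only [r]; linarith
  have hz0 : ∀ z ∈ U, z ≠ 0 := fun z hz => norm_pos_iff.1 ((Real.exp_pos _).trans hz.1)
  have := Complex.differentiableOn_tsum_of_summable_norm (summable_gaussLaurent_bound hB C r)
    (F := fun (j : ℤ) z => D j * Complex.exp (-B * (j : ℂ) ^ 2) * z ^ j) (U := U)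
    (fun j z hz =>
      ((differentiableAt_zpow.2 (Or.inl (hz0 z hz))).const_mul _).differentiableWithinAt)
    hU (fun j z hz => by
      have hzp : 0 < ‖z‖ := norm_pos_iff.2 (hz0 z hz)
      refine norm_gaussLaurent_term_le hC (hz0 z hz) ?_ ?_ j
      · exact ((Real.log_lt_iff_lt_exp hzp).2 hz.2).le
      · exact ((Real.lt_log_iff_exp_lt hzp).2 hz.1).le)
  exact this.differentiableAt (hU.mem_nhds hwU)

lemma gaussLaurent_exp (B : ℂ) (D : ℤ → ℂ) (x : ℂ) :
    ∑' j : ℤ, D j * Complex.exp (-B * ((j : ℂ) + x) ^ 2) =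
      Complex.exp (-B * x ^ 2) * gaussLaurent B D (Complex.exp (-2 * B * x)) := by
  rw [gaussLaurent, ← tsum_mul_left]
  refine tsum_congr fun j => ?_
  rw [← Complex.exp_int_mul, mul_assoc, mul_left_comm, ← Complex.exp_add, ← Complex.exp_add]
  congr 2
  ring

lemma gaussLaurent_mul {N : ℕ} {η : ℂ} (hη : η ≠ 0) (hD : ∀ j, D (j + N) = η * D j) {w : ℂ}
    (hw : w ≠ 0) : gaussLaurent B D (Complex.exp (-2 * B * N) * w) =
      η⁻¹ * Complex.exp (B * N ^ 2) * w ^ (-(N : ℤ)) * gaussLaurent B D w := by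
  rw [gaussLaurent, gaussLaurent, ← tsum_mul_left, ← (Equiv.subRight (N : ℤ)).tsum_eq]
  refine tsum_congr fun j => ?_
  have h1 : D (j - N) = η⁻¹ * D j := by
    have := hD (j - N)
    rw [sub_add_cancel] at this
    rw [this, inv_mul_cancel_left₀ hη]
  simp only [Equiv.subRight_apply]
  have e2 : w ^ (j - (N : ℤ)) = w ^ (-(N : ℤ)) * w ^ j := by
    rw [← zpow_add₀ hw]; congr 1; ring
  have e3 : Complex.exp (-B * ((j - (N : ℤ) : ℤ) : ℂ) ^ 2) *
      Complex.exp (-2 * B * N) ^ (j - (N : ℤ)) =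
      Complex.exp (B * N ^ 2) * Complex.exp (-B * (j : ℂ) ^ 2) := by
    rw [← Complex.exp_int_mul, ← Complex.exp_add, ← Complex.exp_add]
    congr 1
    push_cast
    ring
  rw [h1, mul_zpow, e2]
  linear_combination (η⁻¹ * D j * (w ^ (-(N : ℤ)) * w ^ j)) * e3

/-- The coefficients are recovered by integration over the unit circle. -/
lemma eq_zero_of_gaussLaurent_eq_zero (hB : 0 < B.re) (hC : ∀ j, ‖D j‖ ≤ C)
    (h : ∀ w ≠ 0, gaussLaurent B D w = 0) (k : ℤ) : D k = 0 := by
  let a : ℤ → ℂ := fun j => D j * Complex.exp (-B * (j : ℂ) ^ 2)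
  let F : ℤ → C(ℝ, ℂ) := fun j => ⟨fun t => a j * Complex.exp (((j - k : ℤ) : ℂ) * Complex.I * t),
    by fun_prop⟩
  have hab : ∀ j, ‖a j‖ ≤ C * (Real.exp (-B.re * j ^ 2 + 0 * j) +
      Real.exp (-B.re * j ^ 2 + (-0) * j)) := by
    intro j
    simpa [a] using norm_gaussLaurent_term_le (B := B) hC (w := 1) (r := 0) one_ne_zero
      (by simp) (by simp) j
  have ha : Summable fun j => ‖a j‖ :=
    Summable.of_nonneg_of_le (fun _ => norm_nonneg _) hab (summable_gaussLaurent_bound hB C 0)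
  have hFn : ∀ j t, ‖F j t‖ = ‖a j‖ := by
    intro j t
    have : ((j - k : ℤ) : ℂ) * Complex.I * t = (((j - k : ℤ) * t : ℝ) : ℂ) * Complex.I := by
      push_cast; ring
    change ‖a j * Complex.exp _‖ = _
    rw [norm_mul, this, Complex.norm_exp_ofReal_mul_I, mul_one]
  have hsum := intervalIntegral.hasSum_intervalIntegral_of_summable_norm (a := 0)
    (b := 2 * Real.pi) (f := F)
    (Summable.of_nonneg_of_le (fun _ => norm_nonneg _)
      (fun j => (ContinuousMap.norm_le _ (norm_nonneg (a j))).2 fun t => by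
        simpa using (hFn j t).le) ha)
  have h0 : ∀ t : ℝ, ∑' j, F j t = 0 := by
    intro t
    have h1 := h (Complex.exp (Complex.I * t)) (Complex.exp_ne_zero _)
    have h2 : ∑' j, F j t = Complex.exp (-(k * Complex.I * t)) *
        gaussLaurent B D (Complex.exp (Complex.I * t)) := by
      rw [gaussLaurent, ← tsum_mul_left]
      refine tsum_congr fun j => ?_
      change a j * Complex.exp _ = _
      rw [← Complex.exp_int_mul, mul_left_comm, ← Complex.exp_add]
      congr 2
      push_cast
      ring
    rw [h2, h1, mul_zero]
  have hint : ∀ j, ∫ t in (0 : ℝ)..2 * Real.pi, F j t = if j = k then 2 * Real.pi * a k else 0 := by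
    intro j
    change ∫ t in (0 : ℝ)..2 * Real.pi, a j * Complex.exp (((j - k : ℤ) : ℂ) * Complex.I * t) = _
    rw [intervalIntegral.integral_const_mul]
    split_ifs with hjk
    · subst hjk
      simp
      ring
    · have hne : ((j - k : ℤ) : ℂ) * Complex.I ≠ 0 :=
        mul_ne_zero (by exact_mod_cast sub_ne_zero.2 hjk) Complex.I_ne_zero
      rw [integral_exp_mul_complex hne]
      have : ((j - k : ℤ) : ℂ) * Complex.I * ((2 * Real.pi : ℝ) : ℂ) =
          ((j - k : ℤ) : ℂ) * (2 * Real.pi * Complex.I) := by push_cast; ring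
      rw [this, Complex.exp_int_mul_two_pi_mul_I]
      simp
  simp only [hint, h0, intervalIntegral.integral_zero] at hsum
  have h3 := hsum.unique (hasSum_ite_eq k (2 * Real.pi * a k : ℂ))
  have h4 : a k = 0 := by
    have hpi : (2 * Real.pi : ℂ) ≠ 0 := by exact_mod_cast Real.two_pi_pos.ne'
    exact (mul_eq_zero.1 h3.symm).resolve_left hpi
  exact (mul_eq_zero.1 h4).resolve_right (Complex.exp_ne_zero _)

/-- The number of real zeros modulo `N` of `x ↦ ∑ D_j exp(-B(j + x)²)`, where `D` is
`N`-periodic up to a factor: there are at most `N` of them unless `D = 0`, and fewer than `N` if `N`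
is odd and the factor is `1`. -/
theorem eq_zero_of_gaussSum_zeros (hB : 0 < B.re) {N : ℕ} (hN : 0 < N) {η : ℂ} (hη : ‖η‖ = 1)
    (hD : ∀ j, D (j + N) = η * D j) (xs : List ℝ)
    (hxs : xs.Pairwise fun x y => ∀ k : ℤ, y ≠ x + (N : ℝ) * k)
    (h0 : ∀ x ∈ xs, ∑' j : ℤ, D j * Complex.exp (-B * ((j : ℂ) + x) ^ 2) = 0)
    (hlen : N < xs.length ∨ N = xs.length ∧ Odd N ∧ η = 1) (j : ℤ) : D j = 0 := by
  have hη0 : η ≠ 0 := norm_ne_zero_iff.1 (by rw [hη]; exact one_ne_zero)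
  obtain ⟨C, -, hC⟩ := bounded_of_quasiperiodic (by exact_mod_cast hN) hη hD
  have hNr : (0 : ℝ) < N := by exact_mod_cast hN
  let T := Complex.exp (-2 * B * N)
  have hnorm : ∀ x : ℝ, ‖Complex.exp (-2 * B * x)‖ = Real.exp (-2 * B.re * x) := by
    intro x
    rw [Complex.norm_exp]
    simp
  have hT : ‖T‖ < 1 := by
    have := hnorm N
    simp only [Complex.ofReal_natCast] at this
    simp only [T]
    rw [this, Real.exp_lt_one_iff]
    have := mul_pos hB hNr
    linarith
  have key := eq_zero_or_of_zeros hT (Complex.exp_ne_zero _)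
    (xs.map fun x : ℝ => Complex.exp (-2 * B * x)) (f := gaussLaurent B D)
    (A := η⁻¹ * Complex.exp (B * N ^ 2)) (N := N)
    (fun w hw => differentiableAt_gaussLaurent hB hC hw)
    (fun w hw => gaussLaurent_mul hη0 hD hw)
    (by rw [List.length_map]; rcases hlen with h | h <;> omega)
    (by
      intro w hw
      obtain ⟨x, hx, rfl⟩ := List.mem_map.1 hw
      refine ⟨Complex.exp_ne_zero _, ?_⟩
      have := h0 x hx
      rw [gaussLaurent_exp] at this
      exact (mul_eq_zero.1 this).resolve_left (Complex.exp_ne_zero _))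
    (by
      rw [List.pairwise_map]
      refine hxs.imp fun {x y} hxy k hk => hxy k ?_
      have e : T ^ k * Complex.exp (-2 * B * x) = Complex.exp (-2 * B * ((x + N * k : ℝ) : ℂ)) := by
        rw [← Complex.exp_int_mul, ← Complex.exp_add]
        congr 1
        push_cast
        ring
      have h1 := congrArg norm hk
      rw [e, hnorm, hnorm, Real.exp_eq_exp] at h1
      have h3 : -2 * B.re ≠ 0 := by linarith
      exact mul_left_cancel₀ h3 h1)
  refine eq_zero_of_gaussLaurent_eq_zero hB hC ?_ j
  refine key.resolve_right ?_
  -- if there are exactly `N` zeros, the absolute values of the two sides of `hk` determine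
  -- `k * N + ∑ x`, and then the two sides differ by the factor `(-1) ^ N = -1`
  rintro ⟨hNl, k, hk⟩
  rw [List.length_map] at hNl hk
  obtain ⟨h1, hodd, rfl⟩ := hlen.resolve_left (by omega)
  have hprod : ∀ l : List ℝ, (l.map fun x : ℝ => Complex.exp (-2 * B * x)).prod =
      Complex.exp (-2 * B * l.sum) := by
    intro l
    induction l with
    | nil => simp
    | cons x l ih =>
      rw [List.map_cons, List.prod_cons, ih, ← Complex.exp_add, List.sum_cons]
      push_cast
      ring_nf
  rw [← h1, hodd.neg_one_pow, hprod, ← Complex.exp_int_mul, ← Complex.exp_add] at hk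
  have h5 : ‖Complex.exp (B * N ^ 2)‖ = Real.exp (B.re * N ^ 2) := by
    rw [Complex.norm_exp]
    congr 1
    rw [show (N : ℂ) ^ 2 = ((N ^ 2 : ℝ) : ℂ) by push_cast; rfl, Complex.re_mul_ofReal]
  have h6 : (k : ℂ) * (-2 * B * N) + -2 * B * xs.sum = -2 * B * ((k * N + xs.sum : ℝ) : ℂ) := by
    push_cast; ring
  rw [h6] at hk
  have h7 := congrArg norm hk
  rw [hnorm, inv_one, one_mul, norm_mul, h5, norm_neg, norm_one, mul_one, Real.exp_eq_exp] at h7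
  have h8 : ((k * N + xs.sum : ℝ)) = -(N ^ 2 : ℝ) / 2 := by
    apply mul_left_cancel₀ hB.ne'
    linarith
  rw [h8] at hk
  have h9 : -2 * B * ((-(N ^ 2 : ℝ) / 2 : ℝ) : ℂ) = B * N ^ 2 := by push_cast; ring
  rw [h9, inv_one, one_mul, mul_neg_one] at hk
  exact Complex.exp_ne_zero (B * N ^ 2) (self_eq_neg.1 hk.symm)

/-- A version of `eq_zero_of_gaussSum_zeros` for the zeros in an arithmetic progression. -/
theorem eq_zero_of_gaussSum_progression (hB : 0 < B.re) {N P : ℕ} (hN : 0 < N) (hNP : N < P)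
    {η : ℂ} (hη : ‖η‖ = 1) (hD : ∀ j, D (j + N) = η * D j) (r : ℝ)
    (h0 : ∀ n : ℤ, ∑' j : ℤ, D j * Complex.exp (-B * ((j : ℂ) + ((N / P * n + r : ℝ) : ℂ)) ^ 2) = 0)
    (j : ℤ) : D j = 0 := by
  have hNr : (0 : ℝ) < N := by exact_mod_cast hN
  have hPr : (0 : ℝ) < P := by exact_mod_cast hN.trans hNP
  refine eq_zero_of_gaussSum_zeros hB hN hη hD
    ((List.range P).map fun n : ℕ => (N / P * n + r : ℝ)) ?_ ?_ (Or.inl (by simpa using hNP)) j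
  · rw [List.pairwise_map]
    refine List.pairwise_lt_range.imp_of_mem fun {m n} hm hn hmn k hk => ?_
    rw [List.mem_range] at hm hn
    have h1 : (n : ℝ) - m = P * k := by
      field_simp at hk
      apply mul_left_cancel₀ hNr.ne'
      linear_combination hk
    have h2 : (n : ℤ) - m = P * k := by exact_mod_cast h1
    have h3 : 0 < (P : ℤ) * k := by omega
    have h4 : 0 < k := pos_of_mul_pos_right h3 (by omega)
    nlinarith
  · intro x hx
    obtain ⟨n, -, rfl⟩ := List.mem_map.1 hx
    simpa using h0 n

end

/-! ### Quasi-periodic sequences and twisted products -/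

/-- The sequences with `u(k + c) = η u(k)`. -/
def quasiPeriodic (c : ℤ) (η : ℂ) : Submodule ℂ (ℤ → ℂ) where
  carrier := {u | ∀ k, u (k + c) = η * u k}
  zero_mem' := fun k => by simp
  add_mem' := fun hu hv k => by simp only [Pi.add_apply, hu k, hv k, mul_add]
  smul_mem' := fun z u hu k => by simp only [Pi.smul_apply, smul_eq_mul, hu k]; ring

lemma quasiPeriodic_mul_int {c : ℤ} {η : ℂ} (hη : η ≠ 0) {u : ℤ → ℂ} (hu : u ∈ quasiPeriodic c η)
    (k n : ℤ) : u (k + c * n) = η ^ n * u k := by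
  induction n using Int.induction_on with
  | zero => simp
  | succ n ih =>
    rw [mul_add, mul_one, ← add_assoc, hu, ih, zpow_add_one₀ hη]
    ring
  | pred n ih =>
    have h := hu (k + c * (-(n : ℤ) - 1))
    rw [show k + c * (-(n : ℤ) - 1) + c = k + c * -(n : ℤ) by ring, ih] at h
    rw [zpow_sub_one₀ hη, mul_right_comm, h, mul_comm η, mul_inv_cancel_right₀ hη]

/-- A quasi-periodic sequence is determined by its values on a period, which are arbitrary. -/
def quasiPeriodicEquiv (n : ℕ) [NeZero n] {η : ℂ} (hη : η ≠ 0) :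
    quasiPeriodic n η ≃ₗ[ℂ] (Fin n → ℂ) where
  toFun u i := u.1 (i : ℕ)
  map_add' _ _ := rfl
  map_smul' _ _ := rfl
  invFun f := ⟨fun k => η ^ (k / n) * f ⟨(k % n).toNat, by
      have h : (0 : ℤ) < n := by exact_mod_cast NeZero.pos n
      have := Int.emod_nonneg k h.ne'
      have := Int.emod_lt_of_pos k h
      omega⟩, fun k => by
    have h : (n : ℤ) ≠ 0 := by exact_mod_cast NeZero.ne n
    simp only [Int.add_emod_right, Int.add_ediv_of_dvd_right (dvd_refl (n : ℤ)), Int.ediv_self h,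
      zpow_add_one₀ hη]
    ring⟩
  left_inv u := by
    have h : (0 : ℤ) < n := by exact_mod_cast NeZero.pos n
    ext k
    simp only [Int.toNat_of_nonneg (Int.emod_nonneg k h.ne')]
    rw [← quasiPeriodic_mul_int hη u.2, Int.emod_add_mul_ediv]
  right_inv f := by
    have h : (0 : ℤ) < n := by exact_mod_cast NeZero.pos n
    funext i
    have h1 : ((i : ℕ) : ℤ) < n := by exact_mod_cast i.2
    simp only [Int.ediv_eq_zero_of_lt (Int.natCast_nonneg _) h1, zpow_zero, one_mul,
      Int.emod_eq_of_lt (Int.natCast_nonneg _) h1, Int.toNat_natCast]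

lemma quasiPeriodic_bounded {c : ℤ} (hc : 0 < c) {η : ℂ} (hη : ‖η‖ = 1) {u : ℤ → ℂ}
    (hu : u ∈ quasiPeriodic c η) : ∃ C : ℝ, 0 ≤ C ∧ ∀ k, ‖u k‖ ≤ C :=
  bounded_of_quasiperiodic hc hη hu

/-- The Gaussian factor of a product of sections, with its argument translated by `δ`. -/
def twTerm (g₁ g₂ : SL2Z) (τ : ℂ) (δ : ℝ) (γ k : ℤ) : ℂ :=
  Complex.exp (-(Real.pi * Complex.I * τ / (g₁ 1 0 * g₂ 1 0 * (g₁ * g₂) 1 0)) *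
    (((g₁ * g₂) 1 0 : ℂ) * k - g₁ 1 0 * γ + δ) ^ 2)

/-- The product of sections, in terms of their coefficients, when the holomorphic structures are
translated; `coeffMul` is the case `δ = 0`. -/
def twMul (g₁ g₂ : SL2Z) (τ : ℂ) (δ : ℝ) (u v : ℤ → ℂ) : ℤ → ℂ := fun γ =>
  ∑' k : ℤ, u k * v (γ - g₂ 0 0 * k) * twTerm g₁ g₂ τ δ γ k

lemma twMul_zero (g₁ g₂ : SL2Z) (τ : ℂ) : twMul g₁ g₂ τ 0 = coeffMul g₁ g₂ τ := by
  funext u v γ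
  simp [twMul, coeffMul, twTerm, mulTerm]

lemma norm_twTerm (g₁ g₂ : SL2Z) (τ : ℂ) (δ : ℝ) (γ k : ℤ) :
    ‖twTerm g₁ g₂ τ δ γ k‖ =
      Real.exp (-mulRate g₁ g₂ τ * (((g₁ * g₂) 1 0 : ℝ) * k - g₁ 1 0 * γ + δ) ^ 2) := by
  rw [twTerm, Complex.norm_exp]
  congr 1
  have h : -(Real.pi * Complex.I * τ / (g₁ 1 0 * g₂ 1 0 * (g₁ * g₂) 1 0)) *
      (((g₁ * g₂) 1 0 : ℂ) * k - g₁ 1 0 * γ + δ) ^ 2 =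
      ((-Real.pi / (g₁ 1 0 * g₂ 1 0 * (g₁ * g₂) 1 0) *
        (((g₁ * g₂) 1 0 : ℝ) * k - g₁ 1 0 * γ + δ) ^ 2 : ℝ) : ℂ) * (Complex.I * τ) := by
    push_cast; ring
  rw [h, Complex.re_ofReal_mul, Complex.I_mul_re, mulRate]
  ring

lemma summable_twMul {g₁ g₂ : SL2Z} {τ : ℂ} (h₁ : 0 < g₁ 1 0) (h₂ : 0 < g₂ 1 0)
    (h₁₂ : 0 < (g₁ * g₂) 1 0) (hτ : τ.im < 0) {u v : ℤ → ℂ} {C D : ℝ}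
    (hu : ∀ k, ‖u k‖ ≤ C) (hv : ∀ k, ‖v k‖ ≤ D) (δ : ℝ) (γ : ℤ) :
    Summable fun k : ℤ => u k * v (γ - g₂ 0 0 * k) * twTerm g₁ g₂ τ δ γ k := by
  have h3 : ((g₁ * g₂) 1 0 : ℝ) ≠ 0 := by exact_mod_cast h₁₂.ne'
  have hC := (norm_nonneg _).trans (hu 0)
  refine Summable.of_norm_bounded (g := fun k : ℤ => C * D *
    Real.exp (-mulRate g₁ g₂ τ * (((g₁ * g₂) 1 0 : ℝ) * k + (δ - g₁ 1 0 * γ : ℝ)) ^ 2))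
    ((summable_gauss (mulRate_pos h₁ h₂ h₁₂ hτ) h3 _).mul_left _) fun k => ?_
  rw [norm_mul, norm_mul, norm_twTerm,
    show (((g₁ * g₂) 1 0 : ℝ) * k - g₁ 1 0 * γ + δ) =
      ((g₁ * g₂) 1 0 : ℝ) * k + (δ - g₁ 1 0 * γ : ℝ) by ring]
  gcongr
  · exact hu k
  · exact hv _

lemma twMul_mem {g₁ g₂ : SL2Z} {τ : ℂ} {δ : ℝ} {u v : ℤ → ℂ} {η₁ η₂ : ℂ} (hη₂ : η₂ ≠ 0)
    (hu : u ∈ quasiPeriodic (g₁ 1 0) η₁) (hv : v ∈ quasiPeriodic (g₂ 1 0) η₂) :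
    twMul g₁ g₂ τ δ u v ∈ quasiPeriodic ((g₁ * g₂) 1 0) (η₁ * η₂ ^ (g₁ 1 1)) := by
  intro γ
  rw [twMul, twMul, ← (Equiv.addRight (g₁ 1 0)).tsum_eq, ← tsum_mul_left]
  refine tsum_congr fun k => ?_
  simp only [Equiv.coe_addRight]
  have h1 : γ + (g₁ * g₂) 1 0 - g₂ 0 0 * (k + g₁ 1 0) = γ - g₂ 0 0 * k + g₂ 1 0 * g₁ 1 1 := by
    rw [sl_mul10]; ring
  have h2 : twTerm g₁ g₂ τ δ (γ + (g₁ * g₂) 1 0) (k + g₁ 1 0) = twTerm g₁ g₂ τ δ γ k := by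
    rw [twTerm, twTerm]
    congr 2
    push_cast
    ring
  rw [hu, h1, quasiPeriodic_mul_int hη₂ hv, h2]
  ring

lemma twMul_add_left {g₁ g₂ : SL2Z} {τ : ℂ} (h₁ : 0 < g₁ 1 0) (h₂ : 0 < g₂ 1 0)
    (h₁₂ : 0 < (g₁ * g₂) 1 0) (hτ : τ.im < 0) {u u' v : ℤ → ℂ} {C C' D : ℝ}
    (hu : ∀ k, ‖u k‖ ≤ C) (hu' : ∀ k, ‖u' k‖ ≤ C') (hv : ∀ k, ‖v k‖ ≤ D) (δ : ℝ) :
    twMul g₁ g₂ τ δ (u + u') v = twMul g₁ g₂ τ δ u v + twMul g₁ g₂ τ δ u' v := by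
  funext γ
  rw [Pi.add_apply, twMul, twMul, twMul, ← (summable_twMul h₁ h₂ h₁₂ hτ hu hv δ γ).tsum_add
    (summable_twMul h₁ h₂ h₁₂ hτ hu' hv δ γ)]
  exact tsum_congr fun k => by rw [Pi.add_apply]; ring

lemma twMul_add_right {g₁ g₂ : SL2Z} {τ : ℂ} (h₁ : 0 < g₁ 1 0) (h₂ : 0 < g₂ 1 0)
    (h₁₂ : 0 < (g₁ * g₂) 1 0) (hτ : τ.im < 0) {u v v' : ℤ → ℂ} {C D D' : ℝ}
    (hu : ∀ k, ‖u k‖ ≤ C) (hv : ∀ k, ‖v k‖ ≤ D) (hv' : ∀ k, ‖v' k‖ ≤ D') (δ : ℝ) :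
    twMul g₁ g₂ τ δ u (v + v') = twMul g₁ g₂ τ δ u v + twMul g₁ g₂ τ δ u v' := by
  funext γ
  rw [Pi.add_apply, twMul, twMul, twMul, ← (summable_twMul h₁ h₂ h₁₂ hτ hu hv δ γ).tsum_add
    (summable_twMul h₁ h₂ h₁₂ hτ hu hv' δ γ)]
  exact tsum_congr fun k => by rw [Pi.add_apply]; ring

lemma twMul_smul_left (g₁ g₂ : SL2Z) (τ : ℂ) (δ : ℝ) (z : ℂ) (u v : ℤ → ℂ) :
    twMul g₁ g₂ τ δ (z • u) v = z • twMul g₁ g₂ τ δ u v := by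
  funext γ
  simp only [twMul, Pi.smul_apply, smul_eq_mul, mul_assoc]
  exact tsum_mul_left

lemma twMul_smul_right (g₁ g₂ : SL2Z) (τ : ℂ) (δ : ℝ) (z : ℂ) (u v : ℤ → ℂ) :
    twMul g₁ g₂ τ δ u (z • v) = z • twMul g₁ g₂ τ δ u v := by
  funext γ
  simp only [twMul, Pi.smul_apply, smul_eq_mul, mul_left_comm _ z, mul_assoc]
  exact tsum_mul_left

/-- A translated form of `summable_gauss₂`. -/
lemma summable_gauss₂_translate {b₁ b₂ : ℝ} (hb₁ : 0 < b₁) (hb₂ : 0 < b₂) {p c r : ℤ} (hp : 0 < p)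
    (hr : 0 < r) (s q : ℝ) :
    Summable fun x : ℤ × ℤ => Real.exp (-b₁ * ((p : ℝ) * x.2 - c * x.1 + s) ^ 2) *
      Real.exp (-b₂ * ((r : ℝ) * x.1 + q) ^ 2) := by
  refine Summable.of_nonneg_of_le (fun _ => by positivity) (fun x => ?_)
    ((summable_gauss₂ (half_pos hb₁) hb₂ (c := c) hp hr q).mul_left (Real.exp (b₁ * s ^ 2)))
  rw [← mul_assoc]
  refine mul_le_mul_of_nonneg_right ?_ (Real.exp_pos _).le
  rw [← Real.exp_add]
  refine Real.exp_le_exp.2 ?_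
  nlinarith [mul_nonneg hb₁.le (sq_nonneg ((p : ℝ) * x.2 - c * x.1 + 2 * s))]

/-- Associativity of twisted products: the summation indices of the two factors are translated by
`x` and `y` in the Gaussians, and the quasi-periodicity factor of the third sequence reappears in
the first one. -/
lemma twMul_assoc {g₁ g₂ g₃ : SL2Z} {τ : ℂ} (h₁ : 0 < g₁ 1 0) (h₂ : 0 < g₂ 1 0)
    (h₃ : 0 < g₃ 1 0) (h₁₂ : 0 < (g₁ * g₂) 1 0) (h₂₃ : 0 < (g₂ * g₃) 1 0)
    (h₁₂₃ : 0 < (g₁ * g₂ * g₃) 1 0) (hτ : τ.im < 0) {u v w : ℤ → ℂ} {C D : ℝ}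
    (hu : ∀ k, ‖u k‖ ≤ C) (hv : ∀ k, ‖v k‖ ≤ D) {η : ℂ} (hη : ‖η‖ = 1)
    (hw : w ∈ quasiPeriodic (g₃ 1 0) η) (x y : ℝ) :
    twMul (g₁ * g₂) g₃ τ ((g₁ * g₂ * g₃) 1 0 * y)
      (twMul g₁ g₂ τ ((g₁ * g₂) 1 0 * x - g₁ 1 0 * y) (fun k => u k * η ^ (-(g₂ 0 1 * k))) v) w =
    twMul g₁ (g₂ * g₃) τ ((g₁ * g₂ * g₃) 1 0 * x) u
      (twMul g₂ g₃ τ ((g₂ * g₃) 1 0 * y - g₃ 1 0 * x) v w) := by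
  funext ε
  have hη0 : η ≠ 0 := norm_ne_zero_iff.1 (by rw [hη]; exact one_ne_zero)
  let F : ℤ → ℤ → ℂ := fun l k => u k * η ^ (-(g₂ 0 1 * k)) * v (l - g₂ 0 0 * k) *
    twTerm g₁ g₂ τ ((g₁ * g₂) 1 0 * x - g₁ 1 0 * y) l k *
    w (ε - g₃ 0 0 * l) * twTerm (g₁ * g₂) g₃ τ ((g₁ * g₂ * g₃) 1 0 * y) ε l
  have hsum : Summable (Function.uncurry F) := by
    obtain ⟨E, hE0, hE⟩ := quasiPeriodic_bounded h₃ hη hw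
    have hC0 := (norm_nonneg _).trans (hu 0)
    have hD0 := (norm_nonneg _).trans (hv 0)
    refine Summable.of_norm_bounded
      ((summable_gauss₂_translate (mulRate_pos h₁ h₂ h₁₂ hτ) (mulRate_pos h₁₂ h₃ h₁₂₃ hτ) h₁₂ h₁₂₃
        (c := g₁ 1 0) ((g₁ * g₂) 1 0 * x - g₁ 1 0 * y)
        ((g₁ * g₂ * g₃) 1 0 * y - (g₁ * g₂) 1 0 * ε : ℝ)).mul_left (C * D * E)) ?_
    rintro ⟨l, k⟩
    simp only [Function.uncurry, F]
    rw [norm_mul, norm_mul, norm_mul, norm_mul, norm_mul, norm_zpow, hη, one_zpow, mul_one,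
      norm_twTerm, norm_twTerm]
    calc _ ≤ C * D * Real.exp (-mulRate g₁ g₂ τ *
          (((g₁ * g₂) 1 0 : ℝ) * k - g₁ 1 0 * l + ((g₁ * g₂) 1 0 * x - g₁ 1 0 * y)) ^ 2) * E *
          Real.exp (-mulRate (g₁ * g₂) g₃ τ *
            (((g₁ * g₂ * g₃) 1 0 : ℝ) * l - (g₁ * g₂) 1 0 * ε + (g₁ * g₂ * g₃) 1 0 * y) ^ 2) := by
          gcongr
          · exact hu k
          · exact hv _
          · exact hE _
      _ = _ := by
        rw [show ((g₁ * g₂ * g₃) 1 0 : ℝ) * l - (g₁ * g₂) 1 0 * ε + (g₁ * g₂ * g₃) 1 0 * y =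
          ((g₁ * g₂ * g₃) 1 0 : ℝ) * l + ((g₁ * g₂ * g₃) 1 0 * y - (g₁ * g₂) 1 0 * ε) by ring]
        ring
  have hL : twMul (g₁ * g₂) g₃ τ ((g₁ * g₂ * g₃) 1 0 * y)
      (twMul g₁ g₂ τ ((g₁ * g₂) 1 0 * x - g₁ 1 0 * y) (fun k => u k * η ^ (-(g₂ 0 1 * k))) v) w ε =
      ∑' l : ℤ, ∑' k : ℤ, F l k := by
    rw [twMul]
    refine tsum_congr fun l => ?_
    rw [twMul, ← tsum_mul_right, ← tsum_mul_right]
  have hR : twMul g₁ (g₂ * g₃) τ ((g₁ * g₂ * g₃) 1 0 * x) u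
      (twMul g₂ g₃ τ ((g₂ * g₃) 1 0 * y - g₃ 1 0 * x) v w) ε = ∑' k : ℤ, ∑' l : ℤ, F l k := by
    rw [twMul]
    refine tsum_congr fun k => ?_
    rw [twMul, ← tsum_mul_left, ← tsum_mul_right, ← (Equiv.subRight (g₂ 0 0 * k)).tsum_eq]
    refine tsum_congr fun l => ?_
    simp only [Equiv.subRight_apply, F]
    have hwarg : ε - (g₂ * g₃) 0 0 * k - g₃ 0 0 * (l - g₂ 0 0 * k) =
        ε - g₃ 0 0 * l + g₃ 1 0 * (-(g₂ 0 1 * k)) := by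
      rw [sl_mul00]; ring
    rw [hwarg, quasiPeriodic_mul_int hη0 hw]
    have n1 : (g₁ 1 0 : ℂ) ≠ 0 := by exact_mod_cast h₁.ne'
    have n2 : (g₂ 1 0 : ℂ) ≠ 0 := by exact_mod_cast h₂.ne'
    have n3 : (g₃ 1 0 : ℂ) ≠ 0 := by exact_mod_cast h₃.ne'
    have n12 : ((g₁ * g₂) 1 0 : ℂ) ≠ 0 := by exact_mod_cast h₁₂.ne'
    have n23 : ((g₂ * g₃) 1 0 : ℂ) ≠ 0 := by exact_mod_cast h₂₃.ne'
    have n123 : ((g₁ * g₂ * g₃) 1 0 : ℂ) ≠ 0 := by exact_mod_cast h₁₂₃.ne'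
    have d2 := sl_det g₂
    have r1 : (g₂ * g₃) 1 0 * g₂ 0 0 - g₂ 1 0 * (g₂ * g₃) 0 0 = g₃ 1 0 := by
      rw [sl_mul10, sl_mul00]; linear_combination g₃ 1 0 * d2
    have r2 : (g₁ * g₂) 1 0 * (g₂ * g₃) 1 0 - g₂ 1 0 * (g₁ * g₂ * g₃) 1 0 = g₁ 1 0 * g₃ 1 0 := by
      rw [mul_assoc g₁ g₂ g₃, sl_mul10 g₁ (g₂ * g₃), sl_mul10 g₁ g₂]
      linear_combination g₁ 1 0 * r1
    have r1' : ((g₂ * g₃) 1 0 : ℂ) * g₂ 0 0 - g₂ 1 0 * (g₂ * g₃) 0 0 = g₃ 1 0 := by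
      exact_mod_cast r1
    have r2' : ((g₁ * g₂) 1 0 : ℂ) * (g₂ * g₃) 1 0 - g₂ 1 0 * (g₁ * g₂ * g₃) 1 0 =
        g₁ 1 0 * g₃ 1 0 := by
      exact_mod_cast r2
    have hexp : twTerm g₁ (g₂ * g₃) τ ((g₁ * g₂ * g₃) 1 0 * x) ε k *
        twTerm g₂ g₃ τ ((g₂ * g₃) 1 0 * y - g₃ 1 0 * x) (ε - (g₂ * g₃) 0 0 * k) (l - g₂ 0 0 * k) =
        twTerm g₁ g₂ τ ((g₁ * g₂) 1 0 * x - g₁ 1 0 * y) l k *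
          twTerm (g₁ * g₂) g₃ τ ((g₁ * g₂ * g₃) 1 0 * y) ε l := by
      simp only [twTerm]
      rw [← Complex.exp_add, ← Complex.exp_add, ← mul_assoc g₁ g₂ g₃]
      congr 1
      push_cast
      have r3 : ((g₂ * g₃) 1 0 : ℂ) * (l - g₂ 0 0 * k) - g₂ 1 0 * (ε - (g₂ * g₃) 0 0 * k) +
          ((g₂ * g₃) 1 0 * y - g₃ 1 0 * x) =
          (g₂ * g₃) 1 0 * (l + y) - g₂ 1 0 * ε - g₃ 1 0 * (k + x) := by
        linear_combination -(k : ℂ) * r1'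
      rw [r3]
      generalize ((g₁ * g₂ * g₃) 1 0 : ℂ) = c₁₂₃ at *
      generalize ((g₁ * g₂) 1 0 : ℂ) = c₁₂ at *
      generalize ((g₂ * g₃) 1 0 : ℂ) = c₂₃ at *
      generalize (g₁ 1 0 : ℂ) = c₁ at *
      generalize (g₂ 1 0 : ℂ) = c₂ at *
      generalize (g₃ 1 0 : ℂ) = c₃ at *
      have e1 : c₁₂₃ * (k : ℂ) - c₁ * ε + c₁₂₃ * x = c₁₂₃ * (k + x) - c₁ * ε := by ring
      have e2 : c₁₂ * (k : ℂ) - c₁ * l + (c₁₂ * x - c₁ * y) = c₁₂ * (k + x) - c₁ * (l + y) := by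
        ring
      have e3 : c₁₂₃ * (l : ℂ) - c₁₂ * ε + c₁₂₃ * y = c₁₂₃ * (l + y) - c₁₂ * ε := by ring
      rw [e1, e2, e3]
      generalize (k : ℂ) + x = k at *
      generalize (l : ℂ) + y = l at *
      rw [← sub_eq_zero]
      have e3 : c₁₂ * c₂₃ - c₂ * c₁₂₃ - c₁ * c₃ = 0 := sub_eq_zero.2 r2'
      rw [← mul_zero (-(Real.pi * Complex.I * τ) * (-(k : ℂ) ^ 2 / (c₁ * c₂ * c₂₃) +
        (l : ℂ) ^ 2 / (c₂ * c₃ * c₁₂) - (ε : ℂ) ^ 2 / (c₃ * c₂₃ * c₁₂₃))), ← e3]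
      field_simp
      ring
    linear_combination (u k * η ^ (-(g₂ 0 1 * k)) * v (l - g₂ 0 0 * k) * w (ε - g₃ 0 0 * l)) * hexp
  rw [hL, hR]
  exact hsum.tsum_comm.symm

lemma tsum_progression {F : ℤ → ℂ} {c : ℤ} (hc : c ≠ 0) (k : ℤ)
    (hF : ∀ κ, ¬c ∣ κ - k → F κ = 0) : ∑' κ, F κ = ∑' n, F (k + c * n) := by
  refine (Function.Injective.tsum_eq (g := fun n => k + c * n) ?_ ?_).symm
  · intro m n h
    exact mul_left_cancel₀ hc (add_left_cancel h)
  · intro κ hκ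
    by_contra h
    refine hκ (hF κ fun ⟨n, hn⟩ => h ⟨n, ?_⟩)
    simp only
    omega

lemma tsum_int_eq_sum_fin {H : ℤ → ℂ} (hH : Summable H) (n : ℕ) [NeZero n] :
    ∑' γ, H γ = ∑ i : Fin n, ∑' m : ℤ, H ((i : ℕ) - n * m) := by
  rw [← (Int.divModEquiv n).symm.tsum_eq,
    Summable.tsum_prod' (f := fun x => H ((Int.divModEquiv n).symm x))
      ((Int.divModEquiv n).symm.summable_iff.2 hH) fun b => Summable.of_finite]
  simp only [tsum_fintype]
  rw [Summable.tsum_finsetSum]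
  · refine Finset.sum_congr rfl fun i _ => ?_
    rw [← (Equiv.neg ℤ).tsum_eq]
    refine tsum_congr fun m => ?_
    congr 1
    simp [Int.divModEquiv]
    ring
  · intro i _
    refine ((Int.divModEquiv n).symm.summable_iff.2 hH).comp_injective
      (i := fun m : ℤ => (m, i)) fun a b h => (Prod.ext_iff.1 h).1

/-- The sequence supported on `k + cℤ` with the value `1` at `k` and quasi-periodicity factor
`η`. -/
def twDelta (c : ℤ) (η : ℂ) (k : ℤ) : ℤ → ℂ := fun κ => if c ∣ κ - k then η ^ ((κ - k) / c) else 0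

lemma twDelta_mem {c : ℤ} (hc : c ≠ 0) {η : ℂ} (hη : η ≠ 0) (k : ℤ) :
    twDelta c η k ∈ quasiPeriodic c η := by
  intro κ
  have h : κ + c - k = κ - k + c := by ring
  simp only [twDelta, h, dvd_add_self_right]
  split_ifs with h1
  · rw [Int.add_ediv_of_dvd_right (dvd_refl c), Int.ediv_self hc, zpow_add_one₀ hη, mul_comm]
  · simp

lemma twDelta_add_mul {c : ℤ} (hc : c ≠ 0) (η : ℂ) (k n : ℤ) :
    twDelta c η k (k + c * n) = η ^ n := by
  simp [twDelta, hc]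

section

variable {g₁ g₂ : SL2Z} {τ : ℂ}

lemma re_gauss_coeff_pos {c₁ c₂ c₃ : ℤ} (h₁ : 0 < c₁) (h₂ : 0 < c₂) (h₃ : 0 < c₃)
    (hτ : τ.im < 0) : 0 < (Real.pi * Complex.I * τ * c₁ * c₂ / c₃ : ℂ).re := by
  have h1 : (0 : ℝ) < c₁ := by exact_mod_cast h₁
  have h2 : (0 : ℝ) < c₂ := by exact_mod_cast h₂
  have h3 : (0 : ℝ) < c₃ := by exact_mod_cast h₃
  have h : (Real.pi * Complex.I * τ * c₁ * c₂ / c₃ : ℂ) =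
      ((Real.pi * c₁ * c₂ / c₃ : ℝ) : ℂ) * (Complex.I * τ) := by
    push_cast; ring
  rw [h, Complex.re_ofReal_mul, Complex.I_mul_re]
  have := Real.pi_pos
  exact mul_pos (by positivity) (by linarith)

/-- Pairing the products of two delta sequences with a functional `D` gives a Gaussian sum with
coefficients `D`. -/
lemma sum_mul_twMul_twDelta (h₁ : 0 < g₁ 1 0) (h₂ : 0 < g₂ 1 0) {n : ℕ} [NeZero n]
    (h₁₂ : (g₁ * g₂) 1 0 = n) (hτ : τ.im < 0) {η : ℂ} (hη : ‖η‖ = 1) (δ : ℝ) {D : ℤ → ℂ}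
    (hD : D ∈ quasiPeriodic n η⁻¹) (k l : ℤ) :
    ∑ i : Fin n, D (i : ℕ) * twMul g₁ g₂ τ δ (twDelta (g₁ 1 0) η k)
      (twDelta (g₂ 1 0) 1 (l - g₂ 0 0 * k)) (i : ℕ) =
    ∑' j : ℤ, D (l + g₂ 1 0 * j) * twTerm g₁ g₂ τ δ (l + g₂ 1 0 * j) k := by
  have hn : (0 : ℤ) < n := by exact_mod_cast NeZero.pos n
  have h12 : 0 < (g₁ * g₂) 1 0 := by rw [h₁₂]; exact hn
  have hη0 : η ≠ 0 := norm_ne_zero_iff.1 (by rw [hη]; exact one_ne_zero)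
  let v := twDelta (g₂ 1 0) 1 (l - g₂ 0 0 * k)
  have hv : v ∈ quasiPeriodic (g₂ 1 0) 1 := twDelta_mem h₂.ne' one_ne_zero _
  let H : ℤ → ℂ := fun γ => D γ * (v (γ - g₂ 0 0 * k) * twTerm g₁ g₂ τ δ γ k)
  have hH : Summable H := by
    obtain ⟨C, hC0, hC⟩ := quasiPeriodic_bounded hn (by rw [norm_inv, hη, inv_one]) hD
    obtain ⟨E, hE0, hE⟩ := quasiPeriodic_bounded h₂ (by simp) hv
    have h1 : (-(g₁ 1 0 : ℝ)) ≠ 0 := by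
      have : ((g₁ 1 0 : ℤ) : ℝ) ≠ 0 := by exact_mod_cast h₁.ne'
      exact neg_ne_zero.2 this
    refine Summable.of_norm_bounded (g := fun γ : ℤ => C * (E *
      Real.exp (-mulRate g₁ g₂ τ * (-(g₁ 1 0 : ℝ) * γ + ((g₁ * g₂) 1 0 * k + δ : ℝ)) ^ 2)))
      (((summable_gauss (mulRate_pos h₁ h₂ h12 hτ) h1 _).mul_left _).mul_left _) fun γ => ?_
    simp only [H]
    rw [norm_mul, norm_mul, norm_twTerm,
      show (((g₁ * g₂) 1 0 : ℝ) * k - g₁ 1 0 * γ + δ) =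
        -(g₁ 1 0 : ℝ) * γ + ((g₁ * g₂) 1 0 * k + δ : ℝ) by ring]
    gcongr
    · exact hC γ
    · exact hE _
  have hs : ∀ i : Fin n, D (i : ℕ) * twMul g₁ g₂ τ δ (twDelta (g₁ 1 0) η k) v (i : ℕ) =
      ∑' m : ℤ, H ((i : ℕ) - n * m) := by
    intro i
    rw [twMul, tsum_progression h₁.ne' k, ← tsum_mul_left]
    · refine tsum_congr fun m => ?_
      rw [twDelta_add_mul h₁.ne']
      have e1 : D ((i : ℕ) - n * m) = D (i : ℕ) * η ^ m := by
        rw [sub_eq_add_neg, ← mul_neg, quasiPeriodic_mul_int (inv_ne_zero hη0) hD, inv_zpow,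
          zpow_neg, inv_inv, mul_comm]
      have e2 : v ((i : ℕ) - g₂ 0 0 * (k + g₁ 1 0 * m)) =
          v ((i : ℕ) - n * m - g₂ 0 0 * k) := by
        have := quasiPeriodic_mul_int one_ne_zero hv ((i : ℕ) - n * m - g₂ 0 0 * k) (g₁ 1 1 * m)
        rw [one_zpow, one_mul] at this
        rw [← this]
        congr 1
        rw [← h₁₂, sl_mul10]
        ring
      have e3 : twTerm g₁ g₂ τ δ (i : ℕ) (k + g₁ 1 0 * m) =
          twTerm g₁ g₂ τ δ ((i : ℕ) - n * m) k := by
        rw [← h₁₂, twTerm, twTerm]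
        congr 2
        push_cast
        ring
      simp only [H]
      rw [e1, e2, e3]
      ring
    · intro κ hκ
      simp [twDelta, hκ]
  rw [Finset.sum_congr rfl fun i _ => hs i, ← tsum_int_eq_sum_fin hH n,
    tsum_progression h₂.ne' l]
  · refine tsum_congr fun j => ?_
    have : v (l + g₂ 1 0 * j - g₂ 0 0 * k) = 1 := by
      have := twDelta_add_mul h₂.ne' 1 (l - g₂ 0 0 * k) j
      rw [one_zpow] at this
      rw [← this]
      simp only [v]
      congr 1
      ring
    simp only [H]
    rw [this, one_mul]
  · intro γ hγ
    simp [H, v, twDelta, hγ]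

/-- If `c₁₂ < c₁ c₂`, the products span all sections. -/
theorem mem_span_twMul (h₁ : 0 < g₁ 1 0) (h₂ : 0 < g₂ 1 0) (h₁₂ : 0 < (g₁ * g₂) 1 0)
    (hlt : (g₁ * g₂) 1 0 < g₁ 1 0 * g₂ 1 0) (hτ : τ.im < 0) {η : ℂ} (hη : ‖η‖ = 1) (δ : ℝ)
    {W : ℤ → ℂ} (hW : W ∈ quasiPeriodic ((g₁ * g₂) 1 0) η) :
    W ∈ Submodule.span ℂ {w | ∃ u ∈ quasiPeriodic (g₁ 1 0) η, ∃ v ∈ quasiPeriodic (g₂ 1 0) 1,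
      w = twMul g₁ g₂ τ δ u v} := by
  have hη0 : η ≠ 0 := norm_ne_zero_iff.1 (by rw [hη]; exact one_ne_zero)
  obtain ⟨n, hn⟩ := Int.eq_ofNat_of_zero_le h₁₂.le
  obtain ⟨p, hp⟩ := Int.eq_ofNat_of_zero_le (mul_pos h₁ h₂).le
  change (g₁ * g₂) 1 0 = (n : ℤ) at hn
  change g₁ 1 0 * g₂ 1 0 = (p : ℤ) at hp
  have hn0 : 0 < n := by omega
  have : NeZero n := ⟨hn0.ne'⟩
  set S := Submodule.span ℂ {w | ∃ u ∈ quasiPeriodic (g₁ 1 0) η,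
    ∃ v ∈ quasiPeriodic (g₂ 1 0) 1, w = twMul g₁ g₂ τ δ u v}
  rw [hn] at hW
  let S' : Submodule ℂ (quasiPeriodic n η) := S.comap (Submodule.subtype _)
  suffices hS : S' = ⊤ by
    have : (⟨W, hW⟩ : quasiPeriodic n η) ∈ S' := by rw [hS]; trivial
    exact this
  by_contra hne
  obtain ⟨f, hf0, hf⟩ := S'.exists_le_ker_of_lt_top (lt_top_iff_ne_top.2 hne)
  let e := quasiPeriodicEquiv n hη0
  let e' := quasiPeriodicEquiv n (inv_ne_zero hη0)
  let D := e'.symm fun i => f (e.symm (Pi.single i 1))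
  have hD0 : ∀ i : Fin n, D.1 (i : ℕ) = f (e.symm (Pi.single i 1)) := fun i =>
    congrFun (e'.apply_symm_apply fun i => f (e.symm (Pi.single i 1))) i
  have hfD : ∀ u : quasiPeriodic n η, f u = ∑ i : Fin n, D.1 (i : ℕ) * u.1 (i : ℕ) := by
    intro u
    have h1 : u = e.symm (∑ i : Fin n, u.1 (i : ℕ) • Pi.single i 1) := by
      rw [LinearEquiv.eq_symm_apply]
      funext i
      simp only [Finset.sum_apply, Pi.smul_apply, Pi.single_apply, smul_eq_mul, mul_ite, mul_one,
        mul_zero, Finset.sum_ite_eq, Finset.mem_univ, if_true]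
      rfl
    conv_lhs => rw [h1]
    rw [map_sum, map_sum]
    refine Finset.sum_congr rfl fun i _ => ?_
    rw [map_smul, map_smul, hD0, smul_eq_mul, mul_comm]
  have n1 : (g₁ 1 0 : ℂ) ≠ 0 := by exact_mod_cast h₁.ne'
  have n2 : (g₂ 1 0 : ℂ) ≠ 0 := by exact_mod_cast h₂.ne'
  have n3 : (n : ℂ) ≠ 0 := by exact_mod_cast hn0.ne'
  have hpC : (p : ℂ) = g₁ 1 0 * g₂ 1 0 := by exact_mod_cast hp.symm
  have hz : ∀ l, D.1 l = 0 := by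
    intro l
    have hB := re_gauss_coeff_pos (τ := τ) h₁ h₂ h₁₂ hτ
    have := eq_zero_of_gaussSum_progression hB hn0 (by omega : n < p) (η := (η⁻¹) ^ (g₂ 1 0))
      (D := fun j => D.1 (l + g₂ 1 0 * j)) (by rw [norm_zpow, norm_inv, hη, inv_one, one_zpow])
      (fun j => by
        have e : l + g₂ 1 0 * (j + n) = l + g₂ 1 0 * j + n * g₂ 1 0 := by ring
        rw [e, quasiPeriodic_mul_int (inv_ne_zero hη0) D.2])
      ((g₁ 1 0 * l - δ) / p) (fun m => by
        have h1 := sum_mul_twMul_twDelta h₁ h₂ hn hτ hη δ D.2 (-m) l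
        have hmem := twMul_mem (τ := τ) (δ := δ) one_ne_zero (twDelta_mem h₁.ne' hη0 (-m))
          (twDelta_mem (c := g₂ 1 0) h₂.ne' one_ne_zero (l - g₂ 0 0 * (-m)))
        rw [one_zpow, mul_one, hn] at hmem
        have h2 : f ⟨_, hmem⟩ = 0 := hf (show (⟨_, hmem⟩ : quasiPeriodic n η) ∈ S' from
          Submodule.subset_span ⟨_, twDelta_mem h₁.ne' hη0 _, _,
            twDelta_mem h₂.ne' one_ne_zero _, rfl⟩)
        rw [hfD] at h2
        rw [← h2, h1]
        refine tsum_congr fun j => ?_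
        rw [twTerm, hn]
        congr 2
        push_cast
        rw [hpC]
        field_simp
        ring) 0
    simpa using this
  apply hf0
  ext u
  rw [hfD]
  simp [hz]

/-- If `c₂ < c₁ c₁₂`, a section whose products with all delta sequences vanish is zero. -/
theorem eq_zero_of_twMul_eq_zero (h₁ : 0 < g₁ 1 0) (h₂ : 0 < g₂ 1 0) (h₁₂ : 0 < (g₁ * g₂) 1 0)
    (hlt : g₂ 1 0 < g₁ 1 0 * (g₁ * g₂) 1 0) (hτ : τ.im < 0) {η ε : ℂ} (hη : ‖η‖ = 1)
    (hε : ‖ε‖ = 1) (δ : ℝ) {v : ℤ → ℂ} (hv : v ∈ quasiPeriodic (g₂ 1 0) η)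
    (h0 : ∀ k l : ℤ, twMul g₁ g₂ τ δ (fun κ => if g₁ 1 0 ∣ κ - k then ε ^ κ else 0) v l = 0)
    (y : ℤ) : v y = 0 := by
  have hη0 : η ≠ 0 := norm_ne_zero_iff.1 (by rw [hη]; exact one_ne_zero)
  have hε0 : ε ≠ 0 := norm_ne_zero_iff.1 (by rw [hε]; exact one_ne_zero)
  obtain ⟨n, hn⟩ := Int.eq_ofNat_of_zero_le h₂.le
  obtain ⟨p, hp⟩ := Int.eq_ofNat_of_zero_le (mul_pos h₁ h₁₂).le
  change g₂ 1 0 = (n : ℤ) at hn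
  change g₁ 1 0 * (g₁ * g₂) 1 0 = (p : ℤ) at hp
  have n1 : (g₁ 1 0 : ℂ) ≠ 0 := by exact_mod_cast h₁.ne'
  have n2 : (n : ℂ) ≠ 0 := by
    have : n ≠ 0 := by omega
    exact_mod_cast this
  have n3 : ((g₁ * g₂) 1 0 : ℂ) ≠ 0 := by exact_mod_cast h₁₂.ne'
  have hnC : (g₂ 1 0 : ℂ) = n := by exact_mod_cast hn
  have hpC : (p : ℂ) = g₁ 1 0 * (g₁ * g₂) 1 0 := by exact_mod_cast hp.symm
  have hB := re_gauss_coeff_pos (τ := τ) h₁ h₁₂ h₂ hτ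
  have := eq_zero_of_gaussSum_progression hB (by omega : 0 < n) (by omega : n < p)
    (η := ε ^ (g₁ 1 0 * g₂ 1 0) * η ^ (-(g₂ 0 0 * g₁ 1 0)))
    (D := fun j => ε ^ (g₁ 1 0 * j) * v (y - g₂ 0 0 * g₁ 1 0 * j))
    (by rw [norm_mul, norm_zpow, norm_zpow, hε, hη, one_zpow, one_zpow, one_mul])
    (fun j => by
      have e : y - g₂ 0 0 * g₁ 1 0 * (j + n) =
          y - g₂ 0 0 * g₁ 1 0 * j + g₂ 1 0 * (-(g₂ 0 0 * g₁ 1 0)) := by rw [hn]; ring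
      rw [e, quasiPeriodic_mul_int hη0 hv, ← hn, mul_add, zpow_add₀ hε0]
      ring)
    ((δ - g₁ 1 0 * y) / p) (fun m => by
      -- the shift of the summation index in `h0` runs through all multiples of `c₂`
      have h1 := h0 (g₁ 0 0 * m) (y + g₂ 0 0 * g₁ 0 0 * m + g₂ 1 0 * (g₁ 0 1 * m))
      rw [twMul, tsum_progression h₁.ne' (g₁ 0 0 * m)] at h1
      · have h2 : ε ^ (g₁ 0 0 * m) * η ^ (g₁ 0 1 * m) ≠ 0 :=
          mul_ne_zero (zpow_ne_zero _ hε0) (zpow_ne_zero _ hη0)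
        refine (mul_eq_zero.1 (Eq.trans ?_ h1)).resolve_left h2
        rw [← tsum_mul_left]
        refine tsum_congr fun j => ?_
        have e : y + g₂ 0 0 * g₁ 0 0 * m + g₂ 1 0 * (g₁ 0 1 * m) -
            g₂ 0 0 * (g₁ 0 0 * m + g₁ 1 0 * j) =
            y - g₂ 0 0 * g₁ 1 0 * j + g₂ 1 0 * (g₁ 0 1 * m) := by ring
        rw [e, quasiPeriodic_mul_int hη0 hv, add_sub_cancel_left, if_pos (dvd_mul_right _ _),
          zpow_add₀ hε0, twTerm]
        have hd : (g₁ 0 0 * g₁ 1 1 - g₁ 0 1 * g₁ 1 0 : ℂ) = 1 := by exact_mod_cast sl_det g₁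
        have h12 : ((g₁ * g₂) 1 0 : ℂ) = g₁ 1 0 * g₂ 0 0 + g₁ 1 1 * g₂ 1 0 := by
          exact_mod_cast sl_mul10 g₁ g₂
        have e2 : ((g₁ * g₂) 1 0 : ℂ) * (g₁ 0 0 * m + g₁ 1 0 * j : ℤ) -
            g₁ 1 0 * (y + g₂ 0 0 * g₁ 0 0 * m + g₂ 1 0 * (g₁ 0 1 * m) : ℤ) + δ =
            g₁ 1 0 * (g₁ * g₂) 1 0 * j + g₂ 1 0 * m + (δ - g₁ 1 0 * y) := by
          push_cast
          linear_combination (g₁ 0 0 * m : ℂ) * h12 + (g₂ 1 0 * m : ℂ) * hd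
        rw [e2]
        have e3 : -(Real.pi * Complex.I * τ * g₁ 1 0 * (g₁ * g₂) 1 0 / g₂ 1 0) *
            ((j : ℂ) + ((n / p * m + (δ - g₁ 1 0 * y) / p : ℝ) : ℂ)) ^ 2 =
            -(Real.pi * Complex.I * τ / (g₁ 1 0 * g₂ 1 0 * (g₁ * g₂) 1 0)) *
            (g₁ 1 0 * (g₁ * g₂) 1 0 * j + g₂ 1 0 * m + (δ - g₁ 1 0 * y)) ^ 2 := by
          push_cast
          rw [hpC, hnC]
          field_simp
          ring
        rw [e3]
        ring
      · intro κ hκ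
        rw [if_neg hκ, zero_mul, zero_mul]) 0
  simpa using this

end

/-! ### A criterion for quadratic presentations -/

section

variable {A : Type*} [Ring A] [Algebra ℂ A] {ι : Type*} [Fintype ι] {𝓑 : ℕ → Type*}
  [∀ n, AddCommGroup (𝓑 n)] [∀ n, Module ℂ (𝓑 n)]

/-- Let `L n i : 𝓑 n → 𝓑 (n + 1)` be the operators of left multiplication by the generators of a
graded algebra `𝓑` generated in degree one. If every syzygy `∑ L i (w i) = 0` is a consequence of
quadratic relations that hold between elements `x i` of an algebra `A`, then the assignment
`L i₁ (⋯ (L iₙ y)) ↦ x i₁ ⋯ x iₙ ψ₀ y` is well defined. -/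
theorem exists_linearMap_of_quadratic (x : ι → A) (L : ∀ n, ι → 𝓑 n →ₗ[ℂ] 𝓑 (n + 1))
    (hgen : ∀ n (y : 𝓑 (n + 1)), ∃ w : ι → 𝓑 n, y = ∑ i, L n i (w i))
    (hinj : ∀ w : ι → 𝓑 0, ∑ i, L 0 i (w i) = 0 → w = 0)
    (hrel : ∀ n (w : ι → 𝓑 (n + 1)), ∑ i, L (n + 1) i (w i) = 0 →
      w ∈ Submodule.span ℂ {w' | ∃ (r : ι → ι → ℂ) (z : 𝓑 n),
        ∑ i, ∑ j, r i j • (x i * x j) = 0 ∧ w' = fun i => ∑ j, r i j • L n j z})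
    (ψ₀ : 𝓑 0 →ₗ[ℂ] A) :
    ∃ ψ : ∀ n, 𝓑 n →ₗ[ℂ] A, ψ 0 = ψ₀ ∧ ∀ n i y, ψ (n + 1) (L n i y) = x i * ψ n y := by
  classical
  let μ : ∀ n, (ι → 𝓑 n) →ₗ[ℂ] 𝓑 (n + 1) := fun n => ∑ i, L n i ∘ₗ LinearMap.proj i
  have hμ : ∀ n w, μ n w = ∑ i, L n i (w i) := fun n w => by simp [μ]
  let Θ : ∀ n, (𝓑 n →ₗ[ℂ] A) → (ι → 𝓑 n) →ₗ[ℂ] A := fun n ψ =>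
    ∑ i, LinearMap.mulLeft ℂ (x i) ∘ₗ ψ ∘ₗ LinearMap.proj i
  have hΘ : ∀ n ψ w, Θ n ψ w = ∑ i, x i * ψ (w i) := fun n ψ w => by simp [Θ]
  have hsurj : ∀ n, LinearMap.range (μ n) = ⊤ := fun n => LinearMap.range_eq_top.2 fun y => by
    obtain ⟨w, hw⟩ := hgen n y
    exact ⟨w, by rw [hμ, hw]⟩
  choose g hg using fun n => (μ n).exists_rightInverse_of_surjective (hsurj n)
  -- `ψ` is defined with the help of linear sections `g n` of the multiplication maps `μ n`; the
  -- hypotheses on syzygies make it independent of this choice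
  let ψ : ∀ n, 𝓑 n →ₗ[ℂ] A := fun n => Nat.rec ψ₀ (fun n ψ => Θ n ψ ∘ₗ g n) n
  have hgμ : ∀ n w, μ n (g n (μ n w) - w) = 0 := fun n w => by
    have := LinearMap.congr_fun (hg n) (μ n w)
    rw [LinearMap.comp_apply, LinearMap.id_apply] at this
    rw [map_sub, this, sub_self]
  have key : ∀ n w, ψ (n + 1) (μ n w) = Θ n (ψ n) w := by
    intro n
    induction n with
    | zero =>
      intro w
      have h := hinj _ ((hμ 0 _).symm.trans (hgμ 0 w))
      change Θ 0 (ψ 0) (g 0 (μ 0 w)) = _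
      rw [sub_eq_zero.1 h]
    | succ n ih =>
      intro w
      have h := hrel n _ ((hμ (n + 1) _).symm.trans (hgμ (n + 1) w))
      have hL : ∀ j z, ψ (n + 1) (L n j z) = x j * ψ n z := by
        intro j z
        have h1 := ih (Pi.single j z)
        rw [hμ, hΘ, Finset.sum_eq_single j, Finset.sum_eq_single j] at h1
        · simpa using h1
        · intro i _ hij; simp [Pi.single_eq_of_ne hij]
        · simp
        · intro i _ hij; simp [Pi.single_eq_of_ne hij]
        · simp
      have h0 : Θ (n + 1) (ψ (n + 1)) (g (n + 1) (μ (n + 1) w) - w) = 0 := by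
        refine LinearMap.mem_ker.1 (Submodule.span_le.2 ?_ h)
        rintro _ ⟨r, z, hr, rfl⟩
        rw [SetLike.mem_coe, LinearMap.mem_ker, hΘ]
        have : ∀ i, x i * ψ (n + 1) (∑ j, r i j • L n j z) =
            (∑ j, r i j • (x i * x j)) * ψ n z := by
          intro i
          rw [map_sum, Finset.mul_sum, Finset.sum_mul]
          refine Finset.sum_congr rfl fun j _ => ?_
          rw [map_smul, hL, mul_smul_comm, smul_mul_assoc, mul_assoc]
        simp only [this]
        rw [← Finset.sum_mul, hr, zero_mul]
      change Θ (n + 1) (ψ (n + 1)) (g (n + 1) (μ (n + 1) w)) = _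
      rwa [map_sub, sub_eq_zero] at h0
  refine ⟨ψ, rfl, fun n i y => ?_⟩
  have h1 := key n (Pi.single i y)
  rw [hμ, hΘ, Finset.sum_eq_single i, Finset.sum_eq_single i] at h1
  · simpa using h1
  · intro j _ hij; simp [Pi.single_eq_of_ne hij]
  · simp
  · intro j _ hij; simp [Pi.single_eq_of_ne hij]
  · simp

end

namespace RMTorus

variable (T : RMTorus)

/-! ### Degrees of the powers of `g` -/

lemma pow_deg_recurrence (n : ℕ) :
    (T.g ^ (n + 2)) 1 0 = (T.g 0 0 + T.g 1 1) * (T.g ^ (n + 1)) 1 0 - (T.g ^ n) 1 0 := by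
  have h := sl_det T.g
  rw [_root_.pow_succ _ (n + 1), _root_.pow_succ _ n, sl_mul10, sl_mul10, sl_mul11]
  linear_combination -(T.g ^ n) 1 0 * h

lemma pow_deg_nonneg (n : ℕ) : 0 ≤ (T.g ^ n) 1 0 := by
  rcases n with _ | n
  · simp
  · exact (T.pow_pos n).1.le

lemma pow_deg_succ_le (n : ℕ) :
    (T.g ^ (n + 2)) 1 0 ≤ (T.g 0 0 + T.g 1 1) * (T.g ^ (n + 1)) 1 0 := by
  have := T.pow_deg_recurrence n
  have := T.pow_deg_nonneg n
  omega

lemma pow_deg_succ_lt (n : ℕ) : (T.g ^ (n + 2)) 1 0 < T.g 1 0 * (T.g ^ (n + 1)) 1 0 := by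
  have h1 := T.pow_deg_succ_le n
  have h2 := (T.pow_pos n).1
  have h3 := T.degree_ge
  nlinarith

/-! ### The mutated module -/

/-- The matrix `s` with `s⁻¹(1, 0) = c(1, 0) - g(1, 0)` and `c(gs) = c²`. The basic module of
`s⁻¹g^{m+1}` represents the kernel of the multiplication
`𝓗_g ⊗ 𝓗_{g^{m+1}} → 𝓗_{g^{m+2}}`. -/
def mutation : SL2Z :=
  ⟨!![T.g 1 0 - T.g 1 1, T.g 1 0 - (T.g 0 0 + T.g 1 1) + T.g 0 1; T.g 1 0, T.g 1 0 - T.g 0 0], by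
    rw [Matrix.det_fin_two_of]
    linear_combination sl_det T.g⟩

lemma mutation_00 : T.mutation 0 0 = T.g 1 0 - T.g 1 1 := rfl

lemma mutation_10 : T.mutation 1 0 = T.g 1 0 := rfl

lemma mutation_11 : T.mutation 1 1 = T.g 1 0 - T.g 0 0 := rfl

/-- The matrix `s⁻¹g^{m+1}`. -/
def kernelMat (m : ℕ) : SL2Z := T.mutation⁻¹ * T.g ^ (m + 1)

lemma mutation_mul_kernelMat (m : ℕ) : T.mutation * T.kernelMat m = T.g ^ (m + 1) :=
  mul_inv_cancel_left _ _

lemma kernelMat_zero_mul (m : ℕ) : T.kernelMat 0 * T.g ^ m = T.kernelMat m := by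
  rw [kernelMat, kernelMat, mul_assoc, ← _root_.pow_add, add_comm (0 + 1) m, zero_add]

lemma kernelMat_deg (m : ℕ) :
    (T.kernelMat m) 1 0 = T.g 1 0 * (T.g ^ (m + 1)) 1 0 - (T.g ^ (m + 2)) 1 0 := by
  have h1 := T.mutation_mul_kernelMat m
  have h2 : (T.g ^ (m + 1)) 0 0 = (T.mutation * T.kernelMat m) 0 0 := by rw [h1]
  have h3 : (T.g ^ (m + 1)) 1 0 = (T.mutation * T.kernelMat m) 1 0 := by rw [h1]
  have h4 := sl_det T.mutation
  rw [sl_mul00] at h2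
  rw [sl_mul10] at h3
  rw [_root_.pow_succ' _ (m + 1), sl_mul10]
  rw [mutation_00, mutation_10, mutation_11] at *
  linear_combination T.g 1 0 * h2 - (T.g 1 0 - T.g 1 1) * h3 - (T.kernelMat m) 1 0 * h4

lemma kernelMat_deg_pos (m : ℕ) : 0 < (T.kernelMat m) 1 0 := by
  rw [kernelMat_deg]
  exact sub_pos.2 (T.pow_deg_succ_lt m)

/-- Here `c - a - d ≥ 2` is needed. -/
lemma kernelMat_deg_lt (m : ℕ) :
    (T.kernelMat (m + 1)) 1 0 < (T.kernelMat 0) 1 0 * (T.g ^ (m + 1)) 1 0 := by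
  have h1 := T.pow_deg_recurrence (m + 1)
  have h2 := T.pow_deg_succ_le m
  have h3 := T.pow_deg_recurrence 0
  have h4 := (T.pow_pos m).1
  have h5 := T.degree_ge
  simp only [zero_add, _root_.pow_one, _root_.pow_zero] at h3
  rw [kernelMat_deg, kernelMat_deg, h1, zero_add, _root_.pow_one, h3]
  simp only [Matrix.SpecialLinearGroup.coe_one,
    Matrix.one_apply_ne (by decide : (1 : Fin 2) ≠ 0), sub_zero]
  have h6 : 4 ≤ (T.g 1 0 - (T.g 0 0 + T.g 1 1)) ^ 2 := by nlinarith
  nlinarith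

lemma g_mul_mutation_deg : (T.g * T.mutation) 1 0 = T.g 1 0 ^ 2 := by
  rw [sl_mul10, mutation_00, mutation_10]; ring

/-! ### Delta sequences of degree one -/

lemma exists_dvd_sub_idx (n : ℤ) : ∃ i : Fin T.deg, T.g 1 0 ∣ n - idx i := by
  have hc := T.deg_pos
  have hd := T.deg_cast
  have h1 := Int.emod_nonneg (n - 1) hc.ne'
  have h2 := Int.emod_lt_of_pos (n - 1) hc
  refine ⟨⟨((n - 1) % T.g 1 0).toNat, by omega⟩, ?_⟩
  simp only [idx]
  rw [Int.toNat_of_nonneg h1]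
  have := Int.emod_add_mul_ediv (n - 1) (T.g 1 0)
  exact ⟨(n - 1) / T.g 1 0, by linarith⟩

lemma eq_of_dvd_idx_sub_idx {i j : Fin T.deg} (h : T.g 1 0 ∣ idx i - idx j) : i = j := by
  obtain ⟨k, hk⟩ := h
  have hd := T.deg_cast
  have hc := T.deg_pos
  have hi := i.2
  have hj := j.2
  simp only [idx] at hk
  have h1 : k < 1 := by nlinarith
  have h2 : -1 < k := by nlinarith
  have h3 : k = 0 := by omega
  subst h3
  ext
  omega

/-- The coefficients of `φ_i`. -/
def delta (i : Fin T.deg) : ℤ → ℂ := twDelta (T.g 1 0) 1 (idx i)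

lemma delta_apply (i : Fin T.deg) (k : ℤ) :
    T.delta i k = if T.g 1 0 ∣ k - idx i then 1 else 0 := by
  simp [delta, twDelta]

lemma delta_mem (i : Fin T.deg) : T.delta i ∈ quasiPeriodic (T.g 1 0) 1 :=
  twDelta_mem T.deg_pos.ne' one_ne_zero _

lemma norm_delta_le (i : Fin T.deg) (k : ℤ) : ‖T.delta i k‖ ≤ 1 := by
  rw [delta_apply]; split_ifs <;> simp

lemma sum_smul_delta {u : ℤ → ℂ} (hu : u ∈ quasiPeriodic (T.g 1 0) 1) :
    ∑ i, u (idx i) • T.delta i = u := by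
  funext k
  obtain ⟨i, hi⟩ := T.exists_dvd_sub_idx k
  rw [Finset.sum_apply, Finset.sum_eq_single i]
  · rw [Pi.smul_apply, delta_apply, if_pos hi, smul_eq_mul, mul_one]
    obtain ⟨n, hn⟩ := hi
    rw [show k = idx i + T.g 1 0 * n by omega, quasiPeriodic_mul_int one_ne_zero hu]
    simp
  · intro j _ hj
    rw [Pi.smul_apply, delta_apply, if_neg, smul_zero]
    intro hd
    refine hj (T.eq_of_dvd_idx_sub_idx ?_)
    have := dvd_sub hi hd
    simpa using this
  · simp

/-! ### Left multiplication by sections of degree one -/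

/-- The coefficients of `φ_i f` for a section `f` of degree `n`. -/
def lmul (n : ℕ) (i : Fin T.deg) (f : ℤ → ℂ) : ℤ → ℂ := twMul T.g (T.g ^ n) T.τ 0 (T.delta i) f

lemma pow_deg_mul_pos (n : ℕ) : 0 < (T.g * T.g ^ n) 1 0 := by
  rw [← _root_.pow_succ']; exact (T.pow_pos n).1

lemma lmul_mem {n : ℕ} (i : Fin T.deg) {f : ℤ → ℂ} (hf : f ∈ quasiPeriodic ((T.g ^ n) 1 0) 1) :
    T.lmul n i f ∈ quasiPeriodic ((T.g ^ (n + 1)) 1 0) 1 := by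
  have := twMul_mem (τ := T.τ) (δ := 0) one_ne_zero (T.delta_mem i) hf
  rwa [one_zpow, mul_one, ← _root_.pow_succ'] at this

/-- Multiplication by `φ_i` as a linear map. -/
def lmulHom (n : ℕ) (i : Fin T.deg) :
    quasiPeriodic ((T.g ^ (n + 1)) 1 0) 1 →ₗ[ℂ] quasiPeriodic ((T.g ^ (n + 2)) 1 0) 1 where
  toFun f := ⟨T.lmul (n + 1) i f, T.lmul_mem i f.2⟩
  map_add' f f' := Subtype.ext <| by
    obtain ⟨C, -, hC⟩ := quasiPeriodic_bounded (T.pow_pos n).1 norm_one f.2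
    obtain ⟨C', -, hC'⟩ := quasiPeriodic_bounded (T.pow_pos n).1 norm_one f'.2
    exact twMul_add_right T.deg_pos (T.pow_pos n).1 (T.pow_deg_mul_pos (n + 1)) T.im_neg
      (T.norm_delta_le i) hC hC' 0
  map_smul' z f := Subtype.ext (twMul_smul_right _ _ _ _ _ _ _)

/-- The multiplication map `𝓗_g ⊗ 𝓗_{g^{n+1}} → 𝓗_{g^{n+2}}`. -/
def mulHom (n : ℕ) : (Fin T.deg → quasiPeriodic ((T.g ^ (n + 1)) 1 0) 1) →ₗ[ℂ]
    quasiPeriodic ((T.g ^ (n + 2)) 1 0) 1 := ∑ i, T.lmulHom n i ∘ₗ LinearMap.proj i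

lemma mulHom_apply (n : ℕ) (w : Fin T.deg → quasiPeriodic ((T.g ^ (n + 1)) 1 0) 1) :
    (T.mulHom n w : ℤ → ℂ) = ∑ i, T.lmul (n + 1) i (w i) := by
  rw [mulHom, LinearMap.sum_apply, Submodule.coe_sum]
  rfl

lemma sum_smul_lmul {u : ℤ → ℂ} (hu : u ∈ quasiPeriodic (T.g 1 0) 1) {n : ℕ} {v : ℤ → ℂ}
    (hv : v ∈ quasiPeriodic ((T.g ^ (n + 1)) 1 0) 1) :
    twMul T.g (T.g ^ (n + 1)) T.τ 0 u v = ∑ i, u (idx i) • T.lmul (n + 1) i v := by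
  obtain ⟨D, -, hD⟩ := quasiPeriodic_bounded (T.pow_pos n).1 norm_one hv
  let R : quasiPeriodic (T.g 1 0) 1 →ₗ[ℂ] (ℤ → ℂ) :=
    { toFun := fun u => twMul T.g (T.g ^ (n + 1)) T.τ 0 u v
      map_add' := fun u u' => by
        obtain ⟨C, -, hC⟩ := quasiPeriodic_bounded T.deg_pos norm_one u.2
        obtain ⟨C', -, hC'⟩ := quasiPeriodic_bounded T.deg_pos norm_one u'.2
        exact twMul_add_left T.deg_pos (T.pow_pos n).1 (T.pow_deg_mul_pos (n + 1)) T.im_neg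
          hC hC' hD 0
      map_smul' := fun z u => twMul_smul_left _ _ _ _ _ _ _ }
  have h1 : (⟨u, hu⟩ : quasiPeriodic (T.g 1 0) 1) =
      ∑ i, u (idx i) • ⟨T.delta i, T.delta_mem i⟩ := by
    apply Subtype.ext
    rw [Submodule.coe_sum]
    exact (T.sum_smul_delta hu).symm
  have h2 : twMul T.g (T.g ^ (n + 1)) T.τ 0 u v = R ⟨u, hu⟩ := rfl
  rw [h2, h1, map_sum]
  refine Finset.sum_congr rfl fun i _ => ?_
  rw [map_smul]
  rfl

/-- The coordinate ring is generated in degree one, because `deg g^{n+2} < deg g · deg g^{n+1}`. -/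
lemma mulHom_surjective (n : ℕ) : Function.Surjective (T.mulHom n) := by
  rintro ⟨W, hW⟩
  have hlt : (T.g * T.g ^ (n + 1)) 1 0 < T.g 1 0 * (T.g ^ (n + 1)) 1 0 := by
    rw [← _root_.pow_succ']; exact T.pow_deg_succ_lt n
  have hW' := hW
  rw [_root_.pow_succ' _ (n + 1)] at hW'
  have h := mem_span_twMul T.deg_pos (T.pow_pos n).1 (T.pow_deg_mul_pos (n + 1)) hlt T.im_neg
    norm_one 0 hW'
  have h2 : Submodule.span ℂ {w | ∃ u ∈ quasiPeriodic (T.g 1 0) 1,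
      ∃ v ∈ quasiPeriodic ((T.g ^ (n + 1)) 1 0) 1, w = twMul T.g (T.g ^ (n + 1)) T.τ 0 u v} ≤
      (LinearMap.range (T.mulHom n)).map (Submodule.subtype _) := by
    rw [Submodule.span_le]
    rintro _ ⟨u, hu, v, hv, rfl⟩
    refine ⟨T.mulHom n fun i => u (idx i) • ⟨v, hv⟩, ⟨_, rfl⟩, ?_⟩
    rw [Submodule.subtype_apply, mulHom_apply, T.sum_smul_lmul hu hv]
    exact Finset.sum_congr rfl fun i _ => twMul_smul_right _ _ _ _ _ _ _
  obtain ⟨_, ⟨w, rfl⟩, hw⟩ := h2 h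
  exact ⟨w, Subtype.ext hw⟩

end RMTorus

namespace RMTorus

variable (T : RMTorus)

/-! ### Syzygies -/

/-- The quasi-periodicity factor of the sections of the mutated modules. -/
def kernelSign : ℂ := (-1) ^ (T.g 1 0)

/-- The sequence supported on `k + cℤ` with the value `(-1)^{(c-a)κ}` at `κ`. With
these signs, which depend on `κ` itself and not only on its residue class, the products with the
`φ_i` become alternating sums. -/
def signDelta (k : ℤ) : ℤ → ℂ := fun κ =>
  if T.g 1 0 ∣ κ - k then ((-1) ^ (T.g 1 0 - T.g 0 0)) ^ κ else 0

lemma norm_neg_one_zpow (n : ℤ) : ‖((-1 : ℂ) ^ n)‖ = 1 := by simp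

lemma norm_kernelSign : ‖T.kernelSign‖ = 1 := norm_neg_one_zpow _

lemma kernelSign_ne_zero : T.kernelSign ≠ 0 := zpow_ne_zero _ (by norm_num)

lemma norm_signDelta_le (k κ : ℤ) : ‖T.signDelta k κ‖ ≤ 1 := by
  rw [signDelta]
  split_ifs
  · rw [norm_zpow, norm_neg_one_zpow, one_zpow]
  · simp

lemma signDelta_mem (k : ℤ) : T.signDelta k ∈
    quasiPeriodic (T.g 1 0) (((-1) ^ (T.g 1 0 - T.g 0 0)) ^ (T.g 1 0)) := by
  intro κ
  have h : κ + T.g 1 0 - k = κ - k + T.g 1 0 := by ring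
  simp only [signDelta, h, dvd_add_self_right]
  split_ifs
  · rw [zpow_add₀ (zpow_ne_zero _ (by norm_num)), mul_comm]
  · simp

/-- The component at `φ_i` of the syzygy attached to a section `f` of a mutated module. The
translation by `-c/2` places the terms of the sum `sum_twMul_delta_signDelta` at half-integers. -/
def syz (m : ℕ) (f : ℤ → ℂ) (i : Fin T.deg) : ℤ → ℂ :=
  twMul T.mutation (T.kernelMat m) T.τ ((T.g ^ (m + 1)) 1 0 * (-T.g 1 0 / 2))
    (T.signDelta (T.g 1 1 * idx i)) f

lemma syz_mem {m : ℕ} {f : ℤ → ℂ} (hf : f ∈ quasiPeriodic ((T.kernelMat m) 1 0) T.kernelSign)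
    (i : Fin T.deg) : T.syz m f i ∈ quasiPeriodic ((T.g ^ (m + 1)) 1 0) 1 := by
  have h := twMul_mem (g₁ := T.mutation) (τ := T.τ)
    (δ := (T.g ^ (m + 1)) 1 0 * (-T.g 1 0 / 2)) T.kernelSign_ne_zero
    (T.signDelta_mem (T.g 1 1 * idx i)) hf
  have e : ((-1 : ℂ) ^ (T.g 1 0 - T.g 0 0)) ^ (T.g 1 0) * T.kernelSign ^ (T.mutation 1 1) = 1 := by
    rw [kernelSign, mutation_11, ← zpow_mul, ← zpow_mul, ← zpow_add₀ (by norm_num)]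
    refine Even.neg_one_zpow ⟨T.g 1 0 * (T.g 1 0 - T.g 0 0), by ring⟩
  rwa [e, T.mutation_mul_kernelMat] at h

lemma mutation_pos : 0 < T.mutation 1 0 := T.deg_pos

lemma mutation_mul_pos (m : ℕ) : 0 < (T.mutation * T.kernelMat m) 1 0 := by
  rw [mutation_mul_kernelMat]; exact (T.pow_pos m).1

/-- The canonical tensor `∑ φ_i ⊗ s_i` is annihilated by the product: the Gaussian sums that arise
are alternating sums over half-integers, and cancel in pairs. -/
lemma sum_twMul_delta_signDelta :
    ∑ i, twMul T.g T.mutation T.τ (-(T.g 1 0 * (-T.g 1 0 / 2)))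
      (fun k => T.delta i k * T.kernelSign ^ (-(T.mutation 0 1 * k)))
      (T.signDelta (T.g 1 1 * idx i)) = 0 := by
  have hc := T.deg_pos
  have hgs : 0 < (T.g * T.mutation) 1 0 := by rw [g_mul_mutation_deg]; positivity
  have hε0 : ((-1 : ℂ) ^ (T.g 1 0 - T.g 0 0)) ≠ 0 := zpow_ne_zero _ (by norm_num)
  funext ρ
  have hb : ∀ i k, ‖T.delta i k * T.kernelSign ^ (-(T.mutation 0 1 * k))‖ ≤ 1 := fun i k => by
    rw [norm_mul, norm_zpow, norm_kernelSign, one_zpow, mul_one]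
    exact T.norm_delta_le i k
  rw [Finset.sum_apply]
  simp only [twMul]
  rw [← Summable.tsum_finsetSum fun i _ => summable_twMul hc T.mutation_pos hgs T.im_neg (hb i)
    (T.norm_signDelta_le (T.g 1 1 * idx i)) _ ρ]
  have hterm : ∀ k : ℤ, ∑ i, T.delta i k * T.kernelSign ^ (-(T.mutation 0 1 * k)) *
      T.signDelta (T.g 1 1 * idx i) (ρ - T.mutation 0 0 * k) *
      twTerm T.g T.mutation T.τ (-(T.g 1 0 * (-T.g 1 0 / 2))) ρ k =
      (if T.g 1 0 ∣ ρ then ((-1 : ℂ) ^ (T.g 1 0 - T.g 0 0)) ^ ρ * (-1) ^ k else 0) *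
      twTerm T.g T.mutation T.τ (-(T.g 1 0 * (-T.g 1 0 / 2))) ρ k := by
    intro k
    rw [← Finset.sum_mul]
    congr 1
    obtain ⟨i, hi⟩ := T.exists_dvd_sub_idx k
    rw [Finset.sum_eq_single i]
    · rw [delta_apply, if_pos hi, one_mul, signDelta, mutation_00]
      have hiff : T.g 1 0 ∣ ρ - (T.g 1 0 - T.g 1 1) * k - T.g 1 1 * idx i ↔ T.g 1 0 ∣ ρ := by
        have e : ρ - (T.g 1 0 - T.g 1 1) * k - T.g 1 1 * idx i =
            ρ + (-(T.g 1 0 * k) + T.g 1 1 * (k - idx i)) := by ring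
        rw [e]
        exact dvd_add_left (dvd_add (dvd_neg.2 (dvd_mul_right _ _)) (hi.mul_left _))
      simp only [hiff]
      split_ifs
      · rw [sub_eq_add_neg ρ, zpow_add₀ hε0, mul_left_comm]
        congr 1
        rw [kernelSign, ← zpow_mul, ← zpow_mul, ← zpow_add₀ (by norm_num)]
        have hd := sl_det T.mutation
        rw [mutation_00, mutation_10, mutation_11] at hd
        have e : T.g 1 0 * -(T.mutation 0 1 * k) +
            (T.g 1 0 - T.g 0 0) * -((T.g 1 0 - T.g 1 1) * k) =
            k + 2 * (-(1 + T.mutation 0 1 * T.g 1 0) * k) := by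
          linear_combination -k * hd
        rw [e, zpow_add₀ (by norm_num), zpow_mul (-1 : ℂ) 2]
        norm_num
      · rw [mul_zero]
    · intro j _ hj
      rw [delta_apply, if_neg, zero_mul, zero_mul]
      intro hd
      refine hj (T.eq_of_dvd_idx_sub_idx ?_)
      have := dvd_sub hi hd
      simpa using this
    · simp
  simp only [hterm, Pi.zero_apply]
  split_ifs with hρ
  · obtain ⟨R, rfl⟩ := hρ
    -- the reflection `k ↦ 2R - 1 - k` reverses the signs
    have hodd : ∀ k : ℤ, (-1 : ℂ) ^ (2 * R - 1 - k) = -(-1) ^ k := by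
      intro k
      rw [show 2 * R - 1 - k = k + (2 * (R - 1 - k) + 1) by ring, zpow_add₀ (by norm_num),
        Odd.neg_one_zpow ⟨_, rfl⟩]
      ring
    have hrefl : ∀ k : ℤ, twTerm T.g T.mutation T.τ (-(T.g 1 0 * (-T.g 1 0 / 2))) (T.g 1 0 * R)
        (2 * R - 1 - k) =
        twTerm T.g T.mutation T.τ (-(T.g 1 0 * (-T.g 1 0 / 2))) (T.g 1 0 * R) k := by
      intro k
      rw [twTerm, twTerm, g_mul_mutation_deg]
      congr 2
      push_cast
      ring
    have h := (Equiv.subLeft (2 * R - 1)).tsum_eq fun k : ℤ =>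
      ((-1 : ℂ) ^ (T.g 1 0 - T.g 0 0)) ^ (T.g 1 0 * R) * (-1) ^ k *
        twTerm T.g T.mutation T.τ (-(T.g 1 0 * (-T.g 1 0 / 2))) (T.g 1 0 * R) k
    simp only [Equiv.subLeft_apply, hodd, hrefl, mul_neg, neg_mul, tsum_neg] at h
    exact self_eq_neg.1 h.symm
  · simp

lemma sum_lmul_syz {m : ℕ} {f : ℤ → ℂ}
    (hf : f ∈ quasiPeriodic ((T.kernelMat m) 1 0) T.kernelSign) :
    ∑ i, T.lmul (m + 1) i (T.syz m f i) = 0 := by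
  have hc := T.deg_pos
  have hgs : 0 < (T.g * T.mutation) 1 0 := by rw [g_mul_mutation_deg]; positivity
  have e0 : T.g * T.mutation * T.kernelMat m = T.g ^ (m + 2) := by
    rw [mul_assoc, mutation_mul_kernelMat, ← _root_.pow_succ']
  have hgsX : 0 < (T.g * T.mutation * T.kernelMat m) 1 0 := by
    rw [e0]; exact (T.pow_pos (m + 1)).1
  obtain ⟨C, -, hC⟩ := quasiPeriodic_bounded (T.kernelMat_deg_pos m) T.norm_kernelSign hf
  have hassoc : ∀ i, T.lmul (m + 1) i (T.syz m f i) =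
      twMul (T.g * T.mutation) (T.kernelMat m) T.τ ((T.g ^ (m + 2)) 1 0 * (-T.g 1 0 / 2))
        (twMul T.g T.mutation T.τ (-(T.g 1 0 * (-T.g 1 0 / 2)))
          (fun k => T.delta i k * T.kernelSign ^ (-(T.mutation 0 1 * k)))
          (T.signDelta (T.g 1 1 * idx i))) f := by
    intro i
    have := twMul_assoc hc T.mutation_pos (T.kernelMat_deg_pos m) hgs (T.mutation_mul_pos m)
      hgsX T.im_neg (T.norm_delta_le i) (T.norm_signDelta_le (T.g 1 1 * idx i))
      T.norm_kernelSign hf 0 (-T.g 1 0 / 2)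
    rw [e0, T.mutation_mul_kernelMat, mul_zero, mul_zero, zero_sub, mul_zero, sub_zero] at this
    rw [this]
    rfl
  have hP : ∀ i, ∃ D : ℝ, ∀ k, ‖twMul T.g T.mutation T.τ (-(T.g 1 0 * (-T.g 1 0 / 2)))
      (fun k => T.delta i k * T.kernelSign ^ (-(T.mutation 0 1 * k)))
      (T.signDelta (T.g 1 1 * idx i)) k‖ ≤ D := by
    intro i
    have h1 : (fun k => T.delta i k * T.kernelSign ^ (-(T.mutation 0 1 * k))) ∈
        quasiPeriodic (T.g 1 0) (T.kernelSign ^ (-(T.mutation 0 1 * T.g 1 0))) := by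
      intro k
      have h0 : T.delta i (k + T.g 1 0) = 1 * T.delta i k := T.delta_mem i k
      change T.delta i (k + T.g 1 0) * T.kernelSign ^ (-(T.mutation 0 1 * (k + T.g 1 0))) =
        _ * (T.delta i k * T.kernelSign ^ (-(T.mutation 0 1 * k)))
      rw [h0, mul_add, neg_add, zpow_add₀ T.kernelSign_ne_zero]
      ring
    have h2 := twMul_mem (τ := T.τ) (g₁ := T.g) (g₂ := T.mutation)
      (δ := -(T.g 1 0 * (-T.g 1 0 / 2))) (zpow_ne_zero _ (zpow_ne_zero _ (by norm_num))) h1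
      (T.signDelta_mem (T.g 1 1 * idx i))
    obtain ⟨D, -, hD⟩ := quasiPeriodic_bounded hgs (by
      simp only [norm_mul, norm_zpow, norm_kernelSign, norm_neg, norm_one, one_zpow, one_mul]) h2
    exact ⟨D, hD⟩
  choose D hD using hP
  have hsum : ∀ s : Finset (Fin T.deg), (∃ E : ℝ, ∀ k, ‖(∑ i ∈ s, twMul T.g T.mutation T.τ
      (-(T.g 1 0 * (-T.g 1 0 / 2))) (fun k => T.delta i k * T.kernelSign ^ (-(T.mutation 0 1 * k)))
      (T.signDelta (T.g 1 1 * idx i))) k‖ ≤ E) ∧ ∑ i ∈ s, T.lmul (m + 1) i (T.syz m f i) =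
      twMul (T.g * T.mutation) (T.kernelMat m) T.τ ((T.g ^ (m + 2)) 1 0 * (-T.g 1 0 / 2))
        (∑ i ∈ s, twMul T.g T.mutation T.τ (-(T.g 1 0 * (-T.g 1 0 / 2)))
          (fun k => T.delta i k * T.kernelSign ^ (-(T.mutation 0 1 * k)))
          (T.signDelta (T.g 1 1 * idx i))) f := by
    intro s
    induction s using Finset.induction_on with
    | empty =>
      refine ⟨⟨0, by simp⟩, ?_⟩
      funext γ
      simp [twMul]
    | insert j s hj ih =>
      obtain ⟨⟨E, hE⟩, ih⟩ := ih
      rw [Finset.sum_insert hj, Finset.sum_insert hj, ih, hassoc,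
        twMul_add_left hgs (T.kernelMat_deg_pos m) hgsX T.im_neg (hD j) hE hC]
      exact ⟨⟨D j + E, fun k => (norm_add_le _ _).trans (add_le_add (hD j k) (hE k))⟩, rfl⟩
  rw [(hsum Finset.univ).2, sum_twMul_delta_signDelta]
  funext γ
  simp [twMul]

/-- The syzygies as a linear map on the sections of the mutated module. -/
def syzHom (m : ℕ) : quasiPeriodic ((T.kernelMat m) 1 0) T.kernelSign →ₗ[ℂ]
    (Fin T.deg → quasiPeriodic ((T.g ^ (m + 1)) 1 0) 1) where
  toFun f i := ⟨T.syz m f i, T.syz_mem f.2 i⟩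
  map_add' f f' := by
    funext i
    obtain ⟨C, -, hC⟩ := quasiPeriodic_bounded (T.kernelMat_deg_pos m) T.norm_kernelSign f.2
    obtain ⟨C', -, hC'⟩ := quasiPeriodic_bounded (T.kernelMat_deg_pos m) T.norm_kernelSign f'.2
    exact Subtype.ext (twMul_add_right T.mutation_pos (T.kernelMat_deg_pos m)
      (T.mutation_mul_pos m) T.im_neg (T.norm_signDelta_le _) hC hC' _)
  map_smul' z f := by
    funext i
    exact Subtype.ext (twMul_smul_right _ _ _ _ _ _ _)

lemma syzHom_injective (m : ℕ) : Function.Injective (T.syzHom m) := by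
  rw [injective_iff_map_eq_zero]
  intro f hf
  apply Subtype.ext
  funext y
  have hlt : (T.kernelMat m) 1 0 < T.mutation 1 0 * (T.mutation * T.kernelMat m) 1 0 := by
    rw [mutation_mul_kernelMat, mutation_10, kernelMat_deg]
    have : 0 < (T.g ^ (m + 2)) 1 0 := (T.pow_pos (m + 1)).1
    omega
  refine eq_zero_of_twMul_eq_zero T.mutation_pos (T.kernelMat_deg_pos m) (T.mutation_mul_pos m)
    hlt T.im_neg T.norm_kernelSign (norm_neg_one_zpow (T.g 1 0 - T.g 0 0))
    ((T.g ^ (m + 1)) 1 0 * (-T.g 1 0 / 2)) f.2 (fun k l => ?_) y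
  -- `d` is invertible modulo `c`
  obtain ⟨i, hi⟩ := T.exists_dvd_sub_idx (T.g 0 0 * k)
  have h1 : (fun κ => if T.mutation 1 0 ∣ κ - k then ((-1 : ℂ) ^ (T.g 1 0 - T.g 0 0)) ^ κ else 0) =
      T.signDelta (T.g 1 1 * idx i) := by
    funext κ
    rw [signDelta, mutation_10]
    have hd := sl_det T.g
    have e : κ - T.g 1 1 * idx i = (κ - k) + (T.g 1 1 * (T.g 0 0 * k - idx i) -
        T.g 1 0 * (T.g 0 1 * k)) := by linear_combination -k * hd
    have hdvd : T.g 1 0 ∣ T.g 1 1 * (T.g 0 0 * k - idx i) - T.g 1 0 * (T.g 0 1 * k) :=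
      dvd_sub (hi.mul_left _) (dvd_mul_right _ _)
    simp only [e, dvd_add_left hdvd]
  rw [h1]
  exact congrFun (congrArg Subtype.val (congrFun hf i)) l

lemma finrank_quasiPeriodic {c : ℤ} (hc : 0 < c) {η : ℂ} (hη : η ≠ 0) :
    (Module.finrank ℂ (quasiPeriodic c η) : ℤ) = c ∧ Module.Finite ℂ (quasiPeriodic c η) := by
  obtain ⟨n, rfl⟩ := Int.eq_ofNat_of_zero_le hc.le
  have : NeZero n := ⟨by omega⟩
  have e := quasiPeriodicEquiv n hη
  refine ⟨?_, Module.Finite.equiv e.symm⟩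
  have := e.finrank_eq
  rw [Module.finrank_fin_fun] at this
  exact congrArg Nat.cast this

/-- Every syzygy comes from the mutated module, by a comparison of dimensions. -/
lemma range_syzHom (m : ℕ) : LinearMap.range (T.syzHom m) = LinearMap.ker (T.mulHom m) := by
  obtain ⟨d1, f1⟩ := finrank_quasiPeriodic (T.kernelMat_deg_pos m) T.kernelSign_ne_zero
  obtain ⟨d2, f2⟩ := finrank_quasiPeriodic (T.pow_pos m).1 (one_ne_zero (α := ℂ))
  obtain ⟨d3, f3⟩ := finrank_quasiPeriodic (T.pow_pos (m + 1)).1 (one_ne_zero (α := ℂ))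
  refine Submodule.eq_of_le_of_finrank_eq ?_ ?_
  · rintro _ ⟨f, rfl⟩
    rw [LinearMap.mem_ker]
    apply Subtype.ext
    rw [mulHom_apply]
    exact T.sum_lmul_syz f.2
  · rw [LinearMap.finrank_range_of_inj (T.syzHom_injective m)]
    have h := (T.mulHom m).finrank_range_add_finrank_ker
    rw [LinearMap.range_eq_top.2 (T.mulHom_surjective m), finrank_top,
      Module.finrank_pi_fintype, Finset.sum_const, Finset.card_univ, Fintype.card_fin,
      smul_eq_mul] at h
    have h2 := T.kernelMat_deg m
    have h3 := T.deg_cast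
    zify at h ⊢
    rw [d2, d3, h3] at h
    rw [d1, h2]
    change (T.g ^ (m + 2)) 1 0 + _ = _ at h
    omega

/-- Syzygies in higher degrees are compatible with products from the right. -/
lemma syz_twMul {m : ℕ} {f z : ℤ → ℂ}
    (hf : f ∈ quasiPeriodic ((T.kernelMat 0) 1 0) T.kernelSign)
    (hz : z ∈ quasiPeriodic ((T.g ^ (m + 1)) 1 0) 1) (i : Fin T.deg) :
    T.syz (m + 1) (twMul (T.kernelMat 0) (T.g ^ (m + 1)) T.τ
      (-((T.g ^ (m + 1)) 1 0 * (-T.g 1 0 / 2))) f z) i =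
    ∑ j, T.syz 0 f i (idx j) • T.lmul (m + 1) j z := by
  obtain ⟨C, -, hC⟩ := quasiPeriodic_bounded (T.kernelMat_deg_pos 0) T.norm_kernelSign hf
  have e1 : T.mutation * T.kernelMat 0 = T.g := by
    rw [mutation_mul_kernelMat, zero_add, _root_.pow_one]
  have hmem := T.syz_mem hf i
  rw [zero_add, _root_.pow_one] at hmem
  rw [← T.sum_smul_lmul hmem hz]
  have := twMul_assoc T.mutation_pos (T.kernelMat_deg_pos 0) (T.pow_pos m).1
    (T.mutation_mul_pos 0) (by rw [T.kernelMat_zero_mul]; exact T.kernelMat_deg_pos _)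
    (by rw [e1]; exact T.pow_deg_mul_pos (m + 1)) T.im_neg
    (T.norm_signDelta_le (T.g 1 1 * idx i)) hC (η := 1) norm_one hz (-T.g 1 0 / 2) 0
  rw [e1, T.kernelMat_zero_mul, ← _root_.pow_succ', mul_zero, mul_zero, mul_zero, zero_sub,
    sub_zero] at this
  simp only [one_zpow, mul_one] at this
  rw [syz, ← this, syz, zero_add, _root_.pow_one]

/-- Every syzygy in degree at least three is a consequence of quadratic relations. -/
theorem mem_span_of_mulHom_eq_zero (m : ℕ)
    {w : Fin T.deg → quasiPeriodic ((T.g ^ (m + 2)) 1 0) 1} (hw : T.mulHom (m + 1) w = 0) :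
    w ∈ Submodule.span ℂ {w' | ∃ (r : Fin T.deg → Fin T.deg → ℂ)
      (z : quasiPeriodic ((T.g ^ (m + 1)) 1 0) 1),
      ∑ i, ∑ j, r i j • T.lmul 1 i (T.delta j) = 0 ∧
        w' = fun i => ∑ j, r i j • T.lmulHom m j z} := by
  obtain ⟨f, rfl⟩ : w ∈ LinearMap.range (T.syzHom (m + 1)) := by rw [range_syzHom]; exact hw
  have hlt := T.kernelMat_deg_lt m
  have hX : 0 < (T.kernelMat 0 * T.g ^ (m + 1)) 1 0 := by
    rw [T.kernelMat_zero_mul]; exact T.kernelMat_deg_pos _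
  have hf : f.1 ∈ quasiPeriodic ((T.kernelMat 0 * T.g ^ (m + 1)) 1 0) T.kernelSign := by
    rw [T.kernelMat_zero_mul]; exact f.2
  rw [← T.kernelMat_zero_mul] at hlt
  have h := mem_span_twMul (T.kernelMat_deg_pos 0) (T.pow_pos m).1 hX hlt T.im_neg
    T.norm_kernelSign (-((T.g ^ (m + 1)) 1 0 * (-T.g 1 0 / 2))) hf
  set S := Submodule.span ℂ {w' : Fin T.deg → quasiPeriodic ((T.g ^ (m + 2)) 1 0) 1 |
    ∃ (r : Fin T.deg → Fin T.deg → ℂ) (z : quasiPeriodic ((T.g ^ (m + 1)) 1 0) 1),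
      ∑ i, ∑ j, r i j • T.lmul 1 i (T.delta j) = 0 ∧ w' = fun i => ∑ j, r i j • T.lmulHom m j z}
  have h2 : Submodule.span ℂ {w | ∃ u ∈ quasiPeriodic ((T.kernelMat 0) 1 0) T.kernelSign,
      ∃ v ∈ quasiPeriodic ((T.g ^ (m + 1)) 1 0) 1,
      w = twMul (T.kernelMat 0) (T.g ^ (m + 1)) T.τ (-((T.g ^ (m + 1)) 1 0 * (-T.g 1 0 / 2))) u v} ≤
      (S.comap (T.syzHom (m + 1))).map (Submodule.subtype _) := by
    rw [Submodule.span_le]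
    rintro _ ⟨u, hu, z, hz, rfl⟩
    have hmem := twMul_mem (τ := T.τ) (δ := -((T.g ^ (m + 1)) 1 0 * (-T.g 1 0 / 2)))
      one_ne_zero hu hz
    rw [one_zpow, mul_one, T.kernelMat_zero_mul] at hmem
    refine ⟨⟨_, hmem⟩, Submodule.subset_span
      ⟨fun i j => T.syz 0 u i (idx j), ⟨z, hz⟩, ?_, ?_⟩, rfl⟩
    · rw [← T.sum_lmul_syz hu]
      refine Finset.sum_congr rfl fun i _ => ?_
      have hs := T.syz_mem hu i
      have h1 : (⟨_, hs⟩ : quasiPeriodic ((T.g ^ (0 + 1)) 1 0) 1) =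
          ∑ j, T.syz 0 u i (idx j) • ⟨T.delta j, by
            rw [zero_add, _root_.pow_one]; exact T.delta_mem j⟩ := by
        apply Subtype.ext
        rw [Submodule.coe_sum]
        rw [zero_add, _root_.pow_one] at hs
        exact (T.sum_smul_delta hs).symm
      have h2 := congrArg Subtype.val (congrArg (T.lmulHom 0 i) h1)
      rw [map_sum, Submodule.coe_sum] at h2
      refine Eq.trans ?_ h2.symm
      refine Finset.sum_congr rfl fun j _ => ?_
      rw [map_smul]
      rfl
    · funext i
      apply Subtype.ext
      rw [Submodule.coe_sum]
      exact T.syz_twMul hu hz i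
  obtain ⟨f', hf', hff⟩ := h2 h
  have : f' = f := Subtype.ext hff
  rwa [this] at hf'

end RMTorus

namespace RMTorus

variable (T : RMTorus)

/-! ### The matrices of theta constants -/

lemma tr_pos : 0 < T.tr := by
  have h1 := T.tr_cast
  have h2 := T.hyperbolic
  omega

lemma deg_castC : (T.deg : ℂ) = T.g 1 0 := by exact_mod_cast T.deg_cast

lemma mul_self_deg : (T.g * T.g) 1 0 = T.deg * T.tr := by
  rw [sl_mul10, T.deg_cast, T.tr_cast]; ring

lemma dvd_idx_alpha (μ j : Fin T.deg) : T.g 1 0 ∣ T.g 1 1 * (idx μ - idx j) - idx (T.α μ j) := by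
  have hc := T.deg_pos
  have h1 := Int.emod_nonneg (T.g 1 1 * (idx μ - idx j) - 1) hc.ne'
  have h2 := Int.emod_add_mul_ediv (T.g 1 1 * (idx μ - idx j) - 1) (T.g 1 0)
  have h3 : idx (T.α μ j) = (T.g 1 1 * (idx μ - idx j) - 1) % T.g 1 0 + 1 := by
    change (((T.g 1 1 * (idx μ - idx j) - 1) % T.deg).toNat : ℤ) + 1 = _
    rw [T.deg_cast, Int.toNat_of_nonneg h1]
  exact ⟨(T.g 1 1 * (idx μ - idx j) - 1) / T.g 1 0, by rw [h3]; linarith⟩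

lemma alpha_bijective (j : Fin T.deg) : Function.Bijective fun μ => T.α μ j := by
  refine Finite.injective_iff_bijective.1 fun μ ν h => T.eq_of_dvd_idx_sub_idx ?_
  have h1 := dvd_sub (T.dvd_idx_alpha μ j) (T.dvd_idx_alpha ν j)
  change T.α μ j = T.α ν j at h
  rw [h] at h1
  have e : idx μ - idx ν = T.g 0 0 * (T.g 1 1 * (idx μ - idx j) - idx (T.α ν j) -
      (T.g 1 1 * (idx ν - idx j) - idx (T.α ν j))) - T.g 1 0 * (T.g 0 1 * (idx μ - idx ν)) := by
    linear_combination -(idx μ - idx ν) * sl_det T.g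
  rw [e]
  exact dvd_sub (h1.mul_left _) (dvd_mul_right _ _)

/-- The theta constants are the structure constants of the multiplication in degree two. -/
lemma M_eq_tsum (μ j : Fin T.deg) (i : Fin T.tr) :
    T.M μ i j = ∑' n : ℤ, twTerm T.g T.g T.τ 0 (idx μ + T.g 1 0 * (i : ℕ))
      (T.g 1 1 * (idx μ - idx j) + T.g 1 0 * n) := by
  have hc : (T.deg : ℂ) ≠ 0 := by
    rw [T.deg_castC]; exact_mod_cast T.deg_pos.ne'
  have ht : (T.tr : ℂ) ≠ 0 := by exact_mod_cast T.tr_pos.ne'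
  rw [M, Matrix.of_apply, thetaConst, thetaChar]
  refine tsum_congr fun n => ?_
  rw [twTerm, mul_self_deg]
  congr 1
  simp only [q, Λ, tauPrime]
  have hi : idx i = (i : ℕ) + 1 := rfl
  rw [hi]
  push_cast
  rw [← T.deg_castC]
  field_simp
  ring

/-- The products `φ_i φ_j` of degree two are supported on the residue class of the `μ` with
`i = α(μ, j)`. -/
lemma lmul_one_delta_apply (μ : Fin T.deg) (n : ℤ) (i j : Fin T.deg) :
    T.lmul 1 i (T.delta j) (idx μ + T.g 1 0 * n) = if i = T.α μ j then
      ∑' m : ℤ, twTerm T.g T.g T.τ 0 (idx μ + T.g 1 0 * n)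
        (T.g 1 1 * (idx μ - idx j) + T.g 1 0 * m) else 0 := by
  have hd := sl_det T.g
  have hα := T.dvd_idx_alpha μ j
  rw [lmul, _root_.pow_one, twMul]
  have hiff : ∀ k : ℤ, T.g 1 0 ∣ idx μ + T.g 1 0 * n - T.g 0 0 * k - idx j ↔
      T.g 1 0 ∣ k - T.g 1 1 * (idx μ - idx j) := by
    intro k
    constructor
    · intro h
      have e : k - T.g 1 1 * (idx μ - idx j) = -(T.g 1 1 * (idx μ + T.g 1 0 * n - T.g 0 0 * k -
          idx j)) + T.g 1 0 * (T.g 1 1 * n - T.g 0 1 * k) := by linear_combination -k * hd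
      rw [e]
      exact dvd_add (dvd_neg.2 (h.mul_left _)) (dvd_mul_right _ _)
    · intro h
      have e : idx μ + T.g 1 0 * n - T.g 0 0 * k - idx j =
          -(T.g 0 0 * (k - T.g 1 1 * (idx μ - idx j))) +
            T.g 1 0 * (n - T.g 0 1 * (idx μ - idx j)) := by
        linear_combination -(idx μ - idx j) * hd
      rw [e]
      exact dvd_add (dvd_neg.2 (h.mul_left _)) (dvd_mul_right _ _)
  split_ifs with hi
  · rw [tsum_progression T.deg_pos.ne' (T.g 1 1 * (idx μ - idx j))]
    · refine tsum_congr fun m => ?_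
      have h1 : T.g 1 0 ∣ T.g 1 1 * (idx μ - idx j) + T.g 1 0 * m - idx i := by
        rw [hi, add_sub_right_comm]
        exact dvd_add hα (dvd_mul_right _ _)
      rw [delta_apply, delta_apply, if_pos h1, if_pos ((hiff _).2 (by simp)), one_mul, one_mul]
    · intro κ hκ
      rw [T.delta_apply j, if_neg (mt (hiff κ).1 hκ), mul_zero, zero_mul]
  · convert tsum_zero with k
    rw [delta_apply, delta_apply]
    split_ifs with h1 h2
    · exfalso
      refine hi (T.eq_of_dvd_idx_sub_idx ?_)
      have e : idx i - idx (T.α μ j) = -(k - idx i) + (k - T.g 1 1 * (idx μ - idx j)) +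
        (T.g 1 1 * (idx μ - idx j) - idx (T.α μ j)) := by ring
      rw [e]
      exact dvd_add (dvd_add (dvd_neg.2 h1) ((hiff k).1 h2)) hα
    all_goals simp

/-- A linear combination of the rows of `M(μ)` is a Gaussian sum, evaluated at one point for each
column. -/
lemma sum_mul_M (μ j : Fin T.deg) [NeZero T.tr] (D : Fin T.tr → ℂ) :
    ∑ i, D i * T.M μ i j = ∑' γ : ℤ, ((quasiPeriodicEquiv T.tr one_ne_zero).symm D).1 γ *
      Complex.exp (-(Real.pi * Complex.I * T.τ * T.g 1 0 * (1 : ℤ) / (T.tr : ℤ)) *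
        ((γ : ℂ) + (((idx μ - T.g 1 1 * T.tr * (idx μ - idx j)) / T.deg : ℝ) : ℂ)) ^ 2) := by
  have hc : (T.deg : ℂ) ≠ 0 := by
    rw [T.deg_castC]; exact_mod_cast T.deg_pos.ne'
  have ht : (T.tr : ℂ) ≠ 0 := by exact_mod_cast T.tr_pos.ne'
  have hB := re_gauss_coeff_pos (τ := T.τ) T.deg_pos one_pos
    (by exact_mod_cast T.tr_pos : (0 : ℤ) < T.tr) T.im_neg
  set D' := (quasiPeriodicEquiv T.tr one_ne_zero).symm D
  have hD' : ∀ i : Fin T.tr, D'.1 (i : ℕ) = D i := fun i =>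
    congrFun ((quasiPeriodicEquiv T.tr one_ne_zero).apply_symm_apply D) i
  obtain ⟨C, -, hC⟩ := quasiPeriodic_bounded (by exact_mod_cast T.tr_pos : (0 : ℤ) < T.tr)
    norm_one D'.2
  rw [tsum_int_eq_sum_fin _ T.tr]
  · refine Finset.sum_congr rfl fun i _ => ?_
    rw [M_eq_tsum, ← tsum_mul_left]
    refine tsum_congr fun n => ?_
    have h1 := quasiPeriodic_mul_int one_ne_zero D'.2 (i : ℕ) (-n)
    rw [one_zpow, one_mul, mul_neg, ← sub_eq_add_neg] at h1
    rw [h1, hD', twTerm, mul_self_deg]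
    congr 2
    push_cast
    rw [← T.deg_castC]
    field_simp
    ring
  · refine Summable.of_norm_bounded ((summable_gauss hB one_ne_zero
      ((idx μ - T.g 1 1 * T.tr * (idx μ - idx j)) / T.deg : ℝ)).mul_left C) fun γ => ?_
    rw [norm_mul]
    have := norm_gauss (Real.pi * Complex.I * T.τ * T.g 1 0 * (1 : ℤ) / (T.tr : ℤ))
      (γ + ((idx μ - T.g 1 1 * T.tr * (idx μ - idx j)) / T.deg : ℝ))
    rw [Complex.ofReal_add, Complex.ofReal_intCast] at this
    rw [this, one_mul]
    exact mul_le_mul_of_nonneg_right (hC γ) (Real.exp_pos _).le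

/-- The rows of a submatrix of `M(μ)` are independent if it has more than `a + d` columns, or
exactly `a + d` columns and `a + d` is odd. -/
lemma eq_zero_of_sum_mul_M (μ : Fin T.deg) (js : List (Fin T.deg)) (hjs : js.Nodup)
    (hlen : T.tr < js.length ∨ T.tr = js.length ∧ Odd T.tr) (D : Fin T.tr → ℂ)
    (hD : ∀ j ∈ js, ∑ i, D i * T.M μ i j = 0) : D = 0 := by
  have : NeZero T.tr := ⟨T.tr_pos.ne'⟩
  have hB := re_gauss_coeff_pos (τ := T.τ) T.deg_pos one_pos
    (by exact_mod_cast T.tr_pos : (0 : ℤ) < T.tr) T.im_neg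
  have hdet := sl_det T.g
  have htr : (T.tr : ℝ) ≠ 0 := by exact_mod_cast T.tr_pos.ne'
  have hdr : (T.deg : ℝ) ≠ 0 := by
    have : T.deg ≠ 0 := by have := T.tr_add_two_le_deg; omega
    exact_mod_cast this
  set D' := (quasiPeriodicEquiv T.tr one_ne_zero).symm D with hD'
  have key := eq_zero_of_gaussSum_zeros hB T.tr_pos norm_one D'.2
    (js.map fun j => ((idx μ - T.g 1 1 * T.tr * (idx μ - idx j)) / T.deg : ℝ)) (by
      rw [List.pairwise_map]
      refine hjs.imp fun {j j'} hne k hk => hne ?_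
      refine (T.eq_of_dvd_idx_sub_idx ?_).symm
      have h1 : (T.g 1 1 : ℝ) * (idx j' - idx j) = T.deg * k := by
        field_simp at hk
        apply mul_left_cancel₀ htr
        linear_combination hk
      have h2 : T.g 1 1 * (idx j' - idx j) = T.g 1 0 * k := by
        rw [← T.deg_cast]; exact_mod_cast h1
      exact ⟨T.g 0 0 * k - T.g 0 1 * (idx j' - idx j), by
        linear_combination T.g 0 0 * h2 - (idx j' - idx j) * hdet⟩)
    (by
      intro x hx
      obtain ⟨j, hj, rfl⟩ := List.mem_map.1 hx
      rw [← T.sum_mul_M μ j D]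
      exact hD j hj)
    (by simpa using hlen)
  have h0 : D' = 0 := Subtype.ext (funext key)
  rw [hD'] at h0
  exact (LinearEquiv.map_eq_zero_iff _).1 h0

lemma firstCol_injective : Function.Injective T.firstCol := fun _ _ h => Fin.castLE_injective _ h

/-- For odd `a + d` any `a + d` columns are independent, in particular the first ones. -/
lemma F_firstCol_ne_zero (hodd : Odd T.tr) (μ : Fin T.deg) : T.F μ T.firstCol ≠ 0 := by
  intro h
  obtain ⟨D, hD0, hD⟩ := Matrix.exists_vecMul_eq_zero_iff.2 h
  refine hD0 (T.eq_zero_of_sum_mul_M μ ((List.finRange T.tr).map T.firstCol)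
    ((List.nodup_finRange _).map T.firstCol_injective) (Or.inr ⟨by simp, hodd⟩) D fun j hj => ?_)
  obtain ⟨i, -, rfl⟩ := List.mem_map.1 hj
  exact congrFun hD i

/-- The matrix `M(μ)` has rank `a + d`. -/
lemma exists_perm_F_ne_zero (μ : Fin T.deg) :
    ∃ σ : Equiv.Perm (Fin T.deg), T.F μ (fun i => σ (T.firstCol i)) ≠ 0 := by
  obtain ⟨κ, a, ha, hspan, hli⟩ := exists_linearIndependent' ℂ (T.M μ).col
  -- otherwise a functional gives a row combination that vanishes on all `c > a + d` columns
  have htop : Submodule.span ℂ (Set.range (T.M μ).col) = ⊤ := by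
    by_contra hne
    obtain ⟨f, hf0, hf⟩ := Submodule.exists_le_ker_of_lt_top _ (lt_top_iff_ne_top.2 hne)
    have hfs : ∀ u : Fin T.tr → ℂ, f u = ∑ i, f (Pi.single i 1) * u i := by
      intro u
      conv_lhs => rw [pi_eq_sum_univ' u]
      rw [map_sum]
      refine Finset.sum_congr rfl fun i _ => ?_
      rw [map_smul, smul_eq_mul, mul_comm]
    have h := T.eq_zero_of_sum_mul_M μ (List.finRange T.deg) (List.nodup_finRange _)
      (Or.inl (by have := T.tr_add_two_le_deg; simp; omega)) (fun i => f (Pi.single i 1))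
      (fun j _ => by
        have h1 : f ((T.M μ).col j) = 0 := hf (Submodule.subset_span ⟨j, rfl⟩)
        rw [hfs] at h1
        exact h1)
    apply hf0
    ext i
    simpa using congrFun h i
  rw [htop] at hspan
  have b : Module.Basis κ ℂ (Fin T.tr → ℂ) := Module.Basis.mk hli hspan.ge
  have : Finite κ := Finite.of_injective a ha
  have : Fintype κ := Fintype.ofFinite κ
  have hcard : Fintype.card κ = T.tr := by
    rw [← Module.finrank_eq_card_basis b, Module.finrank_fin_fun]
  let e : Fin T.tr ≃ κ := (Fintype.equivFinOfCardEq hcard).symm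
  let s : Fin T.tr → Fin T.deg := a ∘ e
  have hs : Function.Injective s := ha.comp e.injective
  let e' : Set.range T.firstCol ≃ Set.range s :=
    (Equiv.ofInjective _ T.firstCol_injective).symm.trans (Equiv.ofInjective _ hs)
  refine ⟨e'.extendSubtype, ?_⟩
  have hse : (fun i => e'.extendSubtype (T.firstCol i)) = s := by
    funext i
    rw [Equiv.extendSubtype_apply_of_mem e' _ ⟨i, rfl⟩]
    simp only [e', Equiv.trans_apply]
    have : (⟨T.firstCol i, ⟨i, rfl⟩⟩ : Set.range T.firstCol) =
      Equiv.ofInjective _ T.firstCol_injective i := rfl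
    rw [this, Equiv.symm_apply_apply]
    rfl
  rw [hse]
  have h1 : LinearIndependent ℂ ((T.M μ).submatrix id s).col :=
    (hli.comp e e.injective)
  exact ((Matrix.isUnit_iff_isUnit_det _).1
    (Matrix.linearIndependent_cols_iff_isUnit.1 h1)).ne_zero

/-! ### The kernel of the matrix of theta constants -/

/-- The columns, divided into the first `a + d` ones and the others. -/
def colEquiv : Fin T.tr ⊕ Fin (T.deg - T.tr) ≃ Fin T.deg :=
  finSumFinEquiv.trans (finCongr (by have := T.tr_add_two_le_deg; omega))

lemma sum_columns {A : Type*} [AddCommMonoid A] (σ : Equiv.Perm (Fin T.deg)) (f : Fin T.deg → A) :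
    ∑ j, f j = ∑ j, f (σ (T.firstCol j)) + ∑ k, f (σ (T.laterCol k)) := by
  rw [← (T.colEquiv.trans σ).sum_comp, Fintype.sum_sum_type]
  rfl

lemma v_firstCol (μ : Fin T.deg) (σ : Equiv.Perm (Fin T.deg)) (k : Fin (T.deg - T.tr))
    (j : Fin T.tr) : T.v μ σ k (σ (T.firstCol j)) =
      T.F μ (Function.update (fun i => σ (T.firstCol i)) j (σ (T.laterCol k))) := by
  have h : ((T.firstCol j : Fin T.deg) : ℕ) < T.tr := j.2
  simp only [v, Equiv.symm_apply_apply, dif_pos h]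
  rfl

lemma v_laterCol (μ : Fin T.deg) (σ : Equiv.Perm (Fin T.deg)) (k k' : Fin (T.deg - T.tr)) :
    T.v μ σ k (σ (T.laterCol k')) = if k' = k then -T.F μ fun i => σ (T.firstCol i) else 0 := by
  have h : ¬((T.laterCol k' : Fin T.deg) : ℕ) < T.tr := by simp [laterCol]
  have h2 : T.laterCol k' = T.laterCol k ↔ k' = k := by simp [laterCol, Fin.ext_iff]
  simp only [v, Equiv.symm_apply_apply, dif_neg h, EmbeddingLike.apply_eq_iff_eq, h2]

/-- Cramer's rule. -/
lemma M_mulVec_v (μ : Fin T.deg) (σ : Equiv.Perm (Fin T.deg)) (k : Fin (T.deg - T.tr))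
    (i : Fin T.tr) : ∑ j, T.v μ σ k j * T.M μ i j = 0 := by
  let A := (T.M μ).submatrix id fun i => σ (T.firstCol i)
  let b : Fin T.tr → ℂ := fun i => T.M μ i (σ (T.laterCol k))
  have hup : ∀ j, A.updateCol j b = (T.M μ).submatrix id
      (Function.update (fun i => σ (T.firstCol i)) j (σ (T.laterCol k))) := by
    intro j
    ext p r
    simp only [Matrix.updateCol_apply, Matrix.submatrix_apply, Function.update_apply, A, b, id]
    split_ifs <;> rfl
  have h := congrFun (Matrix.mulVec_cramer A b) i
  rw [T.sum_columns σ, Finset.sum_eq_single k]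
  · rw [v_laterCol, if_pos rfl]
    have h1 : ∑ j, T.v μ σ k (σ (T.firstCol j)) * T.M μ i (σ (T.firstCol j)) =
        A.det * T.M μ i (σ (T.laterCol k)) := by
      rw [Pi.smul_apply, smul_eq_mul] at h
      rw [← h, Matrix.mulVec, dotProduct]
      refine Finset.sum_congr rfl fun j _ => ?_
      rw [v_firstCol, Matrix.cramer_apply, hup, mul_comm]
      rfl
    rw [h1, F, neg_mul]
    exact add_neg_cancel _
  · intro k' _ hk
    rw [v_laterCol, if_neg hk, zero_mul]
  · simp

/-- The vectors `v^{μ,k}` span the kernel of `M(μ)`. -/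
lemma exists_eq_sum_smul_v {μ : Fin T.deg} {σ : Equiv.Perm (Fin T.deg)}
    (hF : T.F μ (fun i => σ (T.firstCol i)) ≠ 0) {w : Fin T.deg → ℂ}
    (hw : ∀ i, ∑ j, w j * T.M μ i j = 0) : ∃ l : Fin (T.deg - T.tr) → ℂ,
      ∀ j, w j = ∑ k, l k * T.v μ σ k j := by
  -- the entries of `v^{μ,k}` at the later columns form a multiple of the unit vector
  let l : Fin (T.deg - T.tr) → ℂ := fun k =>
    -w (σ (T.laterCol k)) / T.F μ fun i => σ (T.firstCol i)
  refine ⟨l, fun j => ?_⟩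
  let w' : Fin T.deg → ℂ := fun j => w j - ∑ k, l k * T.v μ σ k j
  have hlater : ∀ k, w' (σ (T.laterCol k)) = 0 := by
    intro k
    simp only [w', v_laterCol, mul_ite, mul_zero, Finset.sum_ite_eq, Finset.mem_univ, if_true, l]
    rw [div_mul_eq_mul_div, mul_neg, neg_mul, neg_neg, mul_div_cancel_right₀ _ hF, sub_self]
  have hw' : ∀ i, ∑ j, w' j * T.M μ i j = 0 := by
    intro i
    simp only [w', sub_mul, Finset.sum_sub_distrib, hw, zero_sub, neg_eq_zero, Finset.sum_mul]
    rw [Finset.sum_comm]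
    refine Finset.sum_eq_zero fun k _ => ?_
    simp only [mul_assoc]
    rw [← Finset.mul_sum, M_mulVec_v, mul_zero]
  have hfirst : (fun j => w' (σ (T.firstCol j))) = 0 := by
    by_contra hne
    refine hF (Matrix.exists_mulVec_eq_zero_iff.1 ⟨_, hne, ?_⟩)
    funext i
    have := hw' i
    rw [T.sum_columns σ] at this
    simp only [hlater, zero_mul, Finset.sum_const_zero, add_zero] at this
    rw [Matrix.mulVec, dotProduct, Pi.zero_apply, ← this]
    exact Finset.sum_congr rfl fun j _ => mul_comm _ _
  have h0 : w' j = 0 := by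
    obtain ⟨x, hx⟩ := (T.colEquiv.trans σ).surjective j
    rw [← hx]
    rcases x with x | x
    · exact congrFun hfirst x
    · exact hlater x
  exact sub_eq_zero.1 h0

/-! ### The quadratic relations -/

/-- The product of a tensor `∑ r_{ij} φ_i ⊗ φ_j` splits into the products of the vectors
`(r_{α(μ,j), j})_j` with the matrices `M(μ)`. -/
lemma sum_lmul_one_apply (r : Fin T.deg → Fin T.deg → ℂ) (μ : Fin T.deg) (i : Fin T.tr) :
    (∑ i', ∑ j, r i' j • T.lmul 1 i' (T.delta j)) (idx μ + T.g 1 0 * (i : ℕ)) =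
      ∑ j, r (T.α μ j) j * T.M μ i j := by
  rw [Finset.sum_comm, Finset.sum_apply]
  refine Finset.sum_congr rfl fun j _ => ?_
  rw [Finset.sum_apply, Finset.sum_eq_single (T.α μ j)]
  · rw [Pi.smul_apply, lmul_one_delta_apply, if_pos rfl, M_eq_tsum, smul_eq_mul]
  · intro i' _ hi'
    rw [Pi.smul_apply, lmul_one_delta_apply, if_neg hi', smul_zero]
  · simp

/-- The relations `f^μ_k` hold between the basis sections. -/
lemma sum_v_smul_lmul (μ : Fin T.deg) (σ : Equiv.Perm (Fin T.deg)) (k : Fin (T.deg - T.tr)) :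
    ∑ j, T.v μ σ k j • T.lmul 1 (T.α μ j) (T.delta j) = 0 := by
  have hmem : ∑ j, T.v μ σ k j • T.lmul 1 (T.α μ j) (T.delta j) ∈
      quasiPeriodic ((T.g ^ 2) 1 0) 1 := by
    refine Submodule.sum_mem _ fun j _ => Submodule.smul_mem _ _ (T.lmul_mem _ ?_)
    rw [_root_.pow_one]; exact T.delta_mem j
  rw [_root_.pow_two, mul_self_deg] at hmem
  funext γ
  obtain ⟨ν, n, hn⟩ := T.exists_dvd_sub_idx γ
  have hγ : γ = idx ν + T.g 1 0 * n := by omega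
  by_cases hν : ν = μ
  · subst hν
    have ht : (0 : ℤ) < T.tr := by exact_mod_cast T.tr_pos
    have h1 := Int.emod_nonneg n ht.ne'
    have h2 := Int.emod_lt_of_pos n ht
    have h3 : γ = idx ν + T.g 1 0 * (n % T.tr).toNat + T.deg * T.tr * (n / T.tr) := by
      rw [Int.toNat_of_nonneg h1, T.deg_cast, mul_assoc, add_assoc, ← mul_add,
        Int.emod_add_mul_ediv, hγ]
    rw [h3, quasiPeriodic_mul_int one_ne_zero hmem, one_zpow, one_mul, Finset.sum_apply,
      Pi.zero_apply, ← T.M_mulVec_v ν σ k ⟨(n % T.tr).toNat, by omega⟩]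
    refine Finset.sum_congr rfl fun j _ => ?_
    rw [Pi.smul_apply, lmul_one_delta_apply, if_pos rfl, M_eq_tsum, smul_eq_mul]
  · rw [Finset.sum_apply, Pi.zero_apply]
    refine Finset.sum_eq_zero fun j _ => ?_
    rw [hγ, Pi.smul_apply, lmul_one_delta_apply, if_neg, smul_zero]
    exact fun h => hν ((T.alpha_bijective j).1 h).symm

variable {σ : Fin T.deg → Equiv.Perm (Fin T.deg)}

lemma sum_v_smul_gen (μ : Fin T.deg) (k : Fin (T.deg - T.tr)) :
    ∑ j, T.v μ (σ μ) k j • (T.gen σ (T.α μ j) * T.gen σ j) = 0 := by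
  have h := RingQuot.mkAlgHom_rel ℂ (s := fun p r : FreeAlgebra ℂ (Fin T.deg) =>
    (∃ μ k, p = T.rel μ (σ μ) k) ∧ r = 0) ⟨⟨μ, k, rfl⟩, rfl⟩
  rw [rel, map_sum, map_zero] at h
  simp only [map_smul, map_mul] at h
  exact h

/-- Every quadratic relation between the basis sections follows from the `f^μ_k`. -/
lemma sum_smul_gen_eq_zero (hσ : ∀ μ, T.F μ (fun i => σ μ (T.firstCol i)) ≠ 0)
    {r : Fin T.deg → Fin T.deg → ℂ} (hr : ∑ i, ∑ j, r i j • T.lmul 1 i (T.delta j) = 0) :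
    ∑ i, ∑ j, r i j • (T.gen σ i * T.gen σ j) = 0 := by
  have h1 : ∀ μ, ∃ l : Fin (T.deg - T.tr) → ℂ, ∀ j,
      r (T.α μ j) j = ∑ k, l k * T.v μ (σ μ) k j := fun μ =>
    T.exists_eq_sum_smul_v (hσ μ) fun i => by rw [← sum_lmul_one_apply, hr]; rfl
  choose l hl using h1
  have h2 : ∑ i, ∑ j, r i j • (T.gen σ i * T.gen σ j) =
      ∑ μ, ∑ j, r (T.α μ j) j • (T.gen σ (T.α μ j) * T.gen σ j) := by
    rw [Finset.sum_comm]
    conv_rhs => rw [Finset.sum_comm]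
    refine Finset.sum_congr rfl fun j _ => ?_
    exact ((T.alpha_bijective j).sum_comp fun i => r i j • (T.gen σ i * T.gen σ j)).symm
  rw [h2]
  refine Finset.sum_eq_zero fun μ _ => ?_
  simp only [hl, Finset.sum_smul]
  rw [Finset.sum_comm]
  refine Finset.sum_eq_zero fun k _ => ?_
  simp only [mul_smul]
  rw [← Finset.smul_sum, sum_v_smul_gen, smul_zero]

end RMTorus

/-! ### The homogeneous coordinate ring in terms of sequences -/

/-- A linear map that intertwines the multiplications by generators intertwines the multiplications
by all elements of the free algebra. -/
lemma map_lift_mul_of_map_mul {A B ι : Type*} [Semiring A] [Algebra ℂ A] [Semiring B]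
    [Algebra ℂ B] {x : ι → B} {y : ι → A} (Ψ : B →ₗ[ℂ] A) (h : ∀ i b, Ψ (x i * b) = y i * Ψ b)
    (p : FreeAlgebra ℂ ι) (b : B) :
    Ψ (FreeAlgebra.lift ℂ x p * b) = FreeAlgebra.lift ℂ y p * Ψ b := by
  induction p using FreeAlgebra.induction generalizing b with
  | grade0 z =>
    rw [AlgHom.commutes, AlgHom.commutes, ← Algebra.smul_def, ← Algebra.smul_def, map_smul]
  | grade1 i => rw [FreeAlgebra.lift_ι_apply, FreeAlgebra.lift_ι_apply, h]
  | mul p q hp hq => rw [map_mul (FreeAlgebra.lift ℂ x), mul_assoc, hp, hq, map_mul, mul_assoc]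
  | add p q hp hq => rw [map_add (FreeAlgebra.lift ℂ x), add_mul, map_add, hp, hq, map_add, add_mul]

namespace RMTorus

variable (T : RMTorus)

lemma gauss_mem_piece (n : ℕ) {u : ℤ → ℂ} (hu : u ∈ quasiPeriodic ((T.g ^ (n + 1)) 1 0) 1) :
    (fun α (x : ℝ) => u α * Complex.exp (-gaussExp (T.g ^ (n + 1)) T.θ T.τ * (x : ℂ) ^ 2)) ∈
      T.piece (n + 1) :=
  (mem_holSections_iff (T.pow_pos n).1 (T.pow_pos n).2 T.im_neg _).2
    ⟨u, fun α => by rw [hu α, one_mul], rfl⟩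

/-- The linear map underlying `sec`. -/
def secHom (n : ℕ) : quasiPeriodic ((T.g ^ (n + 1)) 1 0) 1 →ₗ[ℂ] T.piece (n + 1) where
  toFun u := ⟨_, T.gauss_mem_piece n u.2⟩
  map_add' u v := Subtype.ext <| by
    funext α x
    exact add_mul _ _ _
  map_smul' z u := Subtype.ext <| by
    funext α x
    exact mul_assoc _ _ _

lemma secHom_bijective (n : ℕ) : Function.Bijective (T.secHom n) := by
  constructor
  · intro u v h
    apply Subtype.ext
    funext α
    have h1 := congrFun (congrFun (congrArg Subtype.val h) α) 0
    change u.1 α * Complex.exp (_ * ((0 : ℝ) : ℂ) ^ 2) =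
      v.1 α * Complex.exp (_ * ((0 : ℝ) : ℂ) ^ 2) at h1
    simpa using h1
  · rintro ⟨f, hf⟩
    obtain ⟨u, hu, rfl⟩ :=
      (mem_holSections_iff (T.pow_pos n).1 (T.pow_pos n).2 T.im_neg f).1 hf
    exact ⟨⟨u, fun α => by rw [hu α, one_mul]⟩, rfl⟩

/-- The holomorphic section of degree `n + 1` with given values at `x = 0`. -/
def sec (n : ℕ) : quasiPeriodic ((T.g ^ (n + 1)) 1 0) 1 ≃ₗ[ℂ] T.piece (n + 1) :=
  LinearEquiv.ofBijective (T.secHom n) (T.secHom_bijective n)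

lemma basisSection_eq (i : Fin T.deg) : basisSection T.g T.θ T.τ (idx i) = fun α (x : ℝ) =>
    T.delta i α * Complex.exp (-gaussExp T.g T.θ T.τ * (x : ℂ) ^ 2) := by
  funext α x
  have h : α ≡ idx i [ZMOD T.g 1 0] ↔ T.g 1 0 ∣ α - idx i := by
    rw [Int.modEq_comm, Int.modEq_iff_dvd]
  simp only [basisSection, delta_apply, h, ite_mul, one_mul, zero_mul]
  rfl

lemma basisSection_mem_piece (i : Fin T.deg) : basisSection T.g T.θ T.τ (idx i) ∈ T.piece 1 := by
  have h := basisSection_mem T.deg_pos T.aut_pos T.im_neg (idx i)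
  have e : T.g ^ (0 + 1) = T.g := by simp
  change _ ∈ holSections (T.g ^ (0 + 1)) T.θ T.τ
  rw [e]
  exact h

/-- Left multiplication by `φ_i` in the homogeneous coordinate ring. -/
def mulGen (n : ℕ) (i : Fin T.deg) : T.piece n →ₗ[ℂ] T.piece (n + 1) where
  toFun f := ⟨T.mulFun 1 n (basisSection T.g T.θ T.τ (idx i)) f, by
    have := T.mulFun_mem (T.basisSection_mem_piece i) f.2
    rwa [add_comm 1 n] at this⟩
  map_add' f h := Subtype.ext (T.mulFun_add_right (T.basisSection_mem_piece i) f.2 h.2)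
  map_smul' z f := Subtype.ext (T.mulFun_smul_right 1 n z _ f.1)

lemma mulGen_sec (n : ℕ) (i : Fin T.deg) (f : quasiPeriodic ((T.g ^ (n + 1)) 1 0) 1) :
    T.mulGen (n + 1) i (T.sec n f) = T.sec (n + 1) (T.lmulHom n i f) := by
  apply Subtype.ext
  have h := pairing_gauss (g₁ := T.g) (τ := T.τ) T.deg_pos (T.pow_pos n).1 (T.pow_pos n).2
    (by rw [T.moebius_pow]; exact T.aut_pos) (T.delta i) f.1
  rw [T.moebius_pow, ← basisSection_eq, ← _root_.pow_succ', ← twMul_zero] at h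
  have e : T.g ^ (0 + 1) = T.g := by simp
  change pairing (T.g ^ (0 + 1)) (T.g ^ (n + 1)) T.θ _ _ = _
  rw [e]
  exact h

/-- The constant function `1`, in degree zero. -/
def onePiece : T.piece 0 := ⟨1, Submodule.mem_span_singleton_self _⟩

lemma exists_eq_smul_onePiece (y : T.piece 0) : ∃ z : ℂ, y = z • T.onePiece := by
  obtain ⟨z, hz⟩ := T.mem_piece_zero y.2
  exact ⟨z, Subtype.ext hz⟩

lemma onePiece_ne_zero : T.onePiece ≠ 0 := fun h => by
  have := congrFun (congrFun (congrArg Subtype.val h) 0) 0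
  exact one_ne_zero this

lemma quasiPeriodic_pow_one :
    quasiPeriodic ((T.g ^ (0 + 1)) 1 0) 1 = quasiPeriodic (T.g 1 0) 1 := by
  rw [zero_add, _root_.pow_one]

lemma delta_mem' (i : Fin T.deg) : T.delta i ∈ quasiPeriodic ((T.g ^ (0 + 1)) 1 0) 1 :=
  T.quasiPeriodic_pow_one ▸ T.delta_mem i

lemma mulGen_onePiece (i : Fin T.deg) :
    T.mulGen 0 i T.onePiece = T.sec 0 ⟨T.delta i, T.delta_mem' i⟩ := by
  apply Subtype.ext
  have e : T.g ^ (0 + 1) = T.g := by simp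
  have h : T.mulFun 1 0 (basisSection T.g T.θ T.τ (idx i)) ((1 : ℂ) • 1) =
      (1 : ℂ) • _ :=
    T.mulFun_zero_right 1 1 _
  rw [one_smul, one_smul] at h
  have h2 : basisSection T.g T.θ T.τ (idx i) = fun α (x : ℝ) =>
      T.delta i α * Complex.exp (-gaussExp (T.g ^ (0 + 1)) T.θ T.τ * (x : ℂ) ^ 2) := by
    rw [e, basisSection_eq]
  exact h.trans h2

/-- The sections `φ_i` generate the homogeneous coordinate ring. -/
lemma exists_eq_sum_mulGen (n : ℕ) (y : T.piece (n + 1)) :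
    ∃ w : Fin T.deg → T.piece n, y = ∑ i, T.mulGen n i (w i) := by
  obtain ⟨u, rfl⟩ := (T.sec n).surjective y
  rcases n with _ | n
  · refine ⟨fun i => u.1 (idx i) • T.onePiece, ?_⟩
    simp only [map_smul, mulGen_onePiece]
    simp only [← map_smul, ← map_sum]
    congr 1
    apply Subtype.ext
    rw [Submodule.coe_sum]
    exact (T.sum_smul_delta (T.quasiPeriodic_pow_one.le u.2)).symm
  · obtain ⟨w, rfl⟩ := T.mulHom_surjective n u
    refine ⟨fun i => T.sec n (w i), ?_⟩
    simp only [mulGen_sec, ← map_sum]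
    congr 1
    simp [mulHom]

lemma eq_zero_of_sum_mulGen_zero (w : Fin T.deg → T.piece 0)
    (hw : ∑ i, T.mulGen 0 i (w i) = 0) : w = 0 := by
  choose z hz using fun i => T.exists_eq_smul_onePiece (w i)
  simp only [hz, map_smul, mulGen_onePiece] at hw
  simp only [← map_smul, ← map_sum] at hw
  rw [LinearEquiv.map_eq_zero_iff] at hw
  funext i
  have h := congrFun (congrArg Subtype.val hw) (idx i)
  rw [Submodule.coe_sum, Finset.sum_apply, Finset.sum_eq_single i] at h
  · have h1 : z i * T.delta i (idx i) = 0 := h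
    rw [delta_apply, sub_self, if_pos (dvd_zero _), mul_one] at h1
    rw [hz, h1, zero_smul]; rfl
  · intro j _ hj
    change z j * T.delta j (idx i) = 0
    rw [delta_apply, if_neg fun hd => hj (T.eq_of_dvd_idx_sub_idx hd).symm, mul_zero]
  · simp

variable {σ : Fin T.deg → Equiv.Perm (Fin T.deg)}

/-- The syzygies between the `φ_i` follow from the quadratic relations. -/
lemma mem_span_of_sum_mulGen_eq_zero (hσ : ∀ μ, T.F μ (fun i => σ μ (T.firstCol i)) ≠ 0) (n : ℕ)
    (w : Fin T.deg → T.piece (n + 1)) (hw : ∑ i, T.mulGen (n + 1) i (w i) = 0) :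
    w ∈ Submodule.span ℂ {w' | ∃ (r : Fin T.deg → Fin T.deg → ℂ) (z : T.piece n),
      ∑ i, ∑ j, r i j • (T.gen σ i * T.gen σ j) = 0 ∧
        w' = fun i => ∑ j, r i j • T.mulGen n j z} := by
  obtain ⟨u, rfl⟩ : ∃ u : Fin T.deg → quasiPeriodic ((T.g ^ (n + 1)) 1 0) 1,
      w = fun i => T.sec n (u i) :=
    ⟨fun i => (T.sec n).symm (w i), funext fun i => ((T.sec n).apply_symm_apply _).symm⟩
  simp only [mulGen_sec, ← map_sum] at hw
  rw [LinearEquiv.map_eq_zero_iff] at hw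
  rcases n with _ | n
  · apply Submodule.subset_span
    have hu : ∀ i, (u i).1 ∈ quasiPeriodic (T.g 1 0) 1 := fun i =>
      T.quasiPeriodic_pow_one.le (u i).2
    have hur : ∀ i, u i = ∑ j, (u i).1 (idx j) • (⟨T.delta j, T.delta_mem' j⟩ :
        quasiPeriodic ((T.g ^ (0 + 1)) 1 0) 1) := fun i => Subtype.ext <| by
      rw [Submodule.coe_sum]
      exact (T.sum_smul_delta (hu i)).symm
    refine ⟨fun i j => (u i).1 (idx j), T.onePiece, T.sum_smul_gen_eq_zero hσ ?_, ?_⟩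
    · have h : ∀ i, ∑ j, (u i).1 (idx j) • T.lmul 1 i (T.delta j) = T.lmulHom 0 i (u i) := by
        intro i
        conv_rhs => rw [hur i, map_sum, Submodule.coe_sum]
        refine Finset.sum_congr rfl fun j _ => ?_
        rw [map_smul]
        rfl
      simp only [h]
      rw [← Submodule.coe_sum, hw]
      rfl
    · funext i
      conv_lhs => rw [hur i]
      simp only [mulGen_onePiece, map_sum, map_smul]
  · have h := T.mem_span_of_mulHom_eq_zero n (w := u) (by rw [← hw]; simp [mulHom])
    have h1 := Submodule.mem_map_of_mem
      (f := LinearMap.pi fun i => (T.sec (n + 1)).toLinearMap ∘ₗ LinearMap.proj i) h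
    rw [Submodule.map_span] at h1
    refine Submodule.span_mono ?_ h1
    rintro _ ⟨_, ⟨r, z, hr, rfl⟩, rfl⟩
    refine ⟨r, T.sec n z, T.sum_smul_gen_eq_zero hσ hr, ?_⟩
    funext i
    simp only [mulGen_sec, LinearMap.pi_apply, LinearMap.comp_apply, LinearMap.proj_apply,
      LinearEquiv.coe_coe, map_sum, map_smul]

/-! ### The presentation -/

lemma phi_mul_of (n : ℕ) (i : Fin T.deg) (y : T.piece n) :
    T.φ i * DirectSum.of (fun n => T.piece n) n y =
      DirectSum.of (fun n => T.piece n) (n + 1) (T.mulGen n i y) := by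
  rw [φ, DirectSum.of_mul_of]
  exact DirectSum.of_eq_of_gradedMonoid_eq (T.gradedMonoid_ext (add_comm 1 n) rfl)

lemma of_onePiece : DirectSum.of (fun n => T.piece n) 0 T.onePiece = 1 := rfl

lemma of_smul (n : ℕ) (z : ℂ) (y : T.piece n) : DirectSum.of (fun n => T.piece n) n (z • y) =
    z • DirectSum.of (fun n => T.piece n) n y :=
  (DirectSum.lof ℂ ℕ (fun n => T.piece n) n).map_smul z y

/-- The `φ_i` satisfy the relations `f^μ_k`. -/
lemma lift_phi_rel (μ : Fin T.deg) (k : Fin (T.deg - T.tr)) :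
    FreeAlgebra.lift ℂ T.φ (T.rel μ (σ μ) k) = 0 := by
  have h1 : ∀ j, T.φ j = DirectSum.of (fun n => T.piece n) 1
      (T.sec 0 ⟨T.delta j, T.delta_mem' j⟩) := by
    intro j
    rw [← mulGen_onePiece, ← phi_mul_of, of_onePiece]
    exact (mul_one (T.φ j)).symm
  rw [rel, map_sum]
  simp only [map_smul, map_mul, FreeAlgebra.lift_ι_apply]
  have h2 : ∀ i j, T.φ i * T.φ j = DirectSum.of (fun n => T.piece n) 2
      (T.sec 1 (T.lmulHom 0 i ⟨T.delta j, T.delta_mem' j⟩)) := by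
    intro i j
    rw [h1 j, phi_mul_of, mulGen_sec]
  simp only [h2, ← of_smul, ← (T.sec 1).map_smul, ← map_sum]
  have h3 : ∑ j, T.v μ (σ μ) k j • T.lmulHom 0 (T.α μ j) ⟨T.delta j, T.delta_mem' j⟩ = 0 := by
    apply Subtype.ext
    rw [Submodule.coe_sum]
    exact T.sum_v_smul_lmul μ (σ μ) k
  rw [h3, map_zero, map_zero]

/-- The homomorphism from the algebra defined by the quadratic relations. -/
def presentation (σ : Fin T.deg → Equiv.Perm (Fin T.deg)) : T.Presented σ →ₐ[ℂ] T.CoordRing :=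
  RingQuot.liftAlgHom ℂ ⟨FreeAlgebra.lift ℂ T.φ, by
    rintro _ _ ⟨⟨μ, k, rfl⟩, rfl⟩
    rw [T.lift_phi_rel, map_zero]⟩

lemma presentation_mk (p : FreeAlgebra ℂ (Fin T.deg)) :
    T.presentation σ (RingQuot.mkAlgHom ℂ _ p) = FreeAlgebra.lift ℂ T.φ p :=
  RingQuot.liftAlgHom_mkAlgHom_apply _ _ _ _

lemma presentation_gen (i : Fin T.deg) : T.presentation σ (T.gen σ i) = T.φ i := by
  rw [gen, presentation_mk, FreeAlgebra.lift_ι_apply]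

lemma presentation_surjective : Function.Surjective (T.presentation σ) := by
  rw [← AlgHom.range_eq_top, eq_top_iff]
  rintro b -
  induction b using DirectSum.induction_on with
  | zero => exact zero_mem _
  | add a b ha hb => exact add_mem ha hb
  | of n y =>
    induction n with
    | zero =>
      obtain ⟨z, rfl⟩ := T.exists_eq_smul_onePiece y
      rw [of_smul, of_onePiece]
      exact Subalgebra.smul_mem _ (one_mem _) z
    | succ n ih =>
      obtain ⟨w, rfl⟩ := T.exists_eq_sum_mulGen n y
      rw [map_sum]
      refine sum_mem fun i _ => ?_
      rw [← phi_mul_of]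
      exact mul_mem ⟨T.gen σ i, T.presentation_gen i⟩ (ih _)

/-- Since all syzygies follow from the quadratic relations, the assignment of the product of the
generators `x_{i₁}, …, x_{iₙ}` to `φ_{i₁} ⋯ φ_{iₙ}` is well defined; it is a left inverse of
`presentation`. -/
lemma presentation_injective (hσ : ∀ μ, T.F μ (fun i => σ μ (T.firstCol i)) ≠ 0) :
    Function.Injective (T.presentation σ) := by
  have h0 : Function.Surjective (LinearMap.toSpanSingleton ℂ (T.piece 0) T.onePiece) := fun y => by
    obtain ⟨z, rfl⟩ := T.exists_eq_smul_onePiece y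
    exact ⟨z, rfl⟩
  have h0' : Function.Injective (LinearMap.toSpanSingleton ℂ (T.piece 0) T.onePiece) :=
    smul_left_injective ℂ T.onePiece_ne_zero
  let e := LinearEquiv.ofBijective _ ⟨h0', h0⟩
  have he : e.symm T.onePiece = 1 := by
    rw [LinearEquiv.symm_apply_eq]
    exact (one_smul ℂ _).symm
  obtain ⟨ψ, hψ0, hψ⟩ := exists_linearMap_of_quadratic (A := T.Presented σ) (T.gen σ) T.mulGen
    T.exists_eq_sum_mulGen T.eq_zero_of_sum_mulGen_zero (T.mem_span_of_sum_mulGen_eq_zero hσ)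
    (LinearMap.toSpanSingleton ℂ (T.Presented σ) 1 ∘ₗ e.symm.toLinearMap)
  -- the left inverse of `presentation`
  let Ψ : T.CoordRing →ₗ[ℂ] T.Presented σ := DirectSum.toModule ℂ ℕ _ ψ
  have hof : ∀ n y, Ψ (DirectSum.of (fun n => T.piece n) n y) = ψ n y := fun n y =>
    DirectSum.toModule_lof (φ := ψ) ℂ n y
  have hΨ1 : Ψ 1 = 1 := by
    rw [← of_onePiece, hof, hψ0, LinearMap.comp_apply, LinearEquiv.coe_coe, he,
      LinearMap.toSpanSingleton_apply, one_smul]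
  have hΨφ : ∀ i b, Ψ (T.φ i * b) = T.gen σ i * Ψ b := by
    intro i b
    induction b using DirectSum.induction_on with
    | zero => rw [(DirectSum.semiring fun n => T.piece n).mul_zero, map_zero, mul_zero]
    | add a b ha hb =>
      rw [(DirectSum.semiring fun n => T.piece n).left_distrib, map_add, map_add, ha, hb, mul_add]
    | of n y => rw [phi_mul_of, hof, hof, hψ]
  refine Function.LeftInverse.injective (g := Ψ) fun a => ?_
  obtain ⟨p, rfl⟩ := RingQuot.mkAlgHom_surjective ℂ _ a
  have hmk : FreeAlgebra.lift ℂ (T.gen σ) = RingQuot.mkAlgHom ℂ _ :=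
    FreeAlgebra.hom_ext (funext fun i => FreeAlgebra.lift_ι_apply _ _)
  have hp := map_lift_mul_of_map_mul Ψ hΨφ p (1 : T.CoordRing)
  rw [hΨ1, mul_one, hmk, (DirectSum.semiring fun n => T.piece n).mul_one] at hp
  rw [presentation_mk]
  exact hp

theorem exists_algEquiv (hσ : ∀ μ, T.F μ (fun i => σ μ (T.firstCol i)) ≠ 0) :
    ∃ e : T.Presented σ ≃ₐ[ℂ] T.CoordRing, ∀ i, e (T.gen σ i) = T.φ i :=
  ⟨AlgEquiv.ofBijective (T.presentation σ) ⟨T.presentation_injective hσ,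
    T.presentation_surjective⟩, T.presentation_gen⟩

end RMTorus

end NCTorus

end

theorem mainTheorem1 (T : NCTorus.RMTorus) :
    (∀ μ, ∃ σ : Equiv.Perm (Fin T.deg), T.F μ (fun i => σ (T.firstCol i)) ≠ 0) ∧
    (Odd T.tr → ∀ μ, T.F μ T.firstCol ≠ 0) ∧
    ∀ σ : Fin T.deg → Equiv.Perm (Fin T.deg),
      (∀ μ, T.F μ (fun i => σ μ (T.firstCol i)) ≠ 0) →
        ∃ e : T.Presented σ ≃ₐ[ℂ] T.CoordRing, ∀ i, e (T.gen σ i) = T.φ i :=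
  ⟨T.exists_perm_F_ne_zero, T.F_firstCol_ne_zero, fun _ => T.exists_algEquiv⟩
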